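/- **Setting.** Let $d\ge 1$ and let $C\subset\mathbb{R}^d$ be a bounded Borel set with $|C|=1$ and $|\partial C|=0$, where $|\cdot|$ is Lebesgue measure. Let $F$ be the distribution of a positive random variable $V$ with $\mathbb{E}V=1$, put $\bar F=1-F$, and assume that $V$ has a regularly varying tail of index $\gamma\in(1,2)$, that is, $\bar F(av)/\bar F(v)\to a^{-\gamma}$ as $v\to\infty$ for every $a>0$. For $\lambda,\rho>0$ let $F_\rho(v)=F(v/\rho)$, $\bar F_\rho=1-F_\rho$, let $(1/\bar F_\rho)^{\leftarrow}(u)=\inf\{v\ge 0:1/\bar F_\rho(v)\ge u\}$, let $N_{\lambda,\rho}$ be a Poisson random measure on $\mathbb{R}^d\times(0,\infty)$ with intensity $\lambda\,dx\,F_\rho(dv)$, and for a finite signed Borel measure $\phi$ on $\mathbb{R}^d$ let $$J_{\lambda,\rho}(\phi)=\int\!\!\int \phi(x+v^{1/d}C)\,N_{\lambda,\rho}(dx,dv).$$ A function $\phi\in L^1(\mathbb{R}^d)$ is identified with the measure $\phi(x)\,dx$. For $\alpha\in(0,1)$ let $M^\alpha$ be the set of finite signed measures $\phi$ with $\int\!\!\int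 |x-y|^{-(1-\alpha)d}\,|\phi|(dx)\,|\phi|(dy)<\infty$. **Theorem 2.** Let $\alpha\in(0,2-\gamma)$. As $\lambda\to\infty$ and $\rho\to0$, the following limits hold in the sense of finite-dimensional distributions of random functionals. (i) There is a centred Gaussian random linear functional $W_{\gamma,C}$ on $M^{2-\gamma}$ with $$\mathbb{E}\,W_{\gamma,C}(\phi)W_{\gamma,C}(\psi)=\int\!\!\int\phi(dx)\,K_{\gamma,C}(x-y)\,\psi(dy),\qquad K_{\gamma,C}(x)=\int_0^\infty |(v^{-1/d}x+C)\cap C|\,v^{-\gamma}\,dv,$$ and if $\lambda\bar F_\rho(1)\to\infty$, then $$\frac{J_{\lambda,\rho}(\phi)-\mathbb{E}J_{\lambda,\rho}(\phi)}{(\gamma\lambda\bar F_\rho(1))^{1/2}}\longrightarrow W_{\gamma,C}(\phi),\qquad \phi\in M^\alpha .$$ (ii) Let $N_\gamma$ be a Poisson random measure on $\mathbb{R}^d\times(0,\infty)$ with intensity $dx\,v^{-\gamma-1}dv$. For every $\phi\in M^{2-\gamma}$ the centred integral $$J^*_{\gamma,C}(\phi)=\int\!\!\int \phi(x+v^{1/d}C)\,\bigl(N_\gamma(dx,dv)-dx\,v^{-\gamma-1}dv\bigr)$$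 exists as a limit in probability, and if $\lambda\bar F_\rho(1)\to\sigma_0>0$, then $$J_{\lambda,\rho}(\phi)-\mathbb{E}J_{\lambda,\rho}(\phi)\longrightarrow J^*_{\gamma,C}(\phi_\sigma),\qquad \phi\in M^\alpha,$$ where $\phi_\sigma(A)=\phi(\sigma A)$ and $\sigma=(\gamma\sigma_0)^{1/((\gamma-1)d)}$. (iii) If $\lambda\bar F_\rho(1)\to0$, then $$\frac{J_{\lambda,\rho}(\phi)-\mathbb{E}J_{\lambda,\rho}(\phi)}{c_\gamma\,(1/\bar F_\rho)^{\leftarrow}(\gamma\lambda)}\longrightarrow \Lambda_\gamma(\phi),\qquad \phi\in L^1\cap L^2,$$ where $c_\gamma=\bigl(-\tfrac{\Gamma(2-\gamma)}{\gamma(\gamma-1)}\cos(\tfrac{\pi\gamma}{2})\bigr)^{1/\gamma}$ and $\Lambda_\gamma$ is the independently scattered $\gamma$-stable random measure on $\mathbb{R}^d$ with unit skewness and Lebesgue control measure, that is, the random linear functional on $L^\gamma$ with $$\mathbb{E}e^{i\Lambda_\gamma(\phi)}=\exp\Bigl(-\sigma_\phi^\gamma\bigl(1-i\beta_\phi\tan(\tfrac{\pi\gamma}{2})\bigr)\Bigr),\qquad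 \sigma_\phi=\|\phi\|_\gamma,\quad \beta_\phi=\|\phi\|_\gamma^{-\gamma}\bigl(\|\phi_+\|_\gamma^\gamma-\|\phi_-\|_\gamma^\gamma\bigr),$$ with $\phi_+=\max(\phi,0)$, $\phi_-=-\min(\phi,0)$ (and $\beta_\phi=0$ if $\phi=0$ almost everywhere). -/

import Mathlib

open MeasureTheory ProbabilityTheory Filter Set
open scoped Topology ENNReal NNReal

noncomputable section

/-! ### Poisson random measures and their centred integrals -/

/-- `N` is a Poisson random measure on `S` with intensity measure `η`, defined on the probability
space `(Ω, P)`: a random measure whose values on sets of finite intensity are Poisson distributed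
and whose values on disjoint sets are independent. -/
structure IsPoissonRandomMeasure {S Ω : Type*} [MeasurableSpace S] [MeasurableSpace Ω]
    (N : Ω → Measure S) (η : Measure S) (P : Measure Ω) : Prop where
  measurable : Measurable N
  map_eq : ∀ A : Set S, MeasurableSet A → η A ≠ ∞ →
    P.map (fun ω => N ω A) = (poissonMeasure (η A).toNNReal).map (fun k : ℕ => (k : ℝ≥0∞))
  indep : ∀ (n : ℕ) (A : Fin n → Set S), (∀ k, MeasurableSet (A k)) →
    Pairwise (fun j k => Disjoint (A j) (A k)) → iIndepFun (fun k ω => N ω (A k)) P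

/-- `X` is the centred integral `∫ f (dN - dη)`: for every sequence of `η`-integrable functions
`g n` that is dominated by `|f|` and converges to `f`, the random variables
`∫ g n dN - ∫ g n dη` converge to `X` in probability. -/
def IsCentredPoissonIntegral {S Ω : Type*} [MeasurableSpace S] [MeasurableSpace Ω]
    (N : Ω → Measure S) (η : Measure S) (P : Measure Ω) (f : S → ℝ) (X : Ω → ℝ) : Prop :=
  AEMeasurable X P ∧
    ∀ g : ℕ → S → ℝ, (∀ n, Measurable (g n)) → (∀ n, Integrable (g n) η) →
      (∀ n, ∀ᵐ s ∂η, |g n s| ≤ |f s|) →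
      (∀ᵐ s ∂η, Tendsto (fun n => g n s) atTop (𝓝 (f s))) →
      TendstoInMeasure P (fun n ω => (∫ s, g n s ∂(N ω)) - ∫ s, g n s ∂η) atTop X

open Classical in
/-- The centred integral `∫ f (dN - dη)` as a random variable (zero if it does not exist). -/
def centredPoissonIntegral {S Ω : Type*} [MeasurableSpace S] [MeasurableSpace Ω]
    (N : Ω → Measure S) (η : Measure S) (P : Measure Ω) (f : S → ℝ) : Ω → ℝ :=
  if h : ∃ X : Ω → ℝ, IsCentredPoissonIntegral N η P f X then h.choose else 0

/-! ### Convergence of finite-dimensional distributions -/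

/-- The random functionals `X i` on `(Ω i, P i)` converge along `l` to the random functional `Y` on
`(Ω', Q)`, in the sense of finite-dimensional distributions over the index set `A`. -/
def TendstoFDD {ι T Ω' : Type*} {Ω : ι → Type*} [∀ i, MeasurableSpace (Ω i)] [MeasurableSpace Ω']
    (A : Set T) (X : (i : ι) → T → Ω i → ℝ) (l : Filter ι) (Y : T → Ω' → ℝ)
    (P : (i : ι) → Measure (Ω i)) [∀ i, IsProbabilityMeasure (P i)]
    (Q : Measure Ω') [IsProbabilityMeasure Q] : Prop :=
  ∀ (n : ℕ) (t : Fin n → T), (∀ k, t k ∈ A) →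
    TendstoInDistribution (fun i ω => fun k : Fin n => X i (t k) ω) l
      (fun ω => fun k : Fin n => Y (t k) ω) P Q

/-! ### The volume distribution -/

/-- The tail `v ↦ F((v, ∞))` of a probability distribution `F` on the line. -/
def tail (F : Measure ℝ) (v : ℝ) : ℝ := F.real (Ioi v)

/-- The tail of `F` is regularly varying with exponent `γ`. -/
def HasRegularlyVaryingTail (F : Measure ℝ) (γ : ℝ) : Prop :=
  ∀ a : ℝ, 0 < a → Tendsto (fun v => tail F (a * v) / tail F v) atTop (𝓝 (a ^ (-γ)))

/-- The distribution `F_ρ(v) = F(v / ρ)`, that is, the law of `ρ V` when `V` has the law `F`. -/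
def scaledLaw (F : Measure ℝ) (ρ : ℝ) : Measure ℝ := F.map (fun v => ρ * v)

/-- The quantile function `(1 / F̄)^←(u) = inf {v ≥ 0 : 1 / F̄(v) ≥ u}`. -/
def tailQuantile (F : Measure ℝ) (u : ℝ) : ℝ := sInf {v : ℝ | 0 ≤ v ∧ u ≤ 1 / tail F v}

/-! ### Grains, test measures and the grain field -/

section Grain

variable {d : ℕ}

/-- The grain `x + v ^ (1 / d) C`, of location `x` and volume `v`. -/
def grain (C : Set (EuclideanSpace ℝ (Fin d))) (x : EuclideanSpace ℝ (Fin d)) (v : ℝ) :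
    Set (EuclideanSpace ℝ (Fin d)) :=
  (fun c => x + v ^ (1 / (d : ℝ)) • c) '' C

/-- The intensity `λ dx F_ρ(dv)` of grain locations and grain volumes. -/
def grainIntensity (d : ℕ) (F : Measure ℝ) (lam ρ : ℝ) :
    Measure (EuclideanSpace ℝ (Fin d) × ℝ) :=
  ENNReal.ofReal lam • (volume : Measure (EuclideanSpace ℝ (Fin d))).prod (scaledLaw F ρ)

/-- The intensity `dx v ^ (-γ - 1) dv` on `ℝ^d × (0, ∞)`. -/
def stableIntensity (d : ℕ) (γ : ℝ) : Measure (EuclideanSpace ℝ (Fin d) × ℝ) :=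
  (volume : Measure (EuclideanSpace ℝ (Fin d))).prod
    ((volume.restrict (Ioi (0 : ℝ))).withDensity fun v => ENNReal.ofReal (v ^ (-γ - 1)))

/-- The grain field `J(φ) = ∫ φ(x + v ^ (1 / d) C) N(dx, dv)`. -/
def grainField {Ω : Type*} (C : Set (EuclideanSpace ℝ (Fin d)))
    (N : Ω → Measure (EuclideanSpace ℝ (Fin d) × ℝ))
    (φ : SignedMeasure (EuclideanSpace ℝ (Fin d))) (ω : Ω) : ℝ :=
  ∫ p, φ (grain C p.1 p.2) ∂(N ω)

/-- The centred grain field `J(φ) - 𝔼 J(φ)`. -/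
def centredGrainField {Ω : Type*} [MeasurableSpace Ω] (C : Set (EuclideanSpace ℝ (Fin d)))
    (N : Ω → Measure (EuclideanSpace ℝ (Fin d) × ℝ)) (P : Measure Ω)
    (φ : SignedMeasure (EuclideanSpace ℝ (Fin d))) (ω : Ω) : ℝ :=
  grainField C N φ ω - ∫ ω', grainField C N φ ω' ∂P

/-- The space `M^α` of finite signed measures `φ` on `ℝ^d` such that
`∫∫ |φ|(dx) |φ|(dy) / |x - y| ^ ((1 - α) d)` is finite. -/
def rieszSpace (d : ℕ) (α : ℝ) : Set (SignedMeasure (EuclideanSpace ℝ (Fin d))) :=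
  {φ | ∫⁻ x, ∫⁻ y, ‖x - y‖ₑ ^ (-((1 - α) * d)) ∂φ.totalVariation ∂φ.totalVariation < ∞}

/-- The dilatation `φ_s(A) = φ(s A)`, for `s > 0`. -/
def dilate (s : ℝ) (φ : SignedMeasure (EuclideanSpace ℝ (Fin d))) :
    SignedMeasure (EuclideanSpace ℝ (Fin d)) :=
  φ.map (fun x => s⁻¹ • x)

/-! ### The limits -/

/-- The kernel `K_{γ,C}(x) = ∫_0^∞ |(v ^ (-1 / d) x + C) ∩ C| v ^ (-γ) dv`. It is used for `x ≠ 0`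
only (at `x = 0` the integral diverges). -/
def grainKernel (γ : ℝ) (C : Set (EuclideanSpace ℝ (Fin d))) (x : EuclideanSpace ℝ (Fin d)) : ℝ :=
  ∫ v in Ioi (0 : ℝ),
    volume.real (((fun c => v ^ (-(1 / (d : ℝ))) • x + c) '' C) ∩ C) * v ^ (-γ)

/-- `W` is the centred Gaussian random linear functional `W_{γ,C}` on `M^{2 - γ}` with covariance
`𝔼 W(φ) W(ψ) = ∫∫ φ(dx) K_{γ,C}(x - y) ψ(dy)`. -/
structure IsLargeGrainLimit {Ω : Type*} [MeasurableSpace Ω] (γ : ℝ)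
    (C : Set (EuclideanSpace ℝ (Fin d)))
    (W : SignedMeasure (EuclideanSpace ℝ (Fin d)) → Ω → ℝ) (P : Measure Ω) : Prop where
  linear : ∀ φ ∈ rieszSpace d (2 - γ), ∀ ψ ∈ rieszSpace d (2 - γ), ∀ a b : ℝ,
    W (a • φ + b • ψ) =ᵐ[P] fun ω => a * W φ ω + b * W ψ ω
  gaussian : IsGaussianProcess (fun φ : rieszSpace d (2 - γ) => W φ) P
  mean_eq : ∀ φ ∈ rieszSpace d (2 - γ), ∫ ω, W φ ω ∂P = 0
  cov_eq : ∀ φ ∈ rieszSpace d (2 - γ), ∀ ψ ∈ rieszSpace d (2 - γ),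
    ∫ ω, W φ ω * W ψ ω ∂P = ∫ᵛ x, (∫ᵛ y, grainKernel γ C (x - y) ∂<•ψ) ∂<•φ

/-- The functional `J*_{γ,C}(φ) = ∫∫ φ(x + v ^ (1 / d) C) (N(dx, dv) - dx v ^ (-γ - 1) dv)`. -/
def intermediateField {Ω : Type*} [MeasurableSpace Ω] (γ : ℝ)
    (C : Set (EuclideanSpace ℝ (Fin d))) (N : Ω → Measure (EuclideanSpace ℝ (Fin d) × ℝ))
    (P : Measure Ω) (φ : SignedMeasure (EuclideanSpace ℝ (Fin d))) : Ω → ℝ :=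
  centredPoissonIntegral N (stableIntensity d γ) P (fun p => φ (grain C p.1 p.2))

/-- The norm of `φ` in `L^γ(ℝ^d)`. -/
def stableNorm (γ : ℝ) (φ : EuclideanSpace ℝ (Fin d) → ℝ) : ℝ :=
  (eLpNorm φ (ENNReal.ofReal γ) volume).toReal

/-- The skewness `‖φ‖_γ ^ (-γ) (‖φ₊‖_γ ^ γ - ‖φ₋‖_γ ^ γ)`. -/
def stableSkewness (γ : ℝ) (φ : EuclideanSpace ℝ (Fin d) → ℝ) : ℝ :=
  stableNorm γ φ ^ (-γ) *
    (stableNorm γ (fun x => max (φ x) 0) ^ γ - stableNorm γ (fun x => -min (φ x) 0) ^ γ)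

/-- `Λ` is the independently scattered `γ`-stable random measure on `ℝ^d` with unit skewness and
Lebesgue control measure: the random linear functional on `L^γ` with
`𝔼 exp(i Λ(φ)) = exp(-σ_φ ^ γ (1 - i β_φ tan(π γ / 2)))`. -/
structure IsStableRandomMeasure {Ω : Type*} [MeasurableSpace Ω] (γ : ℝ)
    (Λ : (EuclideanSpace ℝ (Fin d) → ℝ) → Ω → ℝ) (P : Measure Ω) : Prop where
  aemeasurable : ∀ φ, MemLp φ (ENNReal.ofReal γ) volume → AEMeasurable (Λ φ) P
  linear : ∀ φ ψ, MemLp φ (ENNReal.ofReal γ) volume → MemLp ψ (ENNReal.ofReal γ) volume →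
    ∀ a b : ℝ, Λ (a • φ + b • ψ) =ᵐ[P] fun ω => a * Λ φ ω + b * Λ ψ ω
  charFun_eq : ∀ φ, MemLp φ (ENNReal.ofReal γ) volume →
    ∫ ω, Complex.exp (Complex.I * (Λ φ ω : ℂ)) ∂P =
      Complex.exp (-((stableNorm γ φ ^ γ : ℝ) : ℂ) *
        (1 - Complex.I * ((stableSkewness γ φ * Real.tan (Real.pi * γ / 2) : ℝ) : ℂ)))

/-- The constant `c_γ = (-(Γ(2 - γ) / (γ (γ - 1))) cos(π γ / 2)) ^ (1 / γ)`. -/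
def stableConst (γ : ℝ) : ℝ :=
  (-(Real.Gamma (2 - γ) / (γ * (γ - 1)) * Real.cos (Real.pi * γ / 2))) ^ (1 / γ)

end Grain

end

/-! Everything is read off from characteristic functions. For a Poisson random measure of intensity
`η` and `f` integrable, the compensated integral of `f` has characteristic function exp ∫ Ψ(f) dη,
where Ψ(y) = e^{iy} - 1 - iy is `compExp`. A linear combination of the centred fields J(φ_k) is the
centred field of φ = ∑ t_k φ_k. By Lévy's continuity theorem each regime therefore reduces to one
limit, that of λ ∫∫ Ψ(φ(x + v^{1/d} C) / b) dx F_ρ(dv), where b is the normalisation.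

The limit in the volume variable is `tendsto_integral_rescaled`: F̄(x)⁻¹ ∫ g(v/x) F(dv) tends to ∫
g(v) γ v^{-γ-1} dv as x → ∞, and g may vary along the limit, as soon as |g(v)| ≤ K min(v, v^{γ'})
for some γ' > γ > 1. To see this, write F as the law of q(U) with U uniform on (0,1) and q(u) =
(1/F̄)^←(1/u), and substitute u = F̄(x) w. Regular variation gives q(F̄(x) w)/x → w^{-1/γ}, and the
Potter bounds give an integrable majorant.

The two growth bounds are geometric. Integrating over the centre x, Fubini gives ∫ |φ(x + v^{1/d}
C)| dx ≤ v ‖φ‖. The second moment is v times the integral of the overlap |(v^{-1/d}(y-z) + C) ∩ C|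
against |φ| ⊗ |φ|. The overlap is at most a constant times v^{1-α} |y-z|^{-(1-α)d}, so φ ∈ M^α
yields growth v^{2-α}, and 2 - α > γ is exactly α < 2 - γ. For an L² density, Cauchy–Schwarz yields
v² instead, and 2 > γ.

With x = 1/ρ, one has F̄(x) = F̄_ρ(1). In (i), b² = γ λ F̄_ρ(1) → ∞ and b² Ψ(y/b) → -y²/2, so the
limit is Gaussian with variance ∫∫ φ(x + v^{1/d} C)² dx v^{-γ-1} dv. Fubini turns this into the
quadratic form of K_{γ,C}, and `exists_isonormal` over L²(dx v^{-γ-1} dv) provides such a process.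
In (ii) nothing is normalised. The factor γσ₀ in front of ∫∫ Ψ(φ) is absorbed by the dilation, since
dx v^{-γ-1} dv is multiplied by s^{(γ-1)d} under (x, v) ↦ (sx, s^d v). The limiting integral J* is
built by completion in L², from an L² inequality that is itself deduced from the characteristic
function.

In (iii) the threshold is x = (1/F̄)^←(γλ), for which γ λ F̄(x) → 1, and the typical relevant volume
β = ρx tends to 0. Grains shrink to points, φ(x + (βw)^{1/d} C)/β → w φ(x) in L¹, and the exponent
tends to ∫∫ Ψ(w φ(x)/c_γ) dx w^{-γ-1} dw. Two integrations by parts and the Gamma integral at an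
imaginary argument identify it with the γ-stable exponent. -/

noncomputable section

/-! ### The compensated exponential -/

/-- The compensated exponential `e ^ (i x) - 1 - i x`. -/
def compExp (x : ℝ) : ℂ := Complex.exp (x * Complex.I) - 1 - x * Complex.I

lemma compExp_zero : compExp 0 = 0 := by simp [compExp]

@[fun_prop]
lemma continuous_compExp : Continuous compExp := by unfold compExp; fun_prop

lemma norm_exp_mul_I_sub_one_le (x : ℝ) : ‖Complex.exp (x * Complex.I) - 1‖ ≤ |x| := by
  rw [mul_comm]; exact Real.norm_exp_I_mul_ofReal_sub_one_le

lemma norm_exp_mul_I_sub_exp_le (x y : ℝ) :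
    ‖Complex.exp (x * Complex.I) - Complex.exp (y * Complex.I)‖ ≤ |x - y| := by
  have h : Complex.exp (x * Complex.I) - Complex.exp (y * Complex.I) =
      Complex.exp (y * Complex.I) * (Complex.exp ((x - y : ℝ) * Complex.I) - 1) := by
    rw [mul_sub, ← Complex.exp_add]; push_cast; ring_nf
  rw [h, norm_mul, Complex.norm_exp_ofReal_mul_I, one_mul]
  exact norm_exp_mul_I_sub_one_le _

/-- Both e^{ix} and ix are 1-Lipschitz. This global bound turns L¹ convergence of functions into
convergence of cumulants. -/
lemma norm_compExp_sub_le (x y : ℝ) : ‖compExp x - compExp y‖ ≤ 2 * |x - y| := by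
  have h : compExp x - compExp y = (Complex.exp (x * Complex.I) - Complex.exp (y * Complex.I))
      - ((x - y : ℝ) : ℂ) * Complex.I := by
    simp only [compExp]; push_cast; ring
  rw [h]
  refine (norm_sub_le _ _).trans ?_
  have := norm_exp_mul_I_sub_exp_le x y
  simp only [norm_mul, Complex.norm_real, Real.norm_eq_abs, Complex.norm_I, mul_one]
  linarith

lemma norm_compExp_le_abs (x : ℝ) : ‖compExp x‖ ≤ 2 * |x| := by
  simpa [compExp_zero] using norm_compExp_sub_le x 0

/-- For x ≥ 0 the derivative i(e^{ix} - 1) has norm at most x, which is integrated from 0. Negative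
arguments follow by conjugation. -/
lemma norm_compExp_le_sq (x : ℝ) : ‖compExp x‖ ≤ x ^ 2 / 2 := by
  have key : ∀ x : ℝ, 0 ≤ x → ‖compExp x‖ ≤ x ^ 2 / 2 := by
    intro x hx
    have hd : ∀ t : ℝ, HasDerivAt compExp
        ((Complex.exp (t * Complex.I) - 1) * Complex.I) t := by
      intro t
      have h1 : HasDerivAt (fun t : ℝ => (t : ℂ) * Complex.I) Complex.I t := by
        simpa using (Complex.ofRealCLM.hasDerivAt (x := t)).mul_const Complex.I
      have := (h1.cexp.sub_const 1).sub h1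
      refine this.congr_deriv ?_
      ring
    have := image_norm_le_of_norm_deriv_right_le_deriv_boundary (f := compExp) (a := 0) (b := x)
      (f' := fun t => (Complex.exp (t * Complex.I) - 1) * Complex.I)
      (B := fun t => t ^ 2 / 2) (B' := fun t => t) continuous_compExp.continuousOn
      (fun t _ => (hd t).hasDerivWithinAt) (by simp [compExp_zero])
      (fun t => by
        have := (hasDerivAt_pow 2 t).div_const 2
        refine this.congr_deriv ?_
        norm_num)
      (fun t ht => by
        have := norm_exp_mul_I_sub_one_le t
        rw [abs_of_nonneg ht.1] at this
        simpa using this)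
    exact this ⟨hx, le_rfl⟩
  rcases le_total 0 x with hx | hx
  · exact key x hx
  · have h : compExp x = (starRingEnd ℂ) (compExp (-x)) := by
      simp [compExp, ← Complex.exp_conj]
      ring
    rw [h, RCLike.norm_conj]
    simpa using key (-x) (by linarith)

lemma exp_mul_I_sub_one_eq (x : ℝ) :
    Complex.exp (x * Complex.I) - 1 = compExp x + x * Complex.I := by
  simp [compExp]

lemma re_compExp_nonpos (x : ℝ) : (compExp x).re ≤ 0 := by
  have : (compExp x).re = Real.cos x - 1 := by
    simp [compExp, Complex.exp_ofReal_mul_I_re]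
  rw [this]; linarith [Real.cos_le_one x]

lemma one_sub_cos_nonneg (x : ℝ) : 0 ≤ 1 - Real.cos x := by linarith [Real.cos_le_one x]

/-- `s² (e ^ (i y / s) - 1 - i y / s) → - y² / 2` as `s → ∞`, locally uniformly in `y`. -/
lemma tendsto_sq_mul_compExp_div {ι : Type*} {l : Filter ι} {s y : ι → ℝ} {y₀ : ℝ}
    (hs : Tendsto s l atTop) (hy : Tendsto y l (𝓝 y₀)) :
    Tendsto (fun i => ((s i ^ 2 : ℝ) : ℂ) * compExp (y i / s i)) l (𝓝 (-(y₀ ^ 2 / 2 : ℝ))) := by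
  have hsmall : Tendsto (fun i => y i / s i) l (𝓝 0) := hy.div_atTop hs
  -- Third order Taylor remainder. Its constant is 2/9, and 1 suffices.
  have hbound : ∀ x : ℝ, |x| ≤ 1 → ‖compExp x + (x ^ 2 / 2 : ℝ)‖ ≤ |x| ^ 3 := by
    intro x hx
    have := Complex.norm_exp_sub_sum_le_norm_mul_exp (x * Complex.I) 3
    have h2 := Complex.exp_bound (x := x * Complex.I) (by simpa using hx) (n := 3) (by norm_num)
    have e : compExp x + (x ^ 2 / 2 : ℝ) = Complex.exp (x * Complex.I)
        - ∑ m ∈ Finset.range 3, (x * Complex.I) ^ m / (m.factorial : ℂ) := by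
      simp only [compExp, Finset.sum_range_succ, Finset.range_zero, Finset.sum_empty]
      have : (x * Complex.I : ℂ) ^ 2 = - x ^ 2 := by rw [mul_pow, Complex.I_sq]; ring
      rw [this]
      simp [Nat.factorial]
      ring
    rw [e]
    refine h2.trans ?_
    simp only [norm_mul, Complex.norm_real, Real.norm_eq_abs, Complex.norm_I, mul_one]
    norm_num [Nat.factorial]
    have : 0 ≤ |x| ^ 3 := by positivity
    linarith
  rw [tendsto_iff_norm_sub_tendsto_zero]
  -- The remainder contributes s² |y/s|³ = y² |y/s|. The other term is the error made by replacing y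
  -- by its limit.
  have hlim : Tendsto (fun i => |y i| ^ 2 * |y i / s i| + |y₀ ^ 2 / 2 - y i ^ 2 / 2|) l (𝓝 0) := by
    have h1 : Tendsto (fun i => |y i| ^ 2 * |y i / s i|) l (𝓝 (|y₀| ^ 2 * |0|)) :=
      (hy.abs.pow 2).mul hsmall.abs
    have h2 : Tendsto (fun i => |y₀ ^ 2 / 2 - y i ^ 2 / 2|) l (𝓝 |y₀ ^ 2 / 2 - y₀ ^ 2 / 2|) :=
      (tendsto_const_nhds.sub ((hy.pow 2).div_const 2)).abs
    simpa using h1.add h2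
  refine squeeze_zero' (Eventually.of_forall fun i => norm_nonneg _) ?_ hlim
  have hev : ∀ᶠ i in l, |y i / s i| ≤ 1 := by
    have := hsmall.abs
    simp only [abs_zero] at this
    exact this.eventually (eventually_le_nhds one_pos)
  filter_upwards [hev, hs.eventually_gt_atTop 0] with i hi hsi
  have e : ((s i ^ 2 : ℝ) : ℂ) * compExp (y i / s i) - (-(y₀ ^ 2 / 2 : ℝ) : ℂ) =
      ((s i ^ 2 : ℝ) : ℂ) * (compExp (y i / s i) + ((y i / s i) ^ 2 / 2 : ℝ))
        + ((y₀ ^ 2 / 2 - y i ^ 2 / 2 : ℝ) : ℂ) := by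
    have : (s i : ℂ) ≠ 0 := by exact_mod_cast hsi.ne'
    push_cast
    field_simp
    ring
  rw [e]
  refine (norm_add_le _ _).trans (add_le_add ?_ (by rw [Complex.norm_real, Real.norm_eq_abs]))
  rw [norm_mul, Complex.norm_real, Real.norm_eq_abs]
  calc |s i ^ 2| * _ ≤ |s i ^ 2| * |y i / s i| ^ 3 := by gcongr; exact hbound _ hi
    _ = |y i| ^ 2 * |y i / s i| := by
      rw [abs_div, abs_pow]
      have : |s i| ≠ 0 := by simpa using hsi.ne'
      field_simp

/-! ### Integrals with respect to Poisson random measures -/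

/-- The mean of the Poisson law, by the index shift n r^n / n! = r · r^{n-1} / (n-1)!. -/
lemma lintegral_natCast_poissonMeasure (r : ℝ≥0) :
    ∫⁻ k : ℕ, (k : ℝ≥0∞) ∂(poissonMeasure r) = r := by
  have h : ∫⁻ k : ℕ, (k : ℝ≥0∞) ∂(poissonMeasure r) =
      ∑' n : ℕ, ENNReal.ofReal (Real.exp (-r) * r ^ n / n.factorial) * n := by
    rw [poissonMeasure, lintegral_sum_measure]
    simp [lintegral_smul_measure]
  rw [h, tsum_eq_zero_add' ENNReal.summable]
  simp only [Nat.cast_zero, mul_zero, zero_add]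
  have h2 : ∀ n : ℕ, ENNReal.ofReal (Real.exp (-r) * r ^ (n + 1) / (n + 1).factorial) * ((n + 1 : ℕ) : ℝ≥0∞)
      = r * ENNReal.ofReal (Real.exp (-r) * r ^ n / n.factorial) := by
    intro n
    rw [← ENNReal.ofReal_natCast, ← ENNReal.ofReal_mul (by positivity), ← ENNReal.ofReal_coe_nnreal,
      ← ENNReal.ofReal_mul (by positivity)]
    congr 1
    rw [Nat.factorial_succ]
    push_cast
    field_simp
    ring
  simp_rw [h2]
  rw [ENNReal.tsum_mul_left, ← ENNReal.ofReal_tsum_of_nonneg (fun n => by positivity)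
    (hasSum_one_poissonMeasure r).summable, (hasSum_one_poissonMeasure r).tsum_eq]
  simp

namespace IsPoissonRandomMeasure

variable {S Ω : Type*} [MeasurableSpace S] [MeasurableSpace Ω] {N : Ω → Measure S} {η : Measure S}
  {P : Measure Ω}

lemma measurable_apply (hN : IsPoissonRandomMeasure N η P) {A : Set S} (hA : MeasurableSet A) :
    Measurable (fun ω => N ω A) :=
  (Measure.measurable_coe hA).comp hN.measurable

lemma lintegral_apply (hN : IsPoissonRandomMeasure N η P) {A : Set S} (hA : MeasurableSet A)
    (hfin : η A ≠ ∞) : ∫⁻ ω, N ω A ∂P = η A := by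
  have h := lintegral_map (μ := P) (f := fun x : ℝ≥0∞ => x) measurable_id (hN.measurable_apply hA)
  rw [← h, hN.map_eq A hA hfin,
    lintegral_map (f := fun x : ℝ≥0∞ => x) measurable_id (measurable_of_countable _),
    lintegral_natCast_poissonMeasure, ENNReal.coe_toNNReal hfin]

/-- Campbell's formula in measure form: the mean measure is the intensity. The Poisson laws are
prescribed on sets of finite intensity only, hence the localisation to spanning sets. All first
moment formulas follow from it. -/
lemma bind_eq [SigmaFinite η] (hN : IsPoissonRandomMeasure N η P) : P.bind N = η := by
  rw [Measure.ext_iff_of_iUnion_eq_univ (iUnion_spanningSets η)]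
  intro n
  ext A hA
  have hm := measurableSet_spanningSets η n
  rw [Measure.restrict_apply hA, Measure.restrict_apply hA,
    Measure.bind_apply (hA.inter hm) hN.measurable.aemeasurable]
  exact hN.lintegral_apply (hA.inter hm)
    ((measure_mono inter_subset_right).trans_lt (measure_spanningSets_lt_top η n)).ne

lemma lintegral_lintegral [SigmaFinite η] (hN : IsPoissonRandomMeasure N η P) {g : S → ℝ≥0∞}
    (hg : AEMeasurable g η) : ∫⁻ ω, ∫⁻ s, g s ∂(N ω) ∂P = ∫⁻ s, g s ∂η := by
  conv_rhs => rw [← hN.bind_eq]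
  rw [Measure.lintegral_bind hN.measurable.aemeasurable (by rwa [hN.bind_eq])]

/-- An `η`-null set is almost surely `N`-null, so integrands may be modified on `η`-null sets inside
integrals against `N`. -/
lemma ae_ae [SigmaFinite η] (hN : IsPoissonRandomMeasure N η P) {p : S → Prop}
    (h : ∀ᵐ s ∂η, p s) : ∀ᵐ ω ∂P, ∀ᵐ s ∂(N ω), p s :=
  Measure.ae_ae_of_ae_bind hN.measurable.aemeasurable (by rwa [hN.bind_eq])

lemma ae_integrable [SigmaFinite η] (hN : IsPoissonRandomMeasure N η P) {f : S → ℝ}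
    (hf : Integrable f η) : ∀ᵐ ω ∂P, Integrable f (N ω) := by
  have hmk := hN.ae_ae hf.aestronglyMeasurable.ae_eq_mk
  have hfin : ∫⁻ ω, ∫⁻ s, ‖hf.aestronglyMeasurable.mk f s‖ₑ ∂(N ω) ∂P ≠ ∞ := by
    rw [hN.lintegral_lintegral
      hf.aestronglyMeasurable.stronglyMeasurable_mk.measurable.enorm.aemeasurable]
    exact (hf.congr hf.aestronglyMeasurable.ae_eq_mk).2.ne
  have hmeas : Measurable (fun ω => ∫⁻ s, ‖hf.aestronglyMeasurable.mk f s‖ₑ ∂(N ω)) :=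
    (Measure.measurable_lintegral
      hf.aestronglyMeasurable.stronglyMeasurable_mk.measurable.enorm).comp hN.measurable
  filter_upwards [hmk, ae_lt_top hmeas hfin] with ω (h1 : f =ᵐ[N ω] _) h2
  exact (Integrable.congr
    ⟨hf.aestronglyMeasurable.stronglyMeasurable_mk.aestronglyMeasurable, h2⟩ h1.symm)

lemma aemeasurable_integral [SigmaFinite η] (hN : IsPoissonRandomMeasure N η P) {f : S → ℝ}
    (hf : Integrable f η) : AEMeasurable (fun ω => ∫ s, f s ∂(N ω)) P := by
  set g := hf.aestronglyMeasurable.mk f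
  have hg : Measurable g := hf.aestronglyMeasurable.stronglyMeasurable_mk.measurable
  have h1 : Measurable fun ω => (∫⁻ s, ENNReal.ofReal (g s) ∂(N ω)).toReal -
      (∫⁻ s, ENNReal.ofReal (-g s) ∂(N ω)).toReal :=
    (((Measure.measurable_lintegral hg.ennreal_ofReal).comp hN.measurable).ennreal_toReal).sub
      (((Measure.measurable_lintegral hg.neg.ennreal_ofReal).comp hN.measurable).ennreal_toReal)
  refine ⟨_, h1, ?_⟩
  filter_upwards [hN.ae_ae hf.aestronglyMeasurable.ae_eq_mk, hN.ae_integrable hf] with ω h2 h3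
  rw [integral_congr_ae h2]
  exact integral_eq_lintegral_pos_part_sub_lintegral_neg_part (h3.congr h2)

lemma lintegral_enorm_integral_le [SigmaFinite η] (hN : IsPoissonRandomMeasure N η P) {f : S → ℝ}
    (hf : AEMeasurable f η) : ∫⁻ ω, ‖∫ s, f s ∂(N ω)‖ₑ ∂P ≤ ∫⁻ s, ‖f s‖ₑ ∂η := by
  rw [← hN.lintegral_lintegral hf.enorm]
  exact lintegral_mono fun ω => enorm_integral_le_lintegral_enorm _

lemma integral_integral [SigmaFinite η] (hN : IsPoissonRandomMeasure N η P) {f : S → ℝ}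
    (hf : Integrable f η) : ∫ ω, ∫ s, f s ∂(N ω) ∂P = ∫ s, f s ∂η := by
  set g := hf.aestronglyMeasurable.mk f
  have hfg : f =ᵐ[η] g := hf.aestronglyMeasurable.ae_eq_mk
  have hgi : Integrable g η := hf.congr hfg
  have hg : Measurable g := hf.aestronglyMeasurable.stronglyMeasurable_mk.measurable
  have hm1 : Measurable fun ω => ∫⁻ s, ENNReal.ofReal (g s) ∂(N ω) :=
    (Measure.measurable_lintegral hg.ennreal_ofReal).comp hN.measurable
  have hm2 : Measurable fun ω => ∫⁻ s, ENNReal.ofReal (-g s) ∂(N ω) :=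
    (Measure.measurable_lintegral hg.neg.ennreal_ofReal).comp hN.measurable
  have e1 := hN.lintegral_lintegral (g := fun s => ENNReal.ofReal (g s)) hg.ennreal_ofReal.aemeasurable
  have e2 := hN.lintegral_lintegral (g := fun s => ENNReal.ofReal (-g s)) hg.neg.ennreal_ofReal.aemeasurable
  have f1 : ∫⁻ ω, ∫⁻ s, ENNReal.ofReal (g s) ∂(N ω) ∂P ≠ ∞ := e1 ▸ hgi.lintegral_lt_top.ne
  have f2 : ∫⁻ ω, ∫⁻ s, ENNReal.ofReal (-g s) ∂(N ω) ∂P ≠ ∞ := e2 ▸ hgi.neg.lintegral_lt_top.ne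
  have : (fun ω => ∫ s, f s ∂(N ω)) =ᵐ[P] fun ω => (∫⁻ s, ENNReal.ofReal (g s) ∂(N ω)).toReal -
      (∫⁻ s, ENNReal.ofReal (-g s) ∂(N ω)).toReal := by
    filter_upwards [hN.ae_ae hfg, hN.ae_integrable hf] with ω h2 h3
    rw [integral_congr_ae h2]
    exact integral_eq_lintegral_pos_part_sub_lintegral_neg_part (h3.congr h2)
  rw [integral_congr_ae this, integral_sub (integrable_toReal_of_lintegral_ne_top hm1.aemeasurable f1)
    (integrable_toReal_of_lintegral_ne_top hm2.aemeasurable f2),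
    integral_toReal hm1.aemeasurable (ae_lt_top hm1 f1),
    integral_toReal hm2.aemeasurable (ae_lt_top hm2 f2), e1, e2, integral_congr_ae hfg]
  exact (integral_eq_lintegral_pos_part_sub_lintegral_neg_part hgi).symm

lemma integral_exp_apply (hN : IsPoissonRandomMeasure N η P) {A : Set S} (hA : MeasurableSet A)
    (hfin : η A ≠ ∞) (c : ℝ) :
    ∫ ω, Complex.exp (((N ω).real A * c : ℝ) * Complex.I) ∂P =
      Complex.exp (η.real A * (Complex.exp (c * Complex.I) - 1)) := by
  have h := integral_map (μ := P) (φ := fun ω => N ω A)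
    (hN.measurable_apply hA).aemeasurable
    (f := fun x : ℝ≥0∞ => Complex.exp ((x.toReal * c : ℝ) * Complex.I))
    (by
      refine Measurable.aestronglyMeasurable ?_
      fun_prop)
  have h2 := integral_map (μ := poissonMeasure (η A).toNNReal) (φ := fun k : ℕ => (k : ℝ≥0∞))
    (measurable_of_countable _).aemeasurable
    (f := fun x : ℝ≥0∞ => Complex.exp ((x.toReal * c : ℝ) * Complex.I))
    (by
      refine Measurable.aestronglyMeasurable ?_
      fun_prop)
  have h3 := charFun_map_cast_poissonMeasure (η A).toNNReal c
  rw [charFun_apply, integral_map (measurable_of_countable _).aemeasurable (by fun_prop)] at h3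
  rw [hN.map_eq A hA hfin, h2] at h
  simp only [measureReal_def]
  rw [← h]
  simp only [Real.inner_apply, ENNReal.toReal_natCast] at h3 ⊢
  exact h3

/-- The characteristic functional of a Poisson random measure on simple functions. -/
lemma integral_exp_simpleFunc [SigmaFinite η] [IsProbabilityMeasure P] (hN : IsPoissonRandomMeasure N η P)
    (g : SimpleFunc S ℝ) (hg : Integrable g η) :
    ∫ ω, Complex.exp ((∫ s, g s ∂(N ω) : ℝ) * Complex.I) ∂P =
      Complex.exp (∫ s, (Complex.exp (g s * Complex.I) - 1) ∂η) := by
  classical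
  -- The value 0 is left out: its fibre may have infinite intensity, and it contributes nothing to
  -- either side.
  set R : Finset ℝ := g.range.filter (· ≠ 0) with hR
  have hfin : ∀ c ∈ R, η (g ⁻¹' {c}) ≠ ∞ := by
    intro c hc
    exact (SimpleFunc.integrable_iff.1 hg c (Finset.mem_filter.1 hc).2).ne
  let e := R.equivFin
  -- Independence is postulated for families indexed by `Fin n`, so the values are enumerated.
  have hind : iIndepFun (fun (k : R) ω => N ω (g ⁻¹' {(k : ℝ)})) P := by
    have := hN.indep R.card (fun k => g ⁻¹' {((e.symm k : R) : ℝ)}) (fun k => g.measurableSet_fiber _)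
      (fun j k hjk => by
        refine Disjoint.preimage _ ?_
        simpa [Subtype.ext_iff] using fun h => hjk (e.symm.injective (Subtype.ext h)))
    have h2 := this.precomp e.injective
    refine h2.congr' fun k => ?_
    simp
  have hsum : ∀ (μ : Measure S), Integrable g μ →
      ∫ s, g s ∂μ = ∑ k : R, μ.real (g ⁻¹' {(k : ℝ)}) * k := by
    intro μ hμ
    rw [SimpleFunc.integral_eq_sum g hμ, Finset.sum_coe_sort R (fun c => μ.real (g ⁻¹' {c}) * c),
      hR, Finset.sum_filter]
    refine Finset.sum_congr rfl fun x _ => ?_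
    split_ifs with h
    · simp
    · simp [not_not.1 h]
  have hlhs : ∫ ω, Complex.exp ((∫ s, g s ∂(N ω) : ℝ) * Complex.I) ∂P =
      ∫ ω, ∏ k : R, Complex.exp (((N ω).real (g ⁻¹' {(k : ℝ)}) * k : ℝ) * Complex.I) ∂P := by
    refine integral_congr_ae ?_
    filter_upwards [hN.ae_integrable hg] with ω hω
    rw [hsum _ hω, ← Complex.exp_sum]
    push_cast
    rw [Finset.sum_mul]
  have hm : ∀ k : R, Measurable fun x : ℝ≥0∞ => Complex.exp ((x.toReal * k : ℝ) * Complex.I) := by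
    intro k; fun_prop
  rw [hlhs]
  have := (hind.comp (fun (k : R) (x : ℝ≥0∞) => Complex.exp ((x.toReal * k : ℝ) * Complex.I))
    hm).integral_fun_prod_eq_prod_integral (fun k =>
      ((hm k).comp (hN.measurable_apply (g.measurableSet_fiber _))).aestronglyMeasurable)
  simp only [Function.comp_def, ← measureReal_def] at this
  rw [this]
  simp_rw [fun k : R => hN.integral_exp_apply (g.measurableSet_fiber (k : ℝ)) (hfin k k.2) (k : ℝ)]
  rw [← Complex.exp_sum]
  congr 1
  let h : SimpleFunc S ℂ := g.map fun x : ℝ => Complex.exp ((x : ℂ) * Complex.I) - 1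
  have hi : Integrable h η := by
    refine Integrable.mono hg h.aestronglyMeasurable (ae_of_all _ fun s => ?_)
    simpa [h] using norm_exp_mul_I_sub_one_le (g s)
  have : ∫ s, (Complex.exp (g s * Complex.I) - 1) ∂η = ∫ s, h s ∂η := rfl
  rw [this, ← SimpleFunc.integral_eq_integral h hi, SimpleFunc.map_integral g _ hg (by simp),
    Finset.sum_coe_sort R (fun c => (η.real (g ⁻¹' {c}) : ℂ) * (Complex.exp (c * Complex.I) - 1)),
      hR, Finset.sum_filter]
  refine Finset.sum_congr rfl fun x _ => ?_
  split_ifs with hx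
  · simp
  · simp [not_not.1 hx]

/-- The map x ↦ e^{ix} is bounded and 1-Lipschitz, so L¹ convergence suffices. -/
lemma _root_.tendsto_integral_exp_of_tendsto_lintegral {Ω : Type*} [MeasurableSpace Ω] {P : Measure Ω}
    [IsProbabilityMeasure P] {X : ℕ → Ω → ℝ} {Y : Ω → ℝ} (hX : ∀ n, AEMeasurable (X n) P)
    (hY : AEMeasurable Y P) (h : Tendsto (fun n => ∫⁻ ω, ‖X n ω - Y ω‖ₑ ∂P) atTop (𝓝 0)) :
    Tendsto (fun n => ∫ ω, Complex.exp ((X n ω : ℝ) * Complex.I) ∂P) atTop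
      (𝓝 (∫ ω, Complex.exp ((Y ω : ℝ) * Complex.I) ∂P)) := by
  have hb : ∀ Z : Ω → ℝ, AEMeasurable Z P → Integrable (fun ω => Complex.exp ((Z ω : ℝ) * Complex.I)) P := by
    intro Z hZ
    refine Integrable.of_bound (C := 1) ?_ (ae_of_all _ fun ω => ?_)
    · exact (Complex.measurable_exp.comp_aemeasurable
        ((Complex.measurable_ofReal.comp_aemeasurable hZ).mul_const _)).aestronglyMeasurable
    · rw [Complex.norm_exp_ofReal_mul_I]
  refine tendsto_integral_of_L1 _ (hb Y hY).aestronglyMeasurable (Eventually.of_forall fun n => hb _ (hX n)) ?_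
  refine tendsto_of_tendsto_of_tendsto_of_le_of_le tendsto_const_nhds h (fun _ => zero_le) fun n =>
    lintegral_mono fun ω => ?_
  rw [enorm_le_iff_norm_le]
  exact norm_exp_mul_I_sub_exp_le _ _

/-- The characteristic functional of a Poisson random measure on integrable functions. -/
lemma integral_exp [SigmaFinite η] [IsProbabilityMeasure P] (hN : IsPoissonRandomMeasure N η P)
    {f : S → ℝ} (hf : Integrable f η) :
    ∫ ω, Complex.exp ((∫ s, f s ∂(N ω) : ℝ) * Complex.I) ∂P =
      Complex.exp (∫ s, (Complex.exp (f s * Complex.I) - 1) ∂η) := by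
  have key : ∀ f : S → ℝ, Measurable f → Integrable f η →
      ∫ ω, Complex.exp ((∫ s, f s ∂(N ω) : ℝ) * Complex.I) ∂P =
        Complex.exp (∫ s, (Complex.exp (f s * Complex.I) - 1) ∂η) := by
    intro f hfm hf
    -- Simple functions approximate f in L¹(η). By Campbell's inequality the random integrals
    -- converge in L¹(P), and the exponents converge because e^{ix} - 1 is Lipschitz.
    have hLim := SimpleFunc.tendsto_approxOn_range_L1_enorm hfm hf
    have hgi := SimpleFunc.integrable_approxOn_range hfm hf
    set g := SimpleFunc.approxOn f hfm (range f ∪ {0}) 0 (by simp) with hg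
    have h1 : Tendsto (fun n => ∫ ω, Complex.exp ((∫ s, g n s ∂(N ω) : ℝ) * Complex.I) ∂P) atTop
        (𝓝 (∫ ω, Complex.exp ((∫ s, f s ∂(N ω) : ℝ) * Complex.I) ∂P)) := by
      refine tendsto_integral_exp_of_tendsto_lintegral (fun n => hN.aemeasurable_integral (hgi n))
        (hN.aemeasurable_integral hf) ?_
      refine tendsto_of_tendsto_of_tendsto_of_le_of_le tendsto_const_nhds hLim (fun _ => zero_le)
        fun n => ?_
      refine le_trans (le_of_eq ?_) (hN.lintegral_enorm_integral_le ((hgi n).sub hf).aemeasurable)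
      refine lintegral_congr_ae ?_
      filter_upwards [hN.ae_integrable hf, hN.ae_integrable (hgi n)] with ω h1 h2
      rw [← integral_sub h2 h1]
    have h2 : Tendsto (fun n => Complex.exp (∫ s, (Complex.exp (g n s * Complex.I) - 1) ∂η)) atTop
        (𝓝 (Complex.exp (∫ s, (Complex.exp (f s * Complex.I) - 1) ∂η))) := by
      refine (Complex.continuous_exp.tendsto _).comp ?_
      have hb : ∀ f : S → ℝ, Integrable f η →
          Integrable (fun s => Complex.exp (f s * Complex.I) - 1) η := by
        intro f hf
        refine Integrable.mono hf ?_ (ae_of_all _ fun s => ?_)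
        · exact ((Complex.measurable_exp.comp_aemeasurable ((Complex.measurable_ofReal.comp_aemeasurable
            hf.aemeasurable).mul_const _)).sub_const 1).aestronglyMeasurable
        · exact norm_exp_mul_I_sub_one_le _
      refine tendsto_integral_of_L1 _ (hb f hf).aestronglyMeasurable (Eventually.of_forall fun n => hb _ (hgi n)) ?_
      refine tendsto_of_tendsto_of_tendsto_of_le_of_le tendsto_const_nhds hLim (fun _ => zero_le) fun n =>
        lintegral_mono fun ω => ?_
      rw [enorm_le_iff_norm_le]
      simpa using norm_exp_mul_I_sub_exp_le _ _
    refine tendsto_nhds_unique h1 ?_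
    simp_rw [fun n => hN.integral_exp_simpleFunc (g n) (hgi n)]
    exact h2
  have hfg := hf.aestronglyMeasurable.ae_eq_mk
  have := key _ hf.aestronglyMeasurable.stronglyMeasurable_mk.measurable (hf.congr hfg)
  have e1 : ∫ s, (Complex.exp (f s * Complex.I) - 1) ∂η =
      ∫ s, (Complex.exp (hf.aestronglyMeasurable.mk f s * Complex.I) - 1) ∂η :=
    integral_congr_ae (hfg.mono fun s hs => by simp only [hs])
  rw [e1, ← this]
  refine integral_congr_ae ((hN.ae_ae hfg).mono fun ω hω => ?_)
  simp only
  rw [integral_congr_ae hω]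

lemma _root_.integrable_compExp {f : S → ℝ} (hf : Integrable f η) :
    Integrable (fun s => compExp (f s)) η := by
  refine Integrable.mono (hf.const_mul 2)
    (continuous_compExp.measurable.comp_aemeasurable hf.aemeasurable).aestronglyMeasurable
    (ae_of_all _ fun s => ?_)
  simpa using norm_compExp_le_abs (f s)

/-- The characteristic functional of a compensated Poisson random measure. -/
lemma integral_exp_sub [SigmaFinite η] [IsProbabilityMeasure P] (hN : IsPoissonRandomMeasure N η P)
    {f : S → ℝ} (hf : Integrable f η) :
    ∫ ω, Complex.exp (((∫ s, f s ∂(N ω)) - ∫ s, f s ∂η : ℝ) * Complex.I) ∂P =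
      Complex.exp (∫ s, compExp (f s) ∂η) := by
  have h1 : ∀ ω, Complex.exp (((∫ s, f s ∂(N ω)) - ∫ s, f s ∂η : ℝ) * Complex.I) =
      Complex.exp ((∫ s, f s ∂(N ω) : ℝ) * Complex.I) *
        Complex.exp (-((∫ s, f s ∂η : ℝ) * Complex.I)) := by
    intro ω
    rw [← Complex.exp_add]; push_cast; ring_nf
  simp_rw [h1]
  rw [integral_mul_const, hN.integral_exp hf, ← Complex.exp_add]
  congr 1
  simp_rw [exp_mul_I_sub_one_eq]
  have h2 := integral_mul_const (μ := η) Complex.I (fun s => (f s : ℂ))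
  rw [integral_complex_ofReal] at h2
  have h3 : Integrable (fun s => (f s : ℂ) * Complex.I) η := hf.ofReal.mul_const Complex.I
  rw [integral_add (integrable_compExp hf) h3, h2]
  ring

end IsPoissonRandomMeasure

/-! ### Square integrable compensated Poisson integrals -/

/-- Mean value inequality on the left half plane, which is convex and where |exp'| ≤ 1. -/
lemma norm_exp_sub_one_le_of_re_nonpos {z : ℂ} (hz : z.re ≤ 0) : ‖Complex.exp z - 1‖ ≤ ‖z‖ := by
  have h := Convex.norm_image_sub_le_of_norm_deriv_le (𝕜 := ℂ) (f := Complex.exp)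
    (s := {w : ℂ | w.re ≤ 0}) (x := 0) (y := z) (C := 1)
    (fun x _ => Complex.differentiable_exp x)
    (fun x hx => by
      rw [Complex.deriv_exp, Complex.norm_exp]
      exact Real.exp_le_one_iff.2 hx)
    (convex_halfSpace_re_le 0) (by simp) hz
  simpa using h

/-- Recovers x² as a limit of bounded functions of x whose means are visible in the characteristic
function. This is what Fatou's lemma is applied to below. -/
lemma tendsto_two_mul_one_sub_cos_div (x : ℝ) :
    Tendsto (fun n : ℕ => ((n : ℝ) + 1) ^ 2 * (2 * (1 - Real.cos (x / ((n : ℝ) + 1))))) atTop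
      (𝓝 (x ^ 2)) := by
  have hs : Tendsto (fun n : ℕ => (n : ℝ) + 1) atTop atTop :=
    tendsto_atTop_add_const_right _ _ tendsto_natCast_atTop_atTop
  have h := tendsto_sq_mul_compExp_div hs (tendsto_const_nhds (x := x))
  have h2 := ((Complex.continuous_re.tendsto _).comp h).const_mul (-2)
  convert h2 using 1
  · ext n
    have : ∀ y : ℝ, (compExp y).re = Real.cos y - 1 := by
      intro y; simp [compExp, Complex.exp_ofReal_mul_I_re]
    simp only [Function.comp_apply, Complex.re_ofReal_mul, this]
    ring
  · congr 1
    simp only [Complex.neg_re, Complex.ofReal_re]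
    ring

/-- The compensated integral `∫ f dN - ∫ f dη`. -/
def compensatedIntegral {S Ω : Type*} [MeasurableSpace S] (N : Ω → Measure S) (η : Measure S)
    (f : S → ℝ) (ω : Ω) : ℝ := (∫ s, f s ∂(N ω)) - ∫ s, f s ∂η

lemma eLpNorm_two_eq {α E : Type*} [MeasurableSpace α] [NormedAddCommGroup E] (μ : Measure α)
    (f : α → E) : eLpNorm f 2 μ = (∫⁻ x, ‖f x‖ₑ ^ 2 ∂μ) ^ (1 / 2 : ℝ) := by
  rw [eLpNorm_eq_lintegral_rpow_enorm_toReal (by simp) (by simp)]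
  simp

/-- Dominated convergence in `L²`. -/
lemma tendsto_eLpNorm_two_sub {α : Type*} [MeasurableSpace α] {μ : Measure α} {g : ℕ → α → ℝ}
    {f : α → ℝ} (hf : MemLp f 2 μ) (hg : ∀ n, AEStronglyMeasurable (g n) μ)
    (hb : ∀ n, ∀ᵐ s ∂μ, |g n s| ≤ |f s|)
    (hlim : ∀ᵐ s ∂μ, Tendsto (fun n => g n s) atTop (𝓝 (f s))) :
    Tendsto (fun n => eLpNorm (g n - f) 2 μ) atTop (𝓝 0) := by
  simp_rw [eLpNorm_two_eq]
  have h0 : ((0 : ℝ≥0∞)) = (∫⁻ x, 0 ∂μ) ^ (1 / 2 : ℝ) := by simp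
  rw [h0]
  refine ((ENNReal.continuous_rpow_const (y := 1 / 2)).tendsto _).comp ?_
  refine tendsto_lintegral_of_dominated_convergence' (fun s => (2 * ‖f s‖ₑ) ^ 2)
    (fun n => ((hg n).sub hf.1).enorm.pow_const 2) (fun n => ?_) ?_ ?_
  · filter_upwards [hb n] with s hs
    simp only [Pi.sub_apply]
    gcongr
    refine (enorm_sub_le).trans ?_
    rw [two_mul]
    gcongr
    rw [enorm_le_iff_norm_le]
    exact hs
  · simp_rw [mul_pow]
    rw [lintegral_const_mul'' _ (hf.1.enorm.pow_const 2)]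
    have := hf.2
    rw [eLpNorm_two_eq] at this
    have h3 := (ENNReal.rpow_lt_top_iff_of_pos (by norm_num : (0 : ℝ) < 1 / 2)).1 this
    exact ENNReal.mul_ne_top (by simp) h3.ne
  · filter_upwards [hlim] with s hs
    have h1 : Tendsto (fun n => ‖(g n - f) s‖ₑ) atTop (𝓝 0) := by
      have : Tendsto (fun n => g n s - f s) atTop (𝓝 0) := by
        simpa using hs.sub_const (f s)
      simpa using this.enorm
    simpa using ENNReal.Tendsto.pow (n := 2) h1

lemma eLpNorm_two_le_of_sq {α β : Type*} [MeasurableSpace α] [MeasurableSpace β] {μ : Measure α}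
    {ν : Measure β} {f : α → ℝ} {g : β → ℝ} (h : ∫⁻ x, ‖f x‖ₑ ^ 2 ∂μ ≤ ∫⁻ x, ‖g x‖ₑ ^ 2 ∂ν) :
    eLpNorm f 2 μ ≤ eLpNorm g 2 ν := by
  rw [eLpNorm_two_eq, eLpNorm_two_eq]
  gcongr

namespace IsPoissonRandomMeasure

variable {S Ω : Type*} [MeasurableSpace S] [MeasurableSpace Ω] {N : Ω → Measure S} {η : Measure S}
  {P : Measure Ω} [SigmaFinite η]

lemma aemeasurable_compensatedIntegral (hN : IsPoissonRandomMeasure N η P) {f : S → ℝ}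
    (hf : Integrable f η) : AEMeasurable (compensatedIntegral N η f) P :=
  (hN.aemeasurable_integral hf).sub_const _

lemma compensatedIntegral_sub (hN : IsPoissonRandomMeasure N η P) {f g : S → ℝ}
    (hf : Integrable f η) (hg : Integrable g η) :
    compensatedIntegral N η (f - g) =ᵐ[P] compensatedIntegral N η f - compensatedIntegral N η g := by
  filter_upwards [hN.ae_integrable hf, hN.ae_integrable hg] with ω h1 h2
  simp only [compensatedIntegral, Pi.sub_apply]
  rw [integral_sub h1 h2, integral_sub hf hg]
  ring

lemma _root_.compensatedIntegral_const_smul {S Ω : Type*} [MeasurableSpace S]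
    (N : Ω → Measure S) (η : Measure S) (c : ℝ) (f : S → ℝ) :
    compensatedIntegral N η (c • f) = c • compensatedIntegral N η f := by
  ext ω
  simp only [compensatedIntegral, Pi.smul_apply, smul_eq_mul, integral_const_mul]
  ring

/-- Half of the L² isometry, obtained from the characteristic function without computing moments.
With m = n + 1, Fatou's lemma bounds E X² by the lower limit of 2m² E(1 - cos(X/m)). This is at most
2m² |e^z - 1| ≤ 2m² |z|, where z = ∫ Ψ(f/m) dη has nonpositive real part and |z| ≤ ∫ f² dη / (2m²).
-/
lemma lintegral_sq_compensatedIntegral_le [IsProbabilityMeasure P] (hN : IsPoissonRandomMeasure N η P) {f : S → ℝ}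
    (hf : Integrable f η) (hf2 : MemLp f 2 η) :
    ∫⁻ ω, ‖compensatedIntegral N η f ω‖ₑ ^ 2 ∂P ≤ ∫⁻ s, ‖f s‖ₑ ^ 2 ∂η := by
  set X := compensatedIntegral N η f with hX
  have hXm : AEMeasurable X P := hN.aemeasurable_compensatedIntegral hf
  set Y : ℕ → Ω → ℝ≥0∞ := fun n ω =>
    ENNReal.ofReal (((n : ℝ) + 1) ^ 2 * (2 * (1 - Real.cos (X ω / ((n : ℝ) + 1))))) with hY
  have h1 : ∀ ω, liminf (fun n => Y n ω) atTop = ‖X ω‖ₑ ^ 2 := by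
    intro ω
    have := (ENNReal.continuous_ofReal.tendsto _).comp (tendsto_two_mul_one_sub_cos_div (X ω))
    rw [(show Tendsto (fun n => Y n ω) atTop _ from this).liminf_eq]
    rw [← sq_abs, ENNReal.ofReal_pow (abs_nonneg _), ← Real.norm_eq_abs, ofReal_norm]
  simp_rw [← h1]
  have hsq : ∫⁻ s, ‖f s‖ₑ ^ 2 ∂η = ENNReal.ofReal (∫ s, f s ^ 2 ∂η) := by
    rw [ofReal_integral_eq_lintegral_ofReal hf2.integrable_sq (ae_of_all _ fun s => sq_nonneg _)]
    refine lintegral_congr fun s => ?_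
    rw [← sq_abs, ENNReal.ofReal_pow (abs_nonneg _), ← Real.norm_eq_abs, ofReal_norm]
  refine (lintegral_liminf_le' fun n => ?_).trans ?_
  · refine AEMeasurable.ennreal_ofReal ?_
    exact (((Real.measurable_cos.comp_aemeasurable (hXm.div_const _)).const_sub 1).const_mul
      2).const_mul _
  refine (liminf_le_liminf (v := fun _ => ∫⁻ s, ‖f s‖ₑ ^ 2 ∂η) (Eventually.of_forall fun n => ?_)).trans
    (by simp)
  set t : ℝ := 1 / ((n : ℝ) + 1) with ht
  have hn : (0 : ℝ) < (n : ℝ) + 1 := by positivity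
  have hch := hN.integral_exp_sub (hf.const_mul t)
  set z := ∫ s, compExp (t * f s) ∂η with hz
  have hint : Integrable (fun ω => Real.cos (X ω / ((n : ℝ) + 1))) P := by
    refine Integrable.of_bound (C := 1)
      (Real.measurable_cos.comp_aemeasurable (hXm.div_const _)).aestronglyMeasurable
      (ae_of_all _ fun ω => ?_)
    simpa using Real.abs_cos_le_one _
  have hcos : ∫ ω, Real.cos (X ω / ((n : ℝ) + 1)) ∂P = (Complex.exp z).re := by
    rw [← hch]
    have hi : Integrable (fun ω => Complex.exp (((∫ s, t * f s ∂(N ω)) - ∫ s, t * f s ∂η : ℝ)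
        * Complex.I)) P := by
      refine Integrable.of_bound (C := 1) ?_ (ae_of_all _ fun ω => ?_)
      · exact (Complex.measurable_exp.comp_aemeasurable
          ((Complex.measurable_ofReal.comp_aemeasurable
          (hN.aemeasurable_compensatedIntegral (hf.const_mul t))).mul_const _)).aestronglyMeasurable
      · rw [Complex.norm_exp_ofReal_mul_I]
    have := integral_re hi
    simp only [RCLike.re_to_complex] at this
    rw [← this]
    refine integral_congr_ae (ae_of_all _ fun ω => ?_)
    simp only [Complex.exp_ofReal_mul_I_re, integral_const_mul]
    congr 1
    rw [hX, compensatedIntegral, ht]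
    ring
  have hzre : z.re ≤ 0 := by
    have hi := integrable_compExp (hf.const_mul t)
    have := integral_re hi
    simp only [RCLike.re_to_complex] at this
    rw [hz, ← this]
    exact integral_nonpos fun s => re_compExp_nonpos _
  have hznorm : ‖z‖ ≤ t ^ 2 / 2 * ∫ s, f s ^ 2 ∂η := by
    rw [← integral_const_mul]
    refine norm_integral_le_of_norm_le (hf2.integrable_sq.const_mul _) (ae_of_all _ fun s => ?_)
    refine (norm_compExp_le_sq _).trans (le_of_eq ?_)
    ring
  rw [hsq, ← ofReal_integral_eq_lintegral_ofReal]
  · refine ENNReal.ofReal_le_ofReal ?_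
    rw [integral_const_mul, integral_const_mul, integral_sub (integrable_const _) hint, hcos]
    simp only [integral_const, probReal_univ, smul_eq_mul, mul_one]
    have h3 : 1 - (Complex.exp z).re ≤ ‖Complex.exp z - 1‖ := by
      have := Complex.abs_re_le_norm (Complex.exp z - 1)
      simp only [Complex.sub_re, Complex.one_re] at this
      linarith [neg_abs_le ((Complex.exp z).re - 1)]
    have h4 := h3.trans ((norm_exp_sub_one_le_of_re_nonpos hzre).trans hznorm)
    calc ((n : ℝ) + 1) ^ 2 * (2 * (1 - (Complex.exp z).re))
        ≤ ((n : ℝ) + 1) ^ 2 * (2 * (t ^ 2 / 2 * ∫ s, f s ^ 2 ∂η)) := by gcongr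
      _ = ∫ s, f s ^ 2 ∂η := by rw [ht]; field_simp
  · exact (((integrable_const 1).sub hint).const_mul 2).const_mul _
  · exact ae_of_all _ fun ω => by
      have := one_sub_cos_nonneg (X ω / ((n : ℝ) + 1))
      simp only [Pi.zero_apply]
      positivity

/-- `X` is the centred Poisson integral of the square integrable function `f`, as a limit in `L²`. -/
structure _root_.IsL2CompensatedIntegral (N : Ω → Measure S) (η : Measure S) (P : Measure Ω)
    (f : S → ℝ) (X : Ω → ℝ) : Prop where
  memLp : MemLp f 2 η
  aemeasurable : AEMeasurable X P
  eLpNorm_sub_le : ∀ g : S → ℝ, Integrable g η → MemLp g 2 η →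
    eLpNorm (compensatedIntegral N η g - X) 2 P ≤ eLpNorm (g - f) 2 η

/-- Truncation of small values. -/
def _root_.cutSmall (f : S → ℝ) (n : ℕ) (s : S) : ℝ := {s | 1 / ((n : ℝ) + 1) < |f s|}.indicator f s

lemma _root_.abs_cutSmall_le {S : Type*} (f : S → ℝ) (n : ℕ) (s : S) : |cutSmall f n s| ≤ |f s| := by
  unfold cutSmall
  by_cases h : s ∈ {s | 1 / ((n : ℝ) + 1) < |f s|}
  · rw [indicator_of_mem h]
  · rw [indicator_of_notMem h]; simp

lemma _root_.tendsto_cutSmall {S : Type*} (f : S → ℝ) (s : S) :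
    Tendsto (fun n => cutSmall f n s) atTop (𝓝 (f s)) := by
  by_cases h0 : f s = 0
  · have : ∀ n, cutSmall f n s = f s := by
      intro n
      unfold cutSmall
      rw [indicator_of_notMem, h0]
      simp only [mem_ofPred_eq, h0, abs_zero, not_lt]
      positivity
    simp [this]
  · refine tendsto_const_nhds.congr' ?_
    have := tendsto_one_div_add_atTop_nhds_zero_nat (𝕜 := ℝ)
    filter_upwards [this.eventually_lt_const (abs_pos.2 h0)] with n hn
    unfold cutSmall
    rw [indicator_of_mem]
    exact hn

lemma _root_.aestronglyMeasurable_cutSmall {η : Measure S} {f : S → ℝ} (hf : AEMeasurable f η) (n : ℕ) :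
    AEStronglyMeasurable (cutSmall f n) η := by
  have h1 : Measurable fun x : ℝ => {y : ℝ | 1 / ((n : ℝ) + 1) < |y|}.indicator id x :=
    measurable_id.indicator (measurableSet_lt measurable_const (measurable_norm))
  refine (h1.comp_aemeasurable hf).aestronglyMeasurable.congr (ae_of_all _ fun s => ?_)
  by_cases h : 1 / ((n : ℝ) + 1) < |f s|
  · simp [cutSmall, indicator]
  · simp [cutSmall, indicator]

lemma _root_.memLp_cutSmall {η : Measure S} {f : S → ℝ} (hf : MemLp f 2 η) (n : ℕ) : MemLp (cutSmall f n) 2 η :=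
  hf.mono (aestronglyMeasurable_cutSmall hf.aemeasurable n)
    (ae_of_all _ fun s => abs_cutSmall_le f n s)

/-- Where |f| > 1/(n+1) one has |f| ≤ (n+1) f², so removing the small values makes a square
integrable function integrable. -/
lemma _root_.integrable_cutSmall {η : Measure S} {f : S → ℝ} (hf : MemLp f 2 η) (n : ℕ) :
    Integrable (cutSmall f n) η := by
  refine Integrable.mono' (hf.integrable_sq.const_mul ((n : ℝ) + 1))
    (aestronglyMeasurable_cutSmall hf.aemeasurable n) (ae_of_all _ fun s => ?_)
  have hn : (0 : ℝ) < (n : ℝ) + 1 := by positivity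
  unfold cutSmall
  by_cases h : s ∈ {s | 1 / ((n : ℝ) + 1) < |f s|}
  · rw [indicator_of_mem h, Real.norm_eq_abs, ← sq_abs]
    have h' : 1 < |f s| * ((n : ℝ) + 1) := (div_lt_iff₀ hn).1 h
    nlinarith [abs_nonneg (f s)]
  · rw [indicator_of_notMem h, norm_zero]
    positivity

lemma _root_.tendsto_eLpNorm_cutSmall_sub {η : Measure S} {f : S → ℝ} (hf : MemLp f 2 η) :
    Tendsto (fun n => eLpNorm (cutSmall f n - f) 2 η) atTop (𝓝 0) :=
  tendsto_eLpNorm_two_sub hf (aestronglyMeasurable_cutSmall hf.aemeasurable)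
    (fun n => ae_of_all _ (abs_cutSmall_le f n)) (ae_of_all _ (tendsto_cutSmall f))

lemma memLp_compensatedIntegral [IsProbabilityMeasure P] (hN : IsPoissonRandomMeasure N η P)
    {f : S → ℝ} (hf : Integrable f η) (hf2 : MemLp f 2 η) : MemLp (compensatedIntegral N η f) 2 P :=
  ⟨(hN.aemeasurable_compensatedIntegral hf).aestronglyMeasurable,
    (eLpNorm_two_le_of_sq (hN.lintegral_sq_compensatedIntegral_le hf hf2)).trans_lt hf2.2⟩

lemma eLpNorm_compensatedIntegral_sub_le [IsProbabilityMeasure P] (hN : IsPoissonRandomMeasure N η P)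
    {f g : S → ℝ} (hf : Integrable f η) (hf2 : MemLp f 2 η) (hg : Integrable g η) (hg2 : MemLp g 2 η) :
    eLpNorm (compensatedIntegral N η f - compensatedIntegral N η g) 2 P ≤ eLpNorm (f - g) 2 η := by
  rw [← eLpNorm_congr_ae (hN.compensatedIntegral_sub hf hg)]
  exact eLpNorm_two_le_of_sq (hN.lintegral_sq_compensatedIntegral_le (hf.sub hg) (hf2.sub hg2))

/-- The compensated integrals of the truncations `cutSmall f n` form a Cauchy sequence in L²(P),
because the truncations do so in L²(η). The limit is X. -/
lemma exists_isL2CompensatedIntegral [IsProbabilityMeasure P] (hN : IsPoissonRandomMeasure N η P)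
    {f : S → ℝ} (hf : MemLp f 2 η) : ∃ X, IsL2CompensatedIntegral N η P f X := by
  have hi := integrable_cutSmall hf
  have h2 := memLp_cutSmall hf
  let G : ℕ → Lp ℝ 2 P := fun n => (hN.memLp_compensatedIntegral (hi n) (h2 n)).toLp
  let H : ℕ → Lp ℝ 2 η := fun n => (h2 n).toLp
  have hH : CauchySeq H :=
    ((Lp.tendsto_Lp_iff_tendsto_eLpNorm'' _ h2 f hf).2 (tendsto_eLpNorm_cutSmall_sub hf)).cauchySeq
  have hG : CauchySeq G := by
    rw [EMetric.cauchySeq_iff] at hH ⊢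
    intro ε hε
    obtain ⟨M, hM⟩ := hH ε hε
    refine ⟨M, fun m hm n hn => lt_of_le_of_lt ?_ (hM m hm n hn)⟩
    rw [Lp.edist_toLp_toLp, Lp.edist_toLp_toLp]
    exact hN.eLpNorm_compensatedIntegral_sub_le (hi m) (h2 m) (hi n) (h2 n)
  obtain ⟨Y, hX⟩ := cauchySeq_tendsto_of_complete hG
  obtain ⟨X, hXm, hYX⟩ : ∃ X : Ω → ℝ, AEStronglyMeasurable X P ∧ Y =ᵐ[P] X :=
    ⟨_, Lp.aestronglyMeasurable Y, ae_eq_refl _⟩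
  have hXlim : Tendsto (fun n => eLpNorm (compensatedIntegral N η (cutSmall f n) - X) 2 P) atTop
      (𝓝 0) := by
    rw [Lp.tendsto_Lp_iff_tendsto_eLpNorm'] at hX
    refine hX.congr fun n => eLpNorm_congr_ae ?_
    exact (MemLp.coeFn_toLp _).sub hYX
  refine ⟨X, hf, hXm.aemeasurable, fun g hg hg2 => ?_⟩
  have hIg := hN.memLp_compensatedIntegral hg hg2
  -- A general g is compared with X through the truncations of f. The two extra terms vanish as n →
  -- ∞.
  have key : ∀ n, eLpNorm (compensatedIntegral N η g - X) 2 P ≤ (eLpNorm (g - f) 2 η +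
      eLpNorm (cutSmall f n - f) 2 η) + eLpNorm (compensatedIntegral N η (cutSmall f n) - X) 2 P := by
    intro n
    have hIn := hN.memLp_compensatedIntegral (hi n) (h2 n)
    have e : compensatedIntegral N η g - X =
        (compensatedIntegral N η g - compensatedIntegral N η (cutSmall f n)) +
        (compensatedIntegral N η (cutSmall f n) - X) := by abel
    rw [e]
    refine (eLpNorm_add_le (hIg.1.sub hIn.1) (hIn.1.sub hXm) (by norm_num)).trans ?_
    gcongr
    refine (hN.eLpNorm_compensatedIntegral_sub_le hg hg2 (hi n) (h2 n)).trans ?_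
    have e2 : g - cutSmall f n = (g - f) + (f - cutSmall f n) := by abel
    rw [e2, eLpNorm_sub_comm (cutSmall f n) f]
    exact eLpNorm_add_le (hg2.1.sub hf.1) (hf.1.sub (h2 n).1) (by norm_num)
  have hlim := ((tendsto_const_nhds (x := eLpNorm (g - f) 2 η)).add
    (tendsto_eLpNorm_cutSmall_sub hf)).add hXlim
  simp only [add_zero] at hlim
  exact ge_of_tendsto' hlim key

end IsPoissonRandomMeasure

/-! ### Uniqueness, linearity and characteristic function of compensated integrals in L² -/

namespace IsL2CompensatedIntegral

variable {S Ω : Type*} [MeasurableSpace S] [MeasurableSpace Ω] {N : Ω → Measure S} {η : Measure S}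
  {P : Measure Ω} {f f' : S → ℝ} {X X' : Ω → ℝ}

lemma tendsto_eLpNorm (hX : IsL2CompensatedIntegral N η P f X) {g : ℕ → S → ℝ}
    (hg : ∀ n, Integrable (g n) η) (hg2 : ∀ n, MemLp (g n) 2 η)
    (h : Tendsto (fun n => eLpNorm (g n - f) 2 η) atTop (𝓝 0)) :
    Tendsto (fun n => eLpNorm (compensatedIntegral N η (g n) - X) 2 P) atTop (𝓝 0) :=
  tendsto_of_tendsto_of_tendsto_of_le_of_le tendsto_const_nhds h (fun _ => zero_le)
    fun n => hX.eLpNorm_sub_le _ (hg n) (hg2 n)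

/-- Pointwise dominated convergence to f is convergence in L²(η). It passes to L²(P) by the defining
inequality, hence to convergence in probability. -/
lemma isCentredPoissonIntegral [SigmaFinite η] [IsProbabilityMeasure P]
    (hN : IsPoissonRandomMeasure N η P) (hX : IsL2CompensatedIntegral N η P f X) :
    IsCentredPoissonIntegral N η P f X := by
  refine ⟨hX.aemeasurable, fun g hgm hg hb hlim => ?_⟩
  have hg2 : ∀ n, MemLp (g n) 2 η := fun n => hX.memLp.mono (hgm n).aestronglyMeasurable (hb n)
  refine tendstoInMeasure_of_tendsto_eLpNorm (p := 2) (by simp)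
    (fun n => (hN.aemeasurable_compensatedIntegral (hg n)).aestronglyMeasurable)
    hX.aemeasurable.aestronglyMeasurable ?_
  exact hX.tendsto_eLpNorm hg hg2
    (tendsto_eLpNorm_two_sub hX.memLp (fun n => (hgm n).aestronglyMeasurable) hb hlim)

lemma congr (hX : IsL2CompensatedIntegral N η P f X) (h : X =ᵐ[P] X') :
    IsL2CompensatedIntegral N η P f X' where
  memLp := hX.memLp
  aemeasurable := hX.aemeasurable.congr h
  eLpNorm_sub_le g hg hg2 := by
    rw [← eLpNorm_congr_ae ((ae_eq_refl (compensatedIntegral N η g)).sub h)]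
    exact hX.eLpNorm_sub_le g hg hg2

/-- The random variable `centredPoissonIntegral` is picked by choice, so its properties must come
from uniqueness. Any X of this kind and the L² limit are limits in probability of the same sequence,
the truncations of a measurable version of f. -/
lemma of_isCentredPoissonIntegral [SigmaFinite η] [IsProbabilityMeasure P]
    (hN : IsPoissonRandomMeasure N η P) (hf : MemLp f 2 η)
    (hX : IsCentredPoissonIntegral N η P f X) : IsL2CompensatedIntegral N η P f X := by
  obtain ⟨X', hX'⟩ := hN.exists_isL2CompensatedIntegral hf
  refine hX'.congr ?_
  set g := hf.1.mk f
  have hgm : Measurable g := hf.1.stronglyMeasurable_mk.measurable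
  have hfg : f =ᵐ[η] g := hf.1.ae_eq_mk
  have hg : MemLp g 2 η := hf.ae_eq hfg
  have hm : ∀ n, Measurable (cutSmall g n) := fun n =>
    hgm.indicator (measurableSet_lt measurable_const hgm.abs)
  have hb : ∀ n, ∀ᵐ s ∂η, |cutSmall g n s| ≤ |f s| := fun n =>
    hfg.mono fun s hs => hs ▸ abs_cutSmall_le g n s
  have hl : ∀ᵐ s ∂η, Tendsto (fun n => cutSmall g n s) atTop (𝓝 (f s)) :=
    hfg.mono fun s hs => hs ▸ tendsto_cutSmall g s
  exact tendstoInMeasure_ae_unique ((hX'.isCentredPoissonIntegral hN).2 (cutSmall g) hm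
    (integrable_cutSmall hg) hb hl) (hX.2 (cutSmall g) hm (integrable_cutSmall hg) hb hl)

lemma const_smul [SigmaFinite η] [IsProbabilityMeasure P] (hN : IsPoissonRandomMeasure N η P)
    (hX : IsL2CompensatedIntegral N η P f X) (c : ℝ) :
    IsL2CompensatedIntegral N η P (c • f) (c • X) where
  memLp := hX.memLp.const_smul c
  aemeasurable := hX.aemeasurable.const_smul c
  eLpNorm_sub_le g hg hg2 := by
    rcases eq_or_ne c 0 with rfl | hc
    · simp only [zero_smul, sub_zero]
      exact eLpNorm_two_le_of_sq (hN.lintegral_sq_compensatedIntegral_le hg hg2)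
    · have h := hX.eLpNorm_sub_le (c⁻¹ • g) (hg.smul c⁻¹) (hg2.const_smul c⁻¹)
      have e1 : compensatedIntegral N η g - c • X =
          c • (compensatedIntegral N η (c⁻¹ • g) - X) := by
        rw [compensatedIntegral_const_smul, smul_sub, smul_inv_smul₀ hc]
      have e2 : g - c • f = c • (c⁻¹ • g - f) := by rw [smul_sub, smul_inv_smul₀ hc]
      rw [e1, e2, eLpNorm_const_smul, eLpNorm_const_smul]
      gcongr

lemma add [SigmaFinite η] [IsProbabilityMeasure P] (hN : IsPoissonRandomMeasure N η P)
    (hX : IsL2CompensatedIntegral N η P f X) (hX' : IsL2CompensatedIntegral N η P f' X') :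
    IsL2CompensatedIntegral N η P (f + f') (X + X') where
  memLp := hX.memLp.add hX'.memLp
  aemeasurable := hX.aemeasurable.add hX'.aemeasurable
  eLpNorm_sub_le g hg hg2 := by
    have hi := integrable_cutSmall hX.memLp
    have h2 := memLp_cutSmall hX.memLp
    -- Split g into a truncation of f, compared with X, and the rest g - `cutSmall f n`, compared
    -- with X'. The rest differs from f' by g - (f + f') plus a term that tends to 0.
    have key : ∀ n, eLpNorm (compensatedIntegral N η g - (X + X')) 2 P ≤
        eLpNorm (compensatedIntegral N η (cutSmall f n) - X) 2 P + (eLpNorm (g - (f + f')) 2 η +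
          eLpNorm (cutSmall f n - f) 2 η) := by
      intro n
      have hIn := hN.memLp_compensatedIntegral (hi n) (h2 n)
      have hgi := hg.sub (hi n)
      have hg2' := hg2.sub (h2 n)
      have e : compensatedIntegral N η g - (X + X') =ᵐ[P]
          (compensatedIntegral N η (cutSmall f n) - X) +
          (compensatedIntegral N η (g - cutSmall f n) - X') := by
        filter_upwards [hN.compensatedIntegral_sub hg (hi n)] with ω hω
        simp only [Pi.sub_apply, Pi.add_apply] at hω ⊢
        rw [hω]; ring
      rw [eLpNorm_congr_ae e]
      refine (eLpNorm_add_le (hIn.1.sub hX.aemeasurable.aestronglyMeasurable)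
        ((hN.memLp_compensatedIntegral hgi hg2').1.sub hX'.aemeasurable.aestronglyMeasurable)
        (by norm_num)).trans ?_
      gcongr
      refine (hX'.eLpNorm_sub_le _ hgi hg2').trans ?_
      have e2 : g - cutSmall f n - f' = (g - (f + f')) + (f - cutSmall f n) := by abel
      rw [e2, eLpNorm_sub_comm (cutSmall f n) f]
      exact eLpNorm_add_le (hg2.1.sub (hX.memLp.add hX'.memLp).1) (hX.memLp.1.sub (h2 n).1)
        (by norm_num)
    have hlim := (hX.tendsto_eLpNorm hi h2 (tendsto_eLpNorm_cutSmall_sub hX.memLp)).add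
      ((tendsto_const_nhds (x := eLpNorm (g - (f + f')) 2 η)).add
      (tendsto_eLpNorm_cutSmall_sub hX.memLp))
    simp only [add_zero, zero_add] at hlim
    exact ge_of_tendsto' hlim key

lemma sum [SigmaFinite η] [IsProbabilityMeasure P] (hN : IsPoissonRandomMeasure N η P)
    {ι : Type*} (s : Finset ι) {f : ι → S → ℝ} {X : ι → Ω → ℝ}
    (hX : ∀ i ∈ s, IsL2CompensatedIntegral N η P (f i) (X i)) :
    IsL2CompensatedIntegral N η P (∑ i ∈ s, f i) (∑ i ∈ s, X i) := by
  classical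
  induction s using Finset.induction_on with
  | empty =>
    simp only [Finset.sum_empty]
    refine ⟨MemLp.zero, aemeasurable_const, fun g hg hg2 => ?_⟩
    simp only [sub_zero]
    exact eLpNorm_two_le_of_sq (hN.lintegral_sq_compensatedIntegral_le hg hg2)
  | insert i s hi ih =>
    rw [Finset.sum_insert hi, Finset.sum_insert hi]
    exact (hX i (by simp)).add hN (ih fun j hj => hX j (by simp [hj]))

/-- The characteristic function of a centred Poisson integral. -/
lemma integral_exp [SigmaFinite η] [IsProbabilityMeasure P] (hN : IsPoissonRandomMeasure N η P)
    (hX : IsL2CompensatedIntegral N η P f X) :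
    ∫ ω, Complex.exp ((X ω : ℝ) * Complex.I) ∂P = Complex.exp (∫ s, compExp (f s) ∂η) := by
  have hi := integrable_cutSmall hX.memLp
  have h2 := memLp_cutSmall hX.memLp
  have h1 : Tendsto (fun n => ∫ ω, Complex.exp ((compensatedIntegral N η (cutSmall f n) ω : ℝ) *
      Complex.I) ∂P) atTop (𝓝 (∫ ω, Complex.exp ((X ω : ℝ) * Complex.I) ∂P)) := by
    refine tendsto_integral_exp_of_tendsto_lintegral
      (fun n => hN.aemeasurable_compensatedIntegral (hi n)) hX.aemeasurable ?_
    refine tendsto_of_tendsto_of_tendsto_of_le_of_le tendsto_const_nhds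
      (hX.tendsto_eLpNorm hi h2 (tendsto_eLpNorm_cutSmall_sub hX.memLp)) (fun _ => zero_le) fun n => ?_
    have := eLpNorm_le_eLpNorm_of_exponent_le (μ := P) (p := 1) (q := 2) (by norm_num)
      ((hN.memLp_compensatedIntegral (hi n) (h2 n)).1.sub hX.aemeasurable.aestronglyMeasurable)
    rwa [eLpNorm_one_eq_lintegral_enorm] at this
  refine tendsto_nhds_unique h1 ?_
  simp_rw [fun n => (show ∫ ω, Complex.exp ((compensatedIntegral N η (cutSmall f n) ω : ℝ) *
      Complex.I) ∂P = _ from hN.integral_exp_sub (hi n))]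
  refine (Complex.continuous_exp.tendsto _).comp ?_
  -- The quadratic bound on Ψ gives the majorant f², so no integrability of f itself is needed.
  refine tendsto_integral_of_dominated_convergence (fun s => f s ^ 2) (fun n => ?_)
    hX.memLp.integrable_sq (fun n => ae_of_all _ fun s => ?_) (ae_of_all _ fun s => ?_)
  · exact (integrable_compExp (hi n)).1
  · refine (norm_compExp_le_sq _).trans ?_
    have := sq_le_sq' (by linarith [neg_abs_le (cutSmall f n s), abs_cutSmall_le f n s])
      ((le_abs_self _).trans (abs_cutSmall_le f n s))
    rw [sq_abs] at this
    have := sq_nonneg (cutSmall f n s)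
    linarith
  · exact (continuous_compExp.tendsto _).comp (tendsto_cutSmall f s)

end IsL2CompensatedIntegral

/-! ### Regularly varying tails -/

section Tail

variable {F : Measure ℝ} [IsProbabilityMeasure F] {γ : ℝ}

lemma tail_antitone (F : Measure ℝ) [IsProbabilityMeasure F] : Antitone (tail F) :=
  fun _ _ h => measureReal_mono (Ioi_subset_Ioi h)

lemma tail_le_one (F : Measure ℝ) [IsProbabilityMeasure F] (v : ℝ) : tail F v ≤ 1 :=
  measureReal_le_one

lemma tail_nonneg (F : Measure ℝ) (v : ℝ) : 0 ≤ tail F v := measureReal_nonneg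

lemma tail_eq (F : Measure ℝ) [IsProbabilityMeasure F] (v : ℝ) : tail F v = 1 - F.real (Iic v) := by
  rw [tail, ← compl_Iic, probReal_compl_eq_one_sub measurableSet_Iic]

lemma tail_zero (hF0 : F (Iic 0) = 0) : tail F 0 = 1 := by
  rw [tail_eq, measureReal_def, hF0]; simp

lemma tendsto_tail_atTop (F : Measure ℝ) [IsProbabilityMeasure F] :
    Tendsto (tail F) atTop (𝓝 0) := by
  have h := (tendsto_cdf_atTop F).const_sub 1
  simp only [sub_self] at h
  refine h.congr fun v => ?_
  rw [tail_eq, cdf_eq_real]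

lemma continuousWithinAt_tail (F : Measure ℝ) [IsProbabilityMeasure F] (v : ℝ) :
    ContinuousWithinAt (tail F) (Ici v) v := by
  have h : ContinuousWithinAt (fun x => 1 - cdf F x) (Ici v) v :=
    continuousWithinAt_const.sub ((cdf F).right_continuous v)
  refine h.congr (fun x _ => ?_) ?_
  · rw [tail_eq, cdf_eq_real]
  · rw [tail_eq, cdf_eq_real]

namespace HasRegularlyVaryingTail

/-- If the tail vanished at v it would vanish beyond v. The quotient at a = 1 would then be 0/0 = 0,
whereas its limit is 1. -/
lemma tail_pos (hF : HasRegularlyVaryingTail F γ) (v : ℝ) : 0 < tail F v := by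
  by_contra h
  have h0 : tail F v = 0 := le_antisymm (not_lt.1 h) (tail_nonneg F v)
  have h1 := hF 1 one_pos
  have h2 : Tendsto (fun v => tail F (1 * v) / tail F v) atTop (𝓝 0) := by
    refine tendsto_const_nhds.congr' ?_
    filter_upwards [eventually_ge_atTop v] with w hw
    have : tail F w = 0 := le_antisymm (h0 ▸ tail_antitone F hw) (tail_nonneg F w)
    simp [this]
  have := tendsto_nhds_unique h1 h2
  simp at this

/-- Regular variation at the single ratio 2, with slack δ in the exponent. Iterating it yields the
Potter bounds. -/
lemma eventually_dyadic (hF : HasRegularlyVaryingTail F γ) {δ : ℝ} (hδ : 0 < δ) :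
    ∀ᶠ v in atTop, tail F (2 * v) ≤ 2 ^ (-(γ - δ)) * tail F v ∧
      tail F v ≤ 2 ^ (γ + δ) * tail F (2 * v) := by
  have h := hF 2 two_pos
  have h1 : (2 : ℝ) ^ (-γ) < 2 ^ (-(γ - δ)) :=
    Real.rpow_lt_rpow_of_exponent_lt one_lt_two (by linarith)
  have h2 : (2 : ℝ) ^ (-(γ + δ)) < 2 ^ (-γ) :=
    Real.rpow_lt_rpow_of_exponent_lt one_lt_two (by linarith)
  filter_upwards [h.eventually_lt_const h1, h.eventually_const_lt h2] with v hv1 hv2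
  have hp := hF.tail_pos v
  constructor
  · exact ((div_lt_iff₀ hp).1 hv1).le
  · have := ((lt_div_iff₀ hp).1 hv2).le
    rw [Real.rpow_neg two_pos.le] at this
    have hpos : (0 : ℝ) < 2 ^ (γ + δ) := Real.rpow_pos_of_pos two_pos _
    rwa [inv_mul_le_iff₀ hpos] at this

/-- Potter bounds. -/
lemma potter (hF : HasRegularlyVaryingTail F γ) {δ : ℝ} (hδ : 0 < δ) (hδγ : δ < γ) :
    ∃ c : ℝ, 0 < c ∧ ∃ x₀ : ℝ, 0 < x₀ ∧ ∀ x, x₀ ≤ x →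
      (∀ m, 0 < m → m ≤ 1 → tail F (x * m) ≤ c * m ^ (-(γ + δ)) * tail F x) ∧
      (∀ m, 1 ≤ m → tail F (x * m) ≤ c * m ^ (-(γ - δ)) * tail F x) := by
  obtain ⟨y, hy⟩ := eventually_atTop.1 (hF.eventually_dyadic hδ)
  set x₀ := max y 1 with hx₀
  have hx₀pos : 0 < x₀ := lt_of_lt_of_le one_pos (le_max_right _ _)
  have hdy : ∀ v, x₀ ≤ v → tail F (2 * v) ≤ 2 ^ (-(γ - δ)) * tail F v ∧
      tail F v ≤ 2 ^ (γ + δ) * tail F (2 * v) := fun v hv => hy v ((le_max_left _ _).trans hv)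
  have hiter : ∀ n : ℕ, ∀ v, x₀ ≤ v → tail F (2 ^ n * v) ≤ ((2 : ℝ) ^ n) ^ (-(γ - δ)) * tail F v ∧
      tail F v ≤ ((2 : ℝ) ^ n) ^ (γ + δ) * tail F (2 ^ n * v) := by
    intro n
    induction n with
    | zero => intro v _; simp
    | succ n ih =>
      intro v hv
      have hpow : (1 : ℝ) ≤ 2 ^ n := one_le_pow₀ one_le_two
      have hge : x₀ ≤ 2 ^ n * v := by nlinarith
      obtain ⟨a1, a2⟩ := ih v hv
      obtain ⟨b1, b2⟩ := hdy _ hge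
      have e : (2 : ℝ) ^ (n + 1) * v = 2 * (2 ^ n * v) := by ring
      have e2 : ∀ p : ℝ, ((2 : ℝ) ^ (n + 1)) ^ p = 2 ^ p * ((2 : ℝ) ^ n) ^ p := by
        intro p
        rw [pow_succ', Real.mul_rpow two_pos.le (by positivity)]
      rw [e, e2, e2]
      constructor
      · calc _ ≤ 2 ^ (-(γ - δ)) * tail F (2 ^ n * v) := b1
          _ ≤ 2 ^ (-(γ - δ)) * (((2 : ℝ) ^ n) ^ (-(γ - δ)) * tail F v) := by gcongr
          _ = _ := by ring
      · calc _ ≤ ((2 : ℝ) ^ n) ^ (γ + δ) * tail F (2 ^ n * v) := a2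
          _ ≤ ((2 : ℝ) ^ n) ^ (γ + δ) * (2 ^ (γ + δ) * tail F (2 * (2 ^ n * v))) := by gcongr
          _ = _ := by ring
  -- Choose n with 2^n ≤ x/u < 2^{n+1} and iterate n + 1 times to pass beyond x. The overshoot costs
  -- the factor 2.
  have hup : ∀ u x, x₀ ≤ u → u ≤ x → tail F u ≤ (2 * (x / u)) ^ (γ + δ) * tail F x := by
    intro u x hu hux
    have hupos : 0 < u := hx₀pos.trans_le hu
    obtain ⟨n, hn1, hn2⟩ := exists_nat_pow_near ((one_le_div hupos).2 hux) one_lt_two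
    have h1 := (hiter (n + 1) u hu).2
    refine h1.trans ?_
    have h2 : x ≤ 2 ^ (n + 1) * u := ((div_lt_iff₀ hupos).1 hn2).le
    have h3 : (2 : ℝ) ^ (n + 1) ≤ 2 * (x / u) := by rw [pow_succ']; gcongr
    exact mul_le_mul (Real.rpow_le_rpow (by positivity) h3 (by linarith)) (tail_antitone F h2)
      (tail_nonneg F _) (Real.rpow_nonneg (by have := div_nonneg (hupos.le.trans hux) hupos.le; linarith) _)
  have hdown : ∀ x m, x₀ ≤ x → 1 ≤ m → tail F (x * m) ≤ (m / 2) ^ (-(γ - δ)) * tail F x := by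
    intro x m hx hm
    obtain ⟨n, hn1, hn2⟩ := exists_nat_pow_near hm one_lt_two
    have hxpos : 0 < x := hx₀pos.trans_le hx
    have h1 : tail F (x * m) ≤ tail F (2 ^ n * x) := by
      refine tail_antitone F ?_
      rw [mul_comm]; gcongr
    refine h1.trans ((hiter n x hx).1.trans ?_)
    have := tail_nonneg F x
    have h2 : m / 2 ≤ 2 ^ n := by rw [pow_succ'] at hn2; linarith
    gcongr ?_ * _
    exact Real.rpow_le_rpow_of_nonpos (by linarith) h2 (by linarith)
  have ht0 := hF.tail_pos x₀
  -- The first entry serves m ≤ 1, including the range x m < x₀ where the dyadic estimate fails. The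
  -- second is the loss from rounding m ≥ 1 down to a power of 2.
  set c := max (2 ^ (γ + δ) / tail F x₀) (2 ^ (γ - δ)) with hc
  have hc1 : 2 ^ (γ + δ) / tail F x₀ ≤ c := le_max_left _ _
  have hc2 : (2 : ℝ) ^ (γ - δ) ≤ c := le_max_right _ _
  have h2p : (0 : ℝ) < 2 ^ (γ + δ) := by positivity
  have hc3 : (2 : ℝ) ^ (γ + δ) ≤ c := by
    refine le_trans ?_ hc1
    rw [le_div_iff₀ ht0]
    nlinarith [tail_le_one F x₀]
  refine ⟨c, by linarith, x₀, hx₀pos, fun x hx => ⟨fun m hm hm1 => ?_, fun m hm => ?_⟩⟩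
  · have hxpos : 0 < x := hx₀pos.trans_le hx
    have htx := tail_nonneg F x
    have hmp : (0 : ℝ) < m ^ (-(γ + δ)) := Real.rpow_pos_of_pos hm _
    rcases le_total x₀ (x * m) with h | h
    · refine (hup (x * m) x h (by nlinarith)).trans ?_
      have e : 2 * (x / (x * m)) = 2 * m⁻¹ := by field_simp
      rw [e, Real.mul_rpow two_pos.le (by positivity), Real.inv_rpow hm.le, ← Real.rpow_neg hm.le]
      gcongr
    · have h1 := hup x₀ x le_rfl hx
      -- Below x₀ the tail is merely bounded by 1, and `hup` from x₀ to x bounds 1 in terms of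
      -- F̄(x)/F̄(x₀). Since x m ≤ x₀, the ratio x/x₀ is at most 1/m.
      have h2 : tail F (x * m) ≤ 2 ^ (γ + δ) / tail F x₀ * (x / x₀) ^ (γ + δ) * tail F x := by
        have e : 2 ^ (γ + δ) / tail F x₀ * (x / x₀) ^ (γ + δ) * tail F x =
            ((2 * (x / x₀)) ^ (γ + δ) * tail F x) / tail F x₀ := by
          rw [Real.mul_rpow two_pos.le (by positivity)]; ring
        rw [e]
        exact (tail_le_one F _).trans ((one_le_div ht0).2 h1)
      refine h2.trans ?_
      have h3 : (x / x₀) ^ (γ + δ) ≤ m ^ (-(γ + δ)) := by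
        rw [Real.rpow_neg hm.le, ← Real.inv_rpow hm.le]
        refine Real.rpow_le_rpow (by positivity) ?_ (by linarith)
        rw [div_le_iff₀ hx₀pos, inv_mul_eq_div, le_div_iff₀ hm]
        exact h
      gcongr
  · refine (hdown x m hx hm).trans ?_
    have hmp : (0 : ℝ) ≤ m ^ (-(γ - δ)) := by positivity
    have e : (m / 2) ^ (-(γ - δ)) = 2 ^ (γ - δ) * m ^ (-(γ - δ)) := by
      rw [Real.div_rpow (by linarith) two_pos.le, Real.rpow_neg two_pos.le, div_inv_eq_mul, mul_comm]
    rw [e]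
    have := tail_nonneg F x
    gcongr

/-! ### The quantile function -/

/-- The Galois relation between the tail and its generalised inverse. The nontrivial direction uses
right continuity of the tail. Every later property of the quantile is deduced from this equivalence.
-/
lemma tailQuantile_one_div_le_iff (hF : HasRegularlyVaryingTail F γ) {u v : ℝ} (hu : 0 < u)
    (hv : 0 ≤ v) : tailQuantile F (1 / u) ≤ v ↔ tail F v ≤ u := by
  have hset : {v : ℝ | 0 ≤ v ∧ 1 / u ≤ 1 / tail F v} = {v : ℝ | 0 ≤ v ∧ tail F v ≤ u} := by
    ext w
    simp only [mem_ofPred_eq]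
    rw [one_div_le_one_div hu (hF.tail_pos w)]
  rw [tailQuantile, hset]
  have hbdd : BddBelow {v : ℝ | 0 ≤ v ∧ tail F v ≤ u} := ⟨0, fun w hw => hw.1⟩
  constructor
  · intro h
    have hne : {v : ℝ | 0 ≤ v ∧ tail F v ≤ u}.Nonempty := by
      obtain ⟨w, hw1, hw2⟩ := (((tendsto_tail_atTop F).eventually_lt_const hu).and
        (eventually_ge_atTop 0)).exists
      exact ⟨w, hw2, hw1.le⟩
    refine le_of_tendsto ((continuousWithinAt_tail F v).mono_left
      (nhdsWithin_mono v Ioi_subset_Ici_self)) ?_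
    filter_upwards [self_mem_nhdsWithin] with w (hw : v < w)
    obtain ⟨z, hz, hzw⟩ := exists_lt_of_csInf_lt hne (h.trans_lt hw)
    exact (tail_antitone F hzw.le).trans hz.2
  · intro h
    exact csInf_le hbdd ⟨hv, h⟩

lemma _root_.tailQuantile_nonneg (F : Measure ℝ) (u : ℝ) : 0 ≤ tailQuantile F u :=
  Real.sInf_nonneg fun _ h => h.1

lemma tailQuantile_one_div_of_nonpos (hF : HasRegularlyVaryingTail F γ) {u : ℝ} (hu : u ≤ 0) :
    tailQuantile F (1 / u) = 0 := by
  refine le_antisymm (csInf_le ⟨0, fun w hw => hw.1⟩ ⟨le_rfl, ?_⟩) (tailQuantile_nonneg F _)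
  have := hF.tail_pos 0
  exact (one_div_nonpos.2 hu).trans (by positivity)

lemma measurable_quantile (hF : HasRegularlyVaryingTail F γ) :
    Measurable fun u => tailQuantile F (1 / u) := by
  refine measurable_of_Iic fun a => ?_
  rcases lt_or_ge a 0 with ha | ha
  · convert! MeasurableSet.empty
    ext u
    simpa using ha.trans_le (tailQuantile_nonneg F _)
  · have : (fun u => tailQuantile F (1 / u)) ⁻¹' Iic a = Iic 0 ∪ (Ioi 0 ∩ Ici (tail F a)) := by
      ext u
      rcases le_or_gt u 0 with hu | hu
      · simp only [mem_preimage, mem_Iic, hF.tailQuantile_one_div_of_nonpos hu, mem_union, hu,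
          true_or, iff_true]
        exact ha
      · simp only [mem_preimage, mem_Iic, hF.tailQuantile_one_div_le_iff hu ha, mem_union,
          mem_inter_iff, mem_Ioi, hu, mem_Ici, true_and, not_le.2 hu, false_or]
    rw [this]
    exact measurableSet_Iic.union (measurableSet_Ioi.inter measurableSet_Ici)

/-- Inverse transform sampling: the quantile at 1/U has law F when U is uniform on (0,1), since it
is at most a ≥ 0 exactly when U ≥ F̄(a). -/
lemma map_quantile (hF : HasRegularlyVaryingTail F γ) (hF0 : F (Iic 0) = 0) :
    (volume.restrict (Ioo (0 : ℝ) 1)).map (fun u => tailQuantile F (1 / u)) = F := by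
  refine Measure.ext_of_Iic _ _ fun a => ?_
  rw [Measure.map_apply hF.measurable_quantile measurableSet_Iic,
    Measure.restrict_apply (hF.measurable_quantile measurableSet_Iic)]
  rcases lt_or_ge a 0 with ha | ha
  · have h1 : (fun u => tailQuantile F (1 / u)) ⁻¹' Iic a = ∅ := by
      ext u
      simpa using ha.trans_le (tailQuantile_nonneg F _)
    rw [h1, empty_inter, measure_empty]
    exact (measure_mono_null (Iic_subset_Iic.2 ha.le) hF0).symm
  · have h1 : (fun u => tailQuantile F (1 / u)) ⁻¹' Iic a ∩ Ioo 0 1 = Ico (tail F a) 1 := by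
      ext u
      have := hF.tail_pos a
      simp only [mem_inter_iff, mem_preimage, mem_Iic, mem_Ioo, mem_Ico]
      constructor
      · rintro ⟨h1, h2, h3⟩
        exact ⟨(hF.tailQuantile_one_div_le_iff h2 ha).1 h1, h3⟩
      · rintro ⟨h1, h2⟩
        have h3 : 0 < u := by linarith
        exact ⟨(hF.tailQuantile_one_div_le_iff h3 ha).2 h1, h3, h2⟩
    rw [h1, Real.volume_Ico, tail_eq, sub_sub_cancel, measureReal_def,
      ENNReal.ofReal_toReal (measure_ne_top _ _)]

/-- Regular variation inverted. The quantile is at most zx iff F̄(xz)/F̄(x) ≤ w, and this ratio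
tends to z^{-γ}, so the transition happens at z = w^{-1/γ}. -/
lemma tendsto_quantile_div (hF : HasRegularlyVaryingTail F γ) (hγ : 0 < γ) {ι : Type*}
    {l : Filter ι} {x : ι → ℝ} (hx : Tendsto x l atTop) {w : ℝ} (hw : 0 < w) :
    Tendsto (fun i => tailQuantile F (1 / (tail F (x i) * w)) / x i) l (𝓝 (w ^ (-1 / γ))) := by
  have hpos : (0 : ℝ) < w ^ (-1 / γ) := Real.rpow_pos_of_pos hw _
  have hww : (w ^ (-1 / γ)) ^ (-γ) = w := by
    rw [← Real.rpow_mul hw.le]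
    have : -1 / γ * -γ = 1 := by field_simp
    rw [this, Real.rpow_one]
  have hlim : ∀ y, Tendsto (fun i => tail F (x i * y) / tail F (x i)) l (𝓝 (y ^ (-γ))) ∨ y ≤ 0 := by
    intro y
    rcases le_or_gt y 0 with hy | hy
    · exact Or.inr hy
    · refine Or.inl (((hF y hy).comp hx).congr fun i => ?_)
      simp [mul_comm]
  refine tendsto_order.2 ⟨fun y hy => ?_, fun y hy => ?_⟩
  -- The lower bound y may be nonpositive. It is replaced by a positive level still below w^{-1/γ}.
  · set z := max y (w ^ (-1 / γ) / 2) with hz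
    have hz0 : 0 < z := lt_of_lt_of_le (by positivity) (le_max_right _ _)
    have hzw : z < w ^ (-1 / γ) := max_lt hy (by linarith)
    have h1 : w < z ^ (-γ) := by
      rw [← hww]
      exact Real.rpow_lt_rpow_of_neg hz0 hzw (by linarith)
    have h2 := (hlim z).resolve_right hz0.not_ge
    filter_upwards [h2.eventually_const_lt h1, hx.eventually_gt_atTop 0] with i hi hxi
    have hp := hF.tail_pos (x i)
    refine (show y ≤ z from le_max_left y _).trans_lt ?_
    rw [lt_div_iff₀ hxi]
    by_contra! hcon
    have h3 := (hF.tailQuantile_one_div_le_iff (mul_pos hp hw) (by positivity)).1 hcon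
    have h4 := (lt_div_iff₀ hp).1 hi
    rw [mul_comm z] at h3
    linarith
  · obtain ⟨z, hz1, hz2⟩ := exists_between hy
    have hz0 : 0 < z := hpos.trans hz1
    have h1 : z ^ (-γ) < w := by
      conv_rhs => rw [← hww]
      exact Real.rpow_lt_rpow_of_neg hpos hz1 (by linarith)
    have h2 := (hlim z).resolve_right hz0.not_ge
    filter_upwards [h2.eventually_lt_const h1, hx.eventually_gt_atTop 0] with i hi hxi
    have hp := hF.tail_pos (x i)
    refine lt_of_le_of_lt ?_ hz2
    rw [div_le_iff₀ hxi]
    refine (hF.tailQuantile_one_div_le_iff (mul_pos hp hw) (by positivity)).2 ?_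
    have h4 := (div_lt_iff₀ hp).1 hi
    rw [mul_comm z]
    linarith

lemma tailQuantile_one_div_pos (hF : HasRegularlyVaryingTail F γ) (hF0 : F (Iic 0) = 0) {u : ℝ}
    (hu : 0 < u) (hu1 : u < 1) : 0 < tailQuantile F (1 / u) := by
  by_contra! h
  have := (hF.tailQuantile_one_div_le_iff hu le_rfl).1 h
  rw [tail_zero hF0] at this
  linarith

/-- Integrals of rescaled functions against a law with a regularly varying tail converge to
integrals against the stable intensity. -/
theorem tendsto_integral_rescaled (hF : HasRegularlyVaryingTail F γ) (hF0 : F (Iic 0) = 0)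
    (hγ : 1 < γ) {γ' : ℝ} (hγ' : γ < γ') {ι : Type*} {l : Filter ι} [l.IsCountablyGenerated]
    {x : ι → ℝ} (hx : Tendsto x l atTop) {g : ι → ℝ → ℂ} {g₀ : ℝ → ℂ}
    (hgm : ∀ i, StronglyMeasurable (g i)) {K : ℝ}
    (hb1 : ∀ᶠ i in l, ∀ v, 0 < v → ‖g i v‖ ≤ K * v ^ γ')
    (hb2 : ∀ᶠ i in l, ∀ v, 0 < v → ‖g i v‖ ≤ K * v)
    (hlim : ∀ (v : ι → ℝ) (v₀ : ℝ), 0 < v₀ → Tendsto v l (𝓝 v₀) →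
      Tendsto (fun i => g i (v i)) l (𝓝 (g₀ v₀))) :
    Tendsto (fun i => (tail F (x i))⁻¹ • ∫ v, g i (v / x i) ∂F) l
      (𝓝 (∫ v in Ioi (0 : ℝ), (γ * v ^ (-γ - 1)) • g₀ v)) := by
  have hq := hF.measurable_quantile
  have hγ0 : 0 < γ := by linarith
  set q : ℝ → ℝ := fun u => tailQuantile F (1 / u) with hqdef
  -- The integrand after u = F̄(x) w. The indicator records u < 1.
  set h : ι → ℝ → ℂ := fun i w => (Iio (1 : ℝ)).indicator (fun u => g i (q u / x i)) (tail F (x i) * w)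
    with hh
  have hlhs : ∀ i, (tail F (x i))⁻¹ • ∫ v, g i (v / x i) ∂F = ∫ w in Ioi (0 : ℝ), h i w := by
    intro i
    have hp := hF.tail_pos (x i)
    have h1 : ∫ v, g i (v / x i) ∂F = ∫ u in Ioo (0 : ℝ) 1, g i (q u / x i) := by
      conv_lhs => rw [← hF.map_quantile hF0]
      rw [integral_map hq.aemeasurable]
      exact ((hgm i).comp_measurable (measurable_id.div_const _)).aestronglyMeasurable
    have h2 : ∫ u in Ioo (0 : ℝ) 1, g i (q u / x i) =
        ∫ u in Ioi (0 : ℝ), (Iio (1 : ℝ)).indicator (fun u => g i (q u / x i)) u := by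
      rw [setIntegral_indicator measurableSet_Iio, Ioi_inter_Iio]
    rw [h1, h2, hh]
    have := integral_comp_mul_left_Ioi ((Iio (1 : ℝ)).indicator (fun u => g i (q u / x i))) 0 hp
    rw [this, mul_zero]
  simp_rw [hlhs]
  -- The substitution w = v^{-γ} carries dw to γ v^{-γ-1} dv.
  have hrhs : ∫ v in Ioi (0 : ℝ), (γ * v ^ (-γ - 1)) • g₀ v =
      ∫ w in Ioi (0 : ℝ), g₀ (w ^ (-1 / γ)) := by
    rw [← integral_comp_rpow_Ioi (fun w => g₀ (w ^ (-1 / γ))) (p := -γ) (by linarith)]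
    refine setIntegral_congr_fun measurableSet_Ioi fun v (hv : 0 < v) => ?_
    simp only [abs_neg, abs_of_pos hγ0]
    rw [← Real.rpow_mul hv.le]
    have : -γ * (-1 / γ) = 1 := by field_simp
    rw [this, Real.rpow_one]
  rw [hrhs]
  -- The slack keeps γ + δ < γ' and γ - δ > 1. These are the conditions for the majorant to be
  -- integrable at infinity and at 0.
  set δ := min ((γ' - γ) / 2) ((γ - 1) / 2) with hδdef
  have hδ : 0 < δ := lt_min (by linarith) (by linarith)
  have hδ1 : γ + δ < γ' := by linarith [min_le_left ((γ' - γ) / 2) ((γ - 1) / 2)]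
  have hδ2 : 1 < γ - δ := by linarith [min_le_right ((γ' - γ) / 2) ((γ - 1) / 2)]
  obtain ⟨c, hc, x₀, hx₀, hpot⟩ := hF.potter hδ (by linarith : δ < γ)
  -- By the Potter bounds the rescaled quantile is at most (w/c)^{-1/(γ-δ)} for w ≤ c and
  -- (w/c)^{-1/(γ+δ)} for w > c. Small w means large volume, where the linear bound on g is used.
  -- Large w means small volume, where the power γ' is used.
  set bound : ℝ → ℝ := fun w => (Ioc 0 c).indicator (fun w => |K| * (w / c) ^ (-1 / (γ - δ))) w +
    (Ioi c).indicator (fun w => |K| * (w / c) ^ (-γ' / (γ + δ))) w with hbound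
  refine tendsto_integral_filter_of_dominated_convergence bound ?_ ?_ ?_ ?_
  · refine Eventually.of_forall fun i => ?_
    have h1 : StronglyMeasurable ((Iio (1 : ℝ)).indicator fun u => g i (q u / x i)) :=
      ((hgm i).comp_measurable (hq.div_const _)).indicator measurableSet_Iio
    exact (h1.comp_measurable (measurable_id.const_mul (tail F (x i)))).aestronglyMeasurable
  · filter_upwards [hb1, hb2, hx.eventually_ge_atTop x₀] with i hi1 hi2 hxi
    refine (ae_restrict_iff' measurableSet_Ioi).2 (ae_of_all _ fun w (hw : 0 < w) => ?_)
    have hp := hF.tail_pos (x i)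
    have hxi0 : 0 < x i := hx₀.trans_le hxi
    have hbn : 0 ≤ bound w := by
      simp only [hbound]
      refine add_nonneg (indicator_nonneg (fun w hw => ?_) _) (indicator_nonneg (fun w hw => ?_) _)
      · have : 0 ≤ w / c := div_nonneg hw.1.le hc.le
        positivity
      · have : 0 ≤ w / c := div_nonneg (hc.le.trans (le_of_lt hw)) hc.le
        positivity
    rcases lt_or_ge (tail F (x i) * w) 1 with hlt | hge
    swap
    · have : h i w = 0 := by simp only [hh]; rw [indicator_of_notMem]; simpa using hge
      rw [this, norm_zero]; exact hbn
    have hval : h i w = g i (q (tail F (x i) * w) / x i) := by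
      simp only [hh]; rw [indicator_of_mem]; exact hlt
    have hu0 : 0 < tail F (x i) * w := mul_pos hp hw
    have hq0 : 0 < q (tail F (x i) * w) / x i :=
      div_pos (hF.tailQuantile_one_div_pos hF0 hu0 hlt) hxi0
    have hqle : ∀ m, 0 < m → tail F (x i * m) ≤ w * tail F (x i) →
        q (tail F (x i) * w) / x i ≤ m := by
      intro m hm hle
      rw [div_le_iff₀ hxi0, mul_comm m]
      refine (hF.tailQuantile_one_div_le_iff hu0 (by positivity)).2 ?_
      linarith
    rw [hval]
    have hcw : 0 < w / c := div_pos hw hc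
    rcases le_or_gt w c with hwc | hwc
    · have e : bound w = |K| * (w / c) ^ (-1 / (γ - δ)) := by
        simp only [hbound]
        rw [indicator_of_mem (show w ∈ Ioc 0 c from ⟨hw, hwc⟩),
          indicator_of_notMem (show w ∉ Ioi c from not_lt.2 hwc), add_zero]
      rw [e]
      refine (hi2 _ hq0).trans (mul_le_mul (le_abs_self K) ?_ hq0.le (abs_nonneg K))
      refine hqle _ (by positivity) (((hpot _ hxi).2 _ ?_).trans (le_of_eq ?_))
      · refine Real.one_le_rpow_of_pos_of_le_one_of_nonpos hcw ((div_le_one hc).2 hwc) ?_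
        exact div_nonpos_of_nonpos_of_nonneg (by norm_num) (by linarith)
      · rw [← Real.rpow_mul hcw.le]
        have h0 : γ - δ ≠ 0 := by linarith
        have : -1 / (γ - δ) * -(γ - δ) = 1 := by field_simp
        rw [this, Real.rpow_one]
        field_simp
    · have e : bound w = |K| * (w / c) ^ (-γ' / (γ + δ)) := by
        simp only [hbound]
        rw [indicator_of_notMem (show w ∉ Ioc 0 c from fun h => not_lt.2 h.2 hwc),
          indicator_of_mem (show w ∈ Ioi c from hwc), zero_add]
      have e2 : (w / c) ^ (-γ' / (γ + δ)) = ((w / c) ^ (-1 / (γ + δ))) ^ γ' := by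
        rw [← Real.rpow_mul hcw.le]; congr 1; ring
      rw [e, e2]
      refine (hi1 _ hq0).trans (mul_le_mul (le_abs_self K) ?_ (by positivity) (abs_nonneg K))
      refine Real.rpow_le_rpow hq0.le ?_ (by linarith)
      refine hqle _ (by positivity) (((hpot _ hxi).1 _ (by positivity) ?_).trans (le_of_eq ?_))
      · refine Real.rpow_le_one_of_one_le_of_nonpos ((one_le_div hc).2 hwc.le) ?_
        exact div_nonpos_of_nonpos_of_nonneg (by norm_num) (by linarith)
      · rw [← Real.rpow_mul hcw.le]
        have h0 : γ + δ ≠ 0 := by linarith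
        have : -1 / (γ + δ) * -(γ + δ) = 1 := by field_simp
        rw [this, Real.rpow_one]
        field_simp
  · have hdiv : ∀ p w : ℝ, 0 < w → |K| * (w / c) ^ p = |K| * c ^ (-p) * w ^ p := by
      intro p w hw
      rw [Real.div_rpow hw.le hc.le, Real.rpow_neg hc.le]
      field_simp
    have hI1 : IntegrableOn (fun w => |K| * (w / c) ^ (-1 / (γ - δ))) (Ioc 0 c) := by
      have hp : -1 < -1 / (γ - δ) := by
        rw [neg_div, neg_lt_neg_iff, div_lt_one (by linarith)]; exact hδ2
      have := ((intervalIntegral.intervalIntegrable_rpow' (a := 0) (b := c) hp).const_mul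
        (|K| * c ^ (-(-1 / (γ - δ)))))
      rw [intervalIntegrable_iff_integrableOn_Ioc_of_le hc.le] at this
      exact this.congr_fun (fun w hw => (hdiv _ _ hw.1).symm) measurableSet_Ioc
    have hI2 : IntegrableOn (fun w => |K| * (w / c) ^ (-γ' / (γ + δ))) (Ioi c) := by
      have hp : -γ' / (γ + δ) < -1 := by
        rw [neg_div, neg_lt_neg_iff, one_lt_div (by linarith)]; exact hδ1
      have := (integrableOn_Ioi_rpow_of_lt hp hc).const_mul (|K| * c ^ (-(-γ' / (γ + δ))))
      exact IntegrableOn.congr_fun this (fun w hw => (hdiv _ _ (hc.trans hw)).symm) measurableSet_Ioi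
    exact (((integrable_indicator_iff measurableSet_Ioc).2 hI1).add
      ((integrable_indicator_iff measurableSet_Ioi).2 hI2)).integrableOn
  · refine (ae_restrict_iff' measurableSet_Ioi).2 (ae_of_all _ fun w (hw : 0 < w) => ?_)
    have h1 := hlim (fun i => q (tail F (x i) * w) / x i) _ (Real.rpow_pos_of_pos hw _)
      (hF.tendsto_quantile_div hγ0 hx hw)
    refine h1.congr' ?_
    have h2 : Tendsto (fun i => tail F (x i) * w) l (𝓝 0) := by
      simpa using ((tendsto_tail_atTop F).comp hx).mul_const w
    filter_upwards [h2.eventually_lt_const one_pos] with i hi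
    simp only [hh]
    rw [indicator_of_mem]
    exact hi

end HasRegularlyVaryingTail

end Tail

/-! ### The rescaled volume distribution -/

section ScaledLaw

variable {F : Measure ℝ} {γ : ℝ}

instance [IsProbabilityMeasure F] (ρ : ℝ) : IsProbabilityMeasure (scaledLaw F ρ) :=
  Measure.isProbabilityMeasure_map (by fun_prop)

lemma scaledLaw_Iic_zero (hF0 : F (Iic 0) = 0) {ρ : ℝ} (hρ : 0 < ρ) :
    scaledLaw F ρ (Iic 0) = 0 := by
  rw [scaledLaw, Measure.map_apply (by fun_prop) measurableSet_Iic]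
  have : (fun v => ρ * v) ⁻¹' Iic 0 = Iic 0 := by
    ext v
    simp only [mem_preimage, mem_Iic]
    exact mul_nonpos_iff_pos_imp_nonpos.trans ⟨fun h => h.1 hρ, fun h => ⟨fun _ => h, fun hv => by linarith⟩⟩
  rw [this, hF0]

lemma tail_scaledLaw {ρ : ℝ} (hρ : 0 < ρ) (v : ℝ) : tail (scaledLaw F ρ) v = tail F (v / ρ) := by
  rw [tail, tail, measureReal_def, measureReal_def, scaledLaw,
    Measure.map_apply (by fun_prop) measurableSet_Ioi]
  congr 2
  ext w
  simp [div_lt_iff₀' hρ]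

lemma tailQuantile_scaledLaw {ρ : ℝ} (hρ : 0 < ρ) (u : ℝ) :
    tailQuantile (scaledLaw F ρ) u = ρ * tailQuantile F u := by
  rw [tailQuantile, tailQuantile, ← smul_eq_mul, ← Real.sInf_smul_of_nonneg hρ.le]
  congr 1
  ext v
  rw [mem_smul_set_iff_inv_smul_mem₀ hρ.ne']
  simp only [mem_ofPred_eq, tail_scaledLaw hρ, smul_eq_mul, inv_mul_eq_div, le_div_iff₀ hρ, zero_mul]

variable [IsProbabilityMeasure F]

namespace HasRegularlyVaryingTail

lemma tendsto_tailQuantile_atTop (hF : HasRegularlyVaryingTail F γ) :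
    Tendsto (tailQuantile F) atTop atTop := by
  refine tendsto_atTop.2 fun M => ?_
  set m := max M 0
  have hp := hF.tail_pos m
  filter_upwards [eventually_gt_atTop (1 / tail F m)] with u hu
  have hu0 : 0 < u := lt_trans (by positivity) hu
  by_contra! h
  have h1 := (hF.tailQuantile_one_div_le_iff (one_div_pos.2 hu0) (le_max_right M 0)).1
    (by rw [one_div_one_div]; exact h.le.trans (le_max_left _ _))
  rw [le_one_div hp hu0] at h1
  linarith

/-- The tail may jump, so the product need not be 1. It is at most 1 by right continuity. For θ < 1
the tail at θ times the quantile q exceeds 1/u, and F̄(θq)/F̄(q) → θ^{-γ} is as close to 1 as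
desired. -/
lemma tendsto_mul_tail_tailQuantile (hF : HasRegularlyVaryingTail F γ) :
    Tendsto (fun u => u * tail F (tailQuantile F u)) atTop (𝓝 1) := by
  have hx := hF.tendsto_tailQuantile_atTop
  refine tendsto_order.2 ⟨fun y hy => ?_, fun y hy => ?_⟩
  · obtain ⟨θ, hθ0, hθ1, hθ⟩ : ∃ θ : ℝ, 0 < θ ∧ θ < 1 ∧ θ ^ (-γ) < (max y (1 / 2))⁻¹ := by
      have hc : Tendsto (fun θ : ℝ => θ ^ (-γ)) (𝓝[<] 1) (𝓝 1) := by
        have : ContinuousAt (fun θ : ℝ => θ ^ (-γ)) 1 := Real.continuousAt_rpow_const _ _ (by simp)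
        simpa using (this.tendsto).mono_left nhdsWithin_le_nhds
      have hlt : 1 < (max y (1 / 2))⁻¹ := by
        rw [one_lt_inv₀ (lt_of_lt_of_le (by norm_num) (le_max_right _ _))]
        exact max_lt hy (by norm_num)
      obtain ⟨θ, h1, h2, h3⟩ := ((hc.eventually_lt_const hlt).and
        ((eventually_mem_nhdsWithin (a := (1 : ℝ)) (s := Iio 1)).and
        (nhdsWithin_le_nhds (lt_mem_nhds (zero_lt_one' ℝ))))).exists
      exact ⟨θ, h3, h2, h1⟩
    filter_upwards [((hF θ hθ0).comp hx).eventually_lt_const hθ, eventually_gt_atTop 0,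
      hx.eventually_gt_atTop 0] with u hu hu0 hx0
    simp only [Function.comp_apply] at hu
    have hp := hF.tail_pos (tailQuantile F u)
    have h1 : 1 / u < tail F (θ * tailQuantile F u) := by
      by_contra! hcon
      have := (hF.tailQuantile_one_div_le_iff (one_div_pos.2 hu0) (by positivity)).2 hcon
      rw [one_div_one_div] at this
      nlinarith
    rw [div_lt_iff₀ hp] at hu
    have hm : 0 < max y (1 / 2) := lt_of_lt_of_le (by norm_num) (le_max_right _ _)
    have h2 : 1 / u < (max y (1 / 2))⁻¹ * tail F (tailQuantile F u) := h1.trans hu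
    rw [inv_mul_eq_div, div_lt_div_iff₀ hu0 hm] at h2
    have := le_max_left y (1 / 2)
    linarith
  · filter_upwards [eventually_gt_atTop 0] with u hu0
    have := (hF.tailQuantile_one_div_le_iff (one_div_pos.2 hu0) (tailQuantile_nonneg F _)).1 le_rfl
    rw [one_div_one_div, le_div_iff₀ hu0] at this
    linarith

/-- In the small-grain regime the normalising quantile tends to zero. -/
lemma tendsto_mul_tailQuantile_zero (hF : HasRegularlyVaryingTail F γ) (hγ : 0 < γ) {ι : Type*}
    {l : Filter ι} {lam ρ : ι → ℝ} (hρ0 : ∀ i, 0 < ρ i) (hlam : Tendsto lam l atTop)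
    (hρ : Tendsto ρ l (𝓝 0)) (h : Tendsto (fun i => lam i * tail F (1 / ρ i)) l (𝓝 0)) :
    Tendsto (fun i => ρ i * tailQuantile F (γ * lam i)) l (𝓝 0) := by
  have hr : Tendsto (fun i => 1 / ρ i) l atTop := by
    simp only [one_div]
    exact tendsto_inv_nhdsGT_zero.comp (tendsto_nhdsWithin_iff.2 ⟨hρ, Eventually.of_forall hρ0⟩)
  refine tendsto_order.2 ⟨fun y hy => Eventually.of_forall fun i =>
    hy.trans_le (mul_nonneg (hρ0 i).le (tailQuantile_nonneg F _)), fun y hy => ?_⟩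
  -- Were the scaled quantile at least y, the tail at the strictly smaller level y/(2ρ) would exceed
  -- 1/(γλ). But γ λ F̄(y/(2ρ)) → 0 by regular variation. Halving y gives the strict inequality.
  have hy2 : 0 < y / 2 := by linarith
  have h1 := (h.mul ((hF _ hy2).comp hr)).const_mul γ
  simp only [zero_mul, mul_zero] at h1
  filter_upwards [h1.eventually_lt_const one_pos, hlam.eventually_gt_atTop 0] with i hi hl
  have hp := hF.tail_pos (1 / ρ i)
  have hgl : 0 < γ * lam i := by positivity
  have hρi := hρ0 i
  by_contra! hcon
  simp only [Function.comp_apply] at hi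
  have h2 : 1 / (γ * lam i) < tail F (y / 2 * (1 / ρ i)) := by
    by_contra! h2
    have := (hF.tailQuantile_one_div_le_iff (one_div_pos.2 hgl) (by positivity)).2 h2
    rw [one_div_one_div, ← div_eq_mul_one_div, le_div_iff₀ hρi] at this
    linarith
  rw [div_lt_iff₀ hgl] at h2
  have e : γ * (lam i * tail F (1 / ρ i) * (tail F (y / 2 * (1 / ρ i)) / tail F (1 / ρ i))) =
      tail F (y / 2 * (1 / ρ i)) * (γ * lam i) := by field_simp
  linarith

end HasRegularlyVaryingTail

end ScaledLaw

/-! ### The characteristic exponent of a totally skewed stable law -/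

/-- The Laplace transform of `t ^ (a - 1)` at a complex argument. -/
lemma integral_rpow_mul_cexp_neg_mul_Ioi {a : ℝ} (ha : 0 < a) {s : ℂ} (hs : 0 < s.re) :
    ∫ t in Ioi (0 : ℝ), ((t ^ (a - 1) : ℝ) : ℂ) * Complex.exp (-(s * t)) =
      (1 / s) ^ (a : ℂ) * Real.Gamma a := by
  -- The integral is the complex moment generating function of t^{a-1} dt, which is analytic on Re z
  -- < 0.
  set μ : Measure ℝ := (volume.restrict (Ioi (0 : ℝ))).withDensity
    fun t => ENNReal.ofReal (t ^ (a - 1)) with hμ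
  have hdm : Measurable fun t : ℝ => (t ^ (a - 1)).toNNReal := by fun_prop
  have hμ' : μ = (volume.restrict (Ioi (0 : ℝ))).withDensity
      fun t => ((t ^ (a - 1)).toNNReal : ℝ≥0∞) := rfl
  have hmgf : ∀ z : ℂ, complexMGF id μ z =
      ∫ t in Ioi (0 : ℝ), ((t ^ (a - 1) : ℝ) : ℂ) * Complex.exp (z * t) := by
    intro z
    rw [complexMGF, hμ', integral_withDensity_eq_integral_smul hdm]
    refine setIntegral_congr_fun measurableSet_Ioi fun t (ht : 0 < t) => ?_
    have : 0 ≤ t ^ (a - 1) := by positivity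
    simp [NNReal.smul_def, Real.coe_toNNReal _ this]
  have hset : Iio (0 : ℝ) ⊆ interior (integrableExpSet id μ) := by
    rw [isOpen_Iio.subset_interior_iff]
    intro r (hr : r < 0)
    simp only [integrableExpSet, mem_ofPred_eq, id]
    rw [hμ', integrable_withDensity_iff_integrable_smul hdm]
    have h := integrableOn_rpow_mul_exp_neg_mul_rpow (p := 1) (s := a - 1) (b := -r)
      (by linarith) one_pos (by linarith)
    refine IntegrableOn.congr_fun h (fun t (ht : 0 < t) => ?_) measurableSet_Ioi
    have : 0 ≤ t ^ (a - 1) := by positivity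
    simp [NNReal.smul_def, Real.coe_toNNReal _ this]
  have hU : ({z : ℂ | z.re < 0}) ⊆ {z : ℂ | z.re ∈ interior (integrableExpSet id μ)} :=
    fun z hz => hset hz
  have han : AnalyticOnNhd ℂ (complexMGF id μ) {z : ℂ | z.re < 0} :=
    analyticOnNhd_complexMGF.mono hU
  have hopen : IsOpen {z : ℂ | z.re < 0} := isOpen_lt Complex.continuous_re continuous_const
  have hslit : ∀ z : ℂ, z.re < 0 → (1 / (-z)) ∈ Complex.slitPlane := by
    intro z hz
    left
    rw [one_div, Complex.inv_re]
    have : 0 < Complex.normSq (-z) := Complex.normSq_pos.2 (by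
      intro h; rw [neg_eq_zero] at h; simp [h] at hz)
    simp only [Complex.neg_re]
    exact div_pos (by linarith) this
  have han2 : AnalyticOnNhd ℂ (fun z : ℂ => (1 / (-z)) ^ (a : ℂ) * Real.Gamma a)
      {z : ℂ | z.re < 0} := by
    refine DifferentiableOn.analyticOnNhd (fun z hz => ?_) hopen
    have hz0 : -z ≠ 0 := by
      intro h; rw [neg_eq_zero] at h; simp [h] at hz
    refine DifferentiableAt.differentiableWithinAt ?_
    refine DifferentiableAt.mul_const ?_ _
    refine DifferentiableAt.cpow_const ?_ (hslit z hz)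
    exact (differentiableAt_const _).div differentiableAt_id.neg hz0
  -- Identity theorem: both sides are analytic on the half plane and agree for real arguments, which
  -- accumulate at -1.
  have heq : EqOn (complexMGF id μ) (fun z : ℂ => (1 / (-z)) ^ (a : ℂ) * Real.Gamma a)
      {z : ℂ | z.re < 0} := by
    refine han.eqOn_of_preconnected_of_frequently_eq han2
      (convex_halfSpace_re_lt 0).isPreconnected (z₀ := ((-1 : ℝ) : ℂ)) (by simp) ?_
    have hseq : Tendsto (fun r : ℝ => (r : ℂ)) (𝓝[≠] (-1)) (𝓝[≠] ((-1 : ℝ) : ℂ)) := by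
      refine tendsto_nhdsWithin_iff.2 ⟨(Complex.continuous_ofReal.tendsto _).mono_left
        nhdsWithin_le_nhds, ?_⟩
      filter_upwards [self_mem_nhdsWithin] with r hr
      simpa using fun h => hr (by exact_mod_cast h)
    refine hseq.frequently (Eventually.frequently ?_)
    filter_upwards [nhdsWithin_le_nhds (gt_mem_nhds (show (-1 : ℝ) < 0 by norm_num))] with r hr
    rw [hmgf]
    have h := Complex.integral_cpow_mul_exp_neg_mul_Ioi (a := a) (r := -r) (by simpa using ha)
      (by linarith)
    rw [Complex.Gamma_ofReal] at h
    push_cast at h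
    rw [← h]
    refine setIntegral_congr_fun measurableSet_Ioi fun t (ht : 0 < t) => ?_
    simp only [neg_mul, neg_neg]
    rw [Complex.ofReal_cpow ht.le]
    push_cast
    rfl
  have := heq (show (-s).re < 0 by simpa using hs)
  rw [hmgf] at this
  simpa using this

lemma norm_cexp_neg_mul_sub_one_le {s : ℂ} (hs : 0 ≤ s.re) {w : ℝ} (hw : 0 ≤ w) :
    ‖Complex.exp (-(s * w)) - 1‖ ≤ min 2 (‖s‖ * w) := by
  have hre : (-(s * w)).re ≤ 0 := by simpa using mul_nonneg hs hw
  refine le_min ?_ ?_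
  · refine (norm_sub_le _ _).trans ?_
    rw [Complex.norm_exp, norm_one]
    have := Real.exp_le_one_iff.2 hre
    linarith
  · refine (norm_exp_sub_one_le_of_re_nonpos hre).trans (le_of_eq ?_)
    rw [norm_neg, norm_mul, Complex.norm_real, Real.norm_of_nonneg hw]

/-- Both power bounds hold everywhere, but p is used on (0,1] and q on (1,∞). -/
lemma integrableOn_Ioi_of_rpow_bounds {E : Type*} [NormedAddCommGroup E] {f : ℝ → E}
    (hf : AEStronglyMeasurable f (volume.restrict (Ioi (0 : ℝ)))) {A B p q : ℝ}
    (hp : -1 < p) (hq : q < -1) (h1 : ∀ w, 0 < w → ‖f w‖ ≤ A * w ^ p)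
    (h2 : ∀ w, 0 < w → ‖f w‖ ≤ B * w ^ q) : IntegrableOn f (Ioi 0) := by
  rw [← Ioc_union_Ioi_eq_Ioi (zero_le_one' ℝ)] at hf ⊢
  refine IntegrableOn.union ?_ ?_
  · have := (intervalIntegral.intervalIntegrable_rpow' (a := 0) (b := 1) hp).const_mul A
    rw [intervalIntegrable_iff_integrableOn_Ioc_of_le zero_le_one] at this
    refine Integrable.mono' this (hf.mono_measure (Measure.restrict_mono subset_union_left le_rfl))
      ((ae_restrict_iff' measurableSet_Ioc).2 (ae_of_all _ fun w hw => h1 w hw.1))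
  · refine Integrable.mono' ((integrableOn_Ioi_rpow_of_lt hq one_pos).const_mul B)
      (hf.mono_measure (Measure.restrict_mono subset_union_right le_rfl))
      ((ae_restrict_iff' measurableSet_Ioi).2 (ae_of_all _ fun w hw => h2 w (one_pos.trans hw)))

lemma integrableOn_rpow_mul_cexp_sub_one {γ : ℝ} (hγ1 : 1 < γ) (hγ2 : γ < 2) {s : ℂ}
    (hs : 0 ≤ s.re) : IntegrableOn (fun w : ℝ =>
      (Complex.exp (-(s * w)) - 1) * ((w ^ (-γ) : ℝ) : ℂ)) (Ioi 0) := by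
  refine integrableOn_Ioi_of_rpow_bounds (A := ‖s‖) (B := 2) (p := 1 - γ) (q := -γ)
    ?_ (by linarith) (by linarith) (fun w hw => ?_) (fun w hw => ?_)
  · exact Measurable.aestronglyMeasurable (by fun_prop)
  all_goals
    have hb := norm_cexp_neg_mul_sub_one_le hs hw.le
    have hp : 0 ≤ w ^ (-γ) := by positivity
    rw [norm_mul, Complex.norm_real, Real.norm_of_nonneg hp]
  · have : ‖s‖ * w ^ (1 - γ) = ‖s‖ * w * w ^ (-γ) := by
      rw [sub_eq_add_neg, Real.rpow_add hw, Real.rpow_one]; ring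
    rw [this]
    gcongr
    exact hb.trans (min_le_right _ _)
  · gcongr
    exact hb.trans (min_le_left _ _)

lemma tendsto_zero_of_norm_le_rpow {f : ℝ → ℂ} {A p : ℝ} (hp : 0 < p)
    (h : ∀ w, 0 < w → ‖f w‖ ≤ A * w ^ p) : Tendsto f (𝓝[>] 0) (𝓝 0) := by
  have h1 : Tendsto (fun w : ℝ => A * w ^ p) (𝓝[>] 0) (𝓝 0) := by
    have : ContinuousAt (fun w : ℝ => A * w ^ p) 0 :=
      continuousAt_const.mul (Real.continuousAt_rpow_const _ _ (Or.inr hp.le))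
    have h2 := this.tendsto.mono_left (nhdsWithin_le_nhds (s := Ioi 0))
    simpa [Real.zero_rpow hp.ne'] using h2
  refine squeeze_zero_norm' ?_ h1
  filter_upwards [self_mem_nhdsWithin] with w hw using h w hw

lemma tendsto_atTop_zero_of_norm_le_rpow {f : ℝ → ℂ} {A p : ℝ} (hp : p < 0)
    (h : ∀ w, 0 < w → ‖f w‖ ≤ A * w ^ p) : Tendsto f atTop (𝓝 0) := by
  have h1 : Tendsto (fun w : ℝ => A * w ^ p) atTop (𝓝 0) := by
    have := (tendsto_rpow_neg_atTop (y := -p) (by linarith)).const_mul A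
    simpa using this
  refine squeeze_zero_norm' ?_ h1
  filter_upwards [eventually_gt_atTop 0] with w hw using h w hw

lemma hasDerivAt_ofReal_rpow_div {w p : ℝ} (hw : 0 < w) (hp : p ≠ 0) :
    HasDerivAt (fun w : ℝ => ((w ^ p / p : ℝ) : ℂ)) ((w ^ (p - 1) : ℝ) : ℂ) w := by
  have := ((Real.hasDerivAt_rpow_const (p := p) (Or.inl hw.ne')).div_const p).ofReal_comp
  refine this.congr_deriv ?_
  rw [mul_div_cancel_left₀ _ hp]

/-- The Laplace transform of `t ^ (-γ)`, compensated to first order. -/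
lemma integral_rpow_mul_cexp_sub_one {γ : ℝ} (hγ1 : 1 < γ) (hγ2 : γ < 2) {s : ℂ} (hs : 0 < s.re) :
    ∫ w in Ioi (0 : ℝ), (Complex.exp (-(s * w)) - 1) * ((w ^ (-γ) : ℝ) : ℂ) =
      -(s / (γ - 1)) * ((1 / s) ^ ((2 - γ : ℝ) : ℂ) * Real.Gamma (2 - γ)) := by
  rw [← integral_rpow_mul_cexp_neg_mul_Ioi (by linarith) hs, ← integral_const_mul]
  have hγ : (1 - γ) ≠ 0 := by linarith
  have hdu : ∀ w : ℝ, HasDerivAt (fun w : ℝ => Complex.exp (-(s * w)) - 1)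
      (-s * Complex.exp (-(s * w))) w := by
    intro w
    have h1 : HasDerivAt (fun w : ℝ => -(s * (w : ℂ))) (-s) w := by
      simpa using ((Complex.ofRealCLM.hasDerivAt (x := w)).const_mul s).fun_neg
    refine (h1.cexp.sub_const 1).congr_deriv ?_
    ring
  have hL : IntegrableOn (fun t : ℝ => ((t ^ (2 - γ - 1) : ℝ) : ℂ) * Complex.exp (-(s * t)))
      (Ioi 0) := by
    have h := integrableOn_rpow_mul_exp_neg_mul_rpow (p := 1) (s := 2 - γ - 1) (b := s.re)
      (by linarith) one_pos hs
    refine Integrable.mono' h (Measurable.aestronglyMeasurable (by fun_prop))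
      ((ae_restrict_iff' measurableSet_Ioi).2 (ae_of_all _ fun w (hw : 0 < w) => ?_))
    have hp : 0 ≤ w ^ (2 - γ - 1) := by positivity
    rw [norm_mul, Complex.norm_real, Real.norm_of_nonneg hp, Complex.norm_exp]
    simp
  have hform : ∀ w : ℝ, (-s * Complex.exp (-(s * w))) * ((w ^ (1 - γ) / (1 - γ) : ℝ) : ℂ) =
      (s / (γ - 1)) * (((w ^ (2 - γ - 1) : ℝ) : ℂ) * Complex.exp (-(s * w))) := by
    intro w
    have e : 2 - γ - 1 = 1 - γ := by ring
    have h1 : ((1 : ℂ) - γ) ≠ 0 := by exact_mod_cast hγ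
    have h2 : ((γ : ℂ) - 1) ≠ 0 := by rw [← neg_sub]; exact neg_ne_zero.2 h1
    rw [e]
    push_cast
    field_simp
    ring
  have hnorm : ∀ w : ℝ, 0 < w → ‖(Complex.exp (-(s * w)) - 1) * ((w ^ (1 - γ) / (1 - γ) : ℝ) : ℂ)‖ =
      ‖Complex.exp (-(s * w)) - 1‖ * (w ^ (1 - γ) / (γ - 1)) := by
    intro w hw
    have hp : 0 ≤ w ^ (1 - γ) := by positivity
    rw [norm_mul, Complex.norm_real, Real.norm_eq_abs, abs_div, abs_of_nonneg hp,
      abs_of_neg (by linarith : 1 - γ < 0), neg_sub]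
  have hg : 0 < γ - 1 := by linarith
  -- Integration by parts reduces the compensated transform to the uncompensated one of t^{1-γ}. The
  -- boundary terms are O(w^{2-γ}) at 0 and O(w^{1-γ}) at infinity, and vanish because 1 < γ < 2.
  have hparts := integral_Ioi_mul_deriv_eq_deriv_mul (a := 0) (a' := 0) (b' := 0)
    (u := fun w : ℝ => Complex.exp (-(s * w)) - 1) (u' := fun w => -s * Complex.exp (-(s * w)))
    (v := fun w : ℝ => ((w ^ (1 - γ) / (1 - γ) : ℝ) : ℂ)) (v' := fun w => ((w ^ (1 - γ - 1) : ℝ) : ℂ))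
    (fun w _ => hdu w) (fun w hw => hasDerivAt_ofReal_rpow_div hw hγ)
    (by
      have := integrableOn_rpow_mul_cexp_sub_one hγ1 hγ2 hs.le
      refine this.congr_fun (fun w _ => ?_) measurableSet_Ioi
      have e : 1 - γ - 1 = -γ := by ring
      simp [e])
    (by
      refine IntegrableOn.congr_fun (hL.const_mul (s / (γ - 1))) (fun w _ => ?_) measurableSet_Ioi
      exact (hform w).symm)
    (by
      refine tendsto_zero_of_norm_le_rpow (A := ‖s‖ / (γ - 1)) (p := 2 - γ) (by linarith)
        fun w hw => ?_
      simp only [Pi.mul_apply]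
      rw [hnorm w hw]
      have e : ‖s‖ / (γ - 1) * w ^ (2 - γ) = ‖s‖ * w * (w ^ (1 - γ) / (γ - 1)) := by
        rw [show (2 - γ) = 1 + (1 - γ) by ring, Real.rpow_add hw, Real.rpow_one]; ring
      rw [e]
      gcongr
      exact (norm_cexp_neg_mul_sub_one_le hs.le hw.le).trans (min_le_right _ _))
    (by
      refine tendsto_atTop_zero_of_norm_le_rpow (A := 2 / (γ - 1)) (p := 1 - γ) (by linarith)
        fun w hw => ?_
      simp only [Pi.mul_apply]
      rw [hnorm w hw]
      have e : 2 / (γ - 1) * w ^ (1 - γ) = 2 * (w ^ (1 - γ) / (γ - 1)) := by ring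
      rw [e]
      gcongr
      exact (norm_cexp_neg_mul_sub_one_le hs.le hw.le).trans (min_le_left _ _))
  have e1 : ∀ w : ℝ, ((w ^ (1 - γ - 1) : ℝ) : ℂ) = ((w ^ (-γ) : ℝ) : ℂ) := by
    intro w; congr 2; ring
  simp only [e1, hform, sub_self, zero_sub] at hparts
  rw [hparts, ← integral_neg]
  simp only [neg_mul]

/-- Boundary value at s = -i of the preceding formula, taken along s_n = 1/(n+1) - i. The functions
min(2, 2w) w^{-γ} dominate, and 1/s_n → i stays away from the cut of the power. -/
lemma integral_rpow_mul_cexp_I_sub_one {γ : ℝ} (hγ1 : 1 < γ) (hγ2 : γ < 2) :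
    ∫ w in Ioi (0 : ℝ), (Complex.exp (w * Complex.I) - 1) * ((w ^ (-γ) : ℝ) : ℂ) =
      (Complex.I / (γ - 1)) * (Complex.I ^ ((2 - γ : ℝ) : ℂ) * Real.Gamma (2 - γ)) := by
  set s : ℕ → ℂ := fun n => ((1 / ((n : ℝ) + 1) : ℝ) : ℂ) - Complex.I with hs
  have hsre : ∀ n, 0 < (s n).re := by
    intro n
    simp only [hs, Complex.sub_re, Complex.ofReal_re, Complex.I_re, sub_zero]
    positivity
  have hsn : ∀ n, ‖s n‖ ≤ 2 := by
    intro n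
    refine (norm_sub_le _ _).trans ?_
    rw [Complex.norm_real, Complex.norm_I, Real.norm_of_nonneg (by positivity)]
    have : 1 / ((n : ℝ) + 1) ≤ 1 := by
      rw [div_le_one (by positivity)]
      have : (0 : ℝ) ≤ n := Nat.cast_nonneg n
      linarith
    linarith
  have hslim : Tendsto s atTop (𝓝 (-Complex.I)) := by
    have := ((Complex.continuous_ofReal.tendsto _).comp
      (tendsto_one_div_add_atTop_nhds_zero_nat (𝕜 := ℝ))).sub_const Complex.I
    simpa [hs] using this
  have hl : Tendsto (fun n => ∫ w in Ioi (0 : ℝ), (Complex.exp (-(s n * w)) - 1) *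
      ((w ^ (-γ) : ℝ) : ℂ)) atTop (𝓝 (∫ w in Ioi (0 : ℝ), (Complex.exp (w * Complex.I) - 1) *
      ((w ^ (-γ) : ℝ) : ℂ))) := by
    have hbi : IntegrableOn (fun w : ℝ => min 2 (2 * w) * w ^ (-γ)) (Ioi 0) := by
      refine integrableOn_Ioi_of_rpow_bounds (A := 2) (B := 2) (p := 1 - γ) (q := -γ)
        (Measurable.aestronglyMeasurable (by fun_prop)) (by linarith) (by linarith)
        (fun w hw => ?_) (fun w hw => ?_)
      all_goals
        have hp : 0 ≤ w ^ (-γ) := by positivity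
        rw [Real.norm_of_nonneg (mul_nonneg (le_min (by norm_num) (by positivity)) hp)]
      · have : 2 * w ^ (1 - γ) = 2 * w * w ^ (-γ) := by
          rw [sub_eq_add_neg, Real.rpow_add hw, Real.rpow_one]; ring
        rw [this]
        gcongr
        exact min_le_right _ _
      · gcongr
        exact min_le_left _ _
    refine tendsto_integral_of_dominated_convergence _
      (fun n => (integrableOn_rpow_mul_cexp_sub_one hγ1 hγ2 (hsre n).le).1) hbi
      (fun n => (ae_restrict_iff' measurableSet_Ioi).2 (ae_of_all _ fun w (hw : 0 < w) => ?_))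
      (ae_of_all _ fun w => ?_)
    · have hp : 0 ≤ w ^ (-γ) := by positivity
      rw [norm_mul, Complex.norm_real, Real.norm_of_nonneg hp]
      gcongr
      refine (norm_cexp_neg_mul_sub_one_le (hsre n).le hw.le).trans (min_le_min le_rfl ?_)
      gcongr
      exact hsn n
    · refine Tendsto.mul_const _ (Tendsto.sub_const ?_ 1)
      have : (w : ℂ) * Complex.I = -(-Complex.I * w) := by ring
      rw [this]
      exact (Complex.continuous_exp.tendsto _).comp ((hslim.mul_const _).neg)
  refine tendsto_nhds_unique hl ?_
  simp_rw [fun n => integral_rpow_mul_cexp_sub_one hγ1 hγ2 (hsre n)]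
  have hI : (1 : ℂ) / -Complex.I = Complex.I := by simp
  refine Tendsto.mul ?_ (Tendsto.mul_const _ ?_)
  · have := (hslim.div_const ((γ : ℂ) - 1)).neg
    simpa [neg_div] using this
  · have h1 : Tendsto (fun n => 1 / s n) atTop (𝓝 Complex.I) := by
      have := (tendsto_const_nhds (x := (1 : ℂ))).div hslim (by simp)
      rwa [hI] at this
    exact (continuousAt_cpow_const (by right; simp)).tendsto.comp h1

/-- The exponent of the totally skewed stable law. -/
lemma integral_rpow_mul_compExp {γ : ℝ} (hγ1 : 1 < γ) (hγ2 : γ < 2) :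
    ∫ w in Ioi (0 : ℝ), compExp w * ((w ^ (-γ - 1) : ℝ) : ℂ) =
      ((Real.Gamma (2 - γ) / (γ * (γ - 1)) : ℝ) : ℂ) *
        Complex.exp (-((Real.pi * γ / 2 : ℝ) : ℂ) * Complex.I) := by
  have hγ0 : γ ≠ 0 := by linarith
  have hγn : -γ ≠ 0 := by linarith
  have hd : ∀ w : ℝ, HasDerivAt compExp ((Complex.exp (w * Complex.I) - 1) * Complex.I) w := by
    intro t
    have h1 : HasDerivAt (fun t : ℝ => (t : ℂ) * Complex.I) Complex.I t := by
      simpa using (Complex.ofRealCLM.hasDerivAt (x := t)).mul_const Complex.I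
    have := (h1.cexp.sub_const 1).sub h1
    refine this.congr_deriv ?_
    ring
  have hI2 : IntegrableOn (fun w : ℝ => (Complex.exp (w * Complex.I) - 1) * ((w ^ (-γ) : ℝ) : ℂ))
      (Ioi 0) := by
    have := integrableOn_rpow_mul_cexp_sub_one hγ1 hγ2 (s := -Complex.I) (by simp)
    refine this.congr_fun (fun w _ => ?_) measurableSet_Ioi
    simp only [neg_mul, neg_neg]
    rw [mul_comm Complex.I]
  have hI1 : IntegrableOn (fun w : ℝ => compExp w * ((w ^ (-γ - 1) : ℝ) : ℂ)) (Ioi 0) := by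
    refine integrableOn_Ioi_of_rpow_bounds (A := 1 / 2) (B := 2) (p := 1 - γ) (q := -γ)
      (Measurable.aestronglyMeasurable
        (continuous_compExp.measurable.mul (Complex.measurable_ofReal.comp (by fun_prop))))
      (by linarith) (by linarith) (fun w hw => ?_) (fun w hw => ?_)
    all_goals
      have hp : 0 ≤ w ^ (-γ - 1) := by positivity
      rw [norm_mul, Complex.norm_real, Real.norm_of_nonneg hp]
    · have : 1 / 2 * w ^ (1 - γ) = w ^ 2 / 2 * w ^ (-γ - 1) := by
        rw [show 1 - γ = 2 + (-γ - 1) by ring, Real.rpow_add hw, Real.rpow_two]; ring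
      rw [this]
      gcongr
      exact norm_compExp_le_sq w
    · have : 2 * w ^ (-γ) = 2 * |w| * w ^ (-γ - 1) := by
        rw [abs_of_pos hw, show -γ = 1 + (-γ - 1) by ring, Real.rpow_add hw, Real.rpow_one]; ring_nf
      rw [this]
      gcongr
      exact norm_compExp_le_abs w
  have hform : ∀ w : ℝ, (Complex.exp (w * Complex.I) - 1) * Complex.I *
      ((w ^ (-γ) / (-γ) : ℝ) : ℂ) =
      -(Complex.I / γ) * ((Complex.exp (w * Complex.I) - 1) * ((w ^ (-γ) : ℝ) : ℂ)) := by
    intro w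
    have : (γ : ℂ) ≠ 0 := by exact_mod_cast hγ0
    push_cast
    field_simp
  have hnorm : ∀ w : ℝ, 0 < w → ‖compExp w * ((w ^ (-γ) / (-γ) : ℝ) : ℂ)‖ =
      ‖compExp w‖ * (w ^ (-γ) / γ) := by
    intro w hw
    have hp : 0 ≤ w ^ (-γ) := by positivity
    rw [norm_mul, Complex.norm_real, Real.norm_eq_abs, abs_div, abs_of_nonneg hp,
      abs_of_neg (by linarith : -γ < 0), neg_neg]
  -- A further integration by parts, lowering w^{-γ-1} to w^{-γ}. The boundary terms vanish by the
  -- quadratic bound on Ψ at 0 and the linear one at infinity.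
  have hparts := integral_Ioi_mul_deriv_eq_deriv_mul (a := 0) (a' := 0) (b' := 0)
    (u := compExp) (u' := fun w => (Complex.exp (w * Complex.I) - 1) * Complex.I)
    (v := fun w : ℝ => ((w ^ (-γ) / (-γ) : ℝ) : ℂ)) (v' := fun w => ((w ^ (-γ - 1) : ℝ) : ℂ))
    (fun w _ => hd w) (fun w hw => hasDerivAt_ofReal_rpow_div hw hγn) hI1
    (by
      refine IntegrableOn.congr_fun (hI2.const_mul (-(Complex.I / γ))) (fun w _ => ?_)
        measurableSet_Ioi
      exact (hform w).symm)
    (by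
      refine tendsto_zero_of_norm_le_rpow (A := 1 / (2 * γ)) (p := 2 - γ) (by linarith)
        fun w hw => ?_
      simp only [Pi.mul_apply]
      rw [hnorm w hw]
      have e : 1 / (2 * γ) * w ^ (2 - γ) = w ^ 2 / 2 * (w ^ (-γ) / γ) := by
        rw [show (2 - γ) = 2 + -γ by ring, Real.rpow_add hw, Real.rpow_two]; field_simp
      rw [e]
      gcongr
      exact norm_compExp_le_sq w)
    (by
      refine tendsto_atTop_zero_of_norm_le_rpow (A := 2 / γ) (p := 1 - γ) (by linarith)
        fun w hw => ?_
      simp only [Pi.mul_apply]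
      rw [hnorm w hw]
      have e : 2 / γ * w ^ (1 - γ) = 2 * |w| * (w ^ (-γ) / γ) := by
        rw [abs_of_pos hw, sub_eq_add_neg, Real.rpow_add hw, Real.rpow_one]; ring
      rw [e]
      gcongr
      exact norm_compExp_le_abs w)
  rw [hparts]
  simp only [hform]
  rw [integral_const_mul, integral_rpow_mul_cexp_I_sub_one hγ1 hγ2]
  have hIpow : Complex.I ^ ((2 - γ : ℝ) : ℂ) =
      -Complex.exp (-((Real.pi * γ / 2 : ℝ) : ℂ) * Complex.I) := by
    rw [Complex.cpow_def_of_ne_zero Complex.I_ne_zero, Complex.log_I]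
    have : (Real.pi : ℂ) / 2 * Complex.I * ((2 - γ : ℝ) : ℂ) =
        -((Real.pi * γ / 2 : ℝ) : ℂ) * Complex.I + Real.pi * Complex.I := by push_cast; ring
    rw [this, Complex.exp_add, Complex.exp_pi_mul_I]
    ring
  rw [hIpow]
  have h1 : (γ : ℂ) ≠ 0 := by exact_mod_cast hγ0
  have h2 : (γ : ℂ) - 1 ≠ 0 := by
    have : γ - 1 ≠ 0 := by linarith
    exact_mod_cast this
  push_cast
  field_simp
  rw [Complex.I_sq]
  ring

/-- For 1 < γ < 2 the angle πγ/2 lies strictly between π/2 and π. -/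
lemma stableConst_pos_aux {γ : ℝ} (hγ1 : 1 < γ) (hγ2 : γ < 2) :
    Real.cos (Real.pi * γ / 2) < 0 ∧
      0 < -(Real.Gamma (2 - γ) / (γ * (γ - 1)) * Real.cos (Real.pi * γ / 2)) := by
  have hc : Real.cos (Real.pi * γ / 2) < 0 := by
    refine Real.cos_neg_of_pi_div_two_lt_of_lt ?_ ?_ <;> nlinarith [Real.pi_pos]
  refine ⟨hc, ?_⟩
  have hG : 0 < Real.Gamma (2 - γ) := Real.Gamma_pos_of_pos (by linarith)
  have h2 : 0 < γ * (γ - 1) := mul_pos (by linarith) (by linarith)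
  have := div_pos hG h2
  nlinarith

lemma stableConst_pos {γ : ℝ} (hγ1 : 1 < γ) (hγ2 : γ < 2) : 0 < stableConst γ :=
  Real.rpow_pos_of_pos (stableConst_pos_aux hγ1 hγ2).2 _

lemma stableConst_rpow {γ : ℝ} (hγ1 : 1 < γ) (hγ2 : γ < 2) : stableConst γ ^ γ =
    -(Real.Gamma (2 - γ) / (γ * (γ - 1)) * Real.cos (Real.pi * γ / 2)) := by
  rw [stableConst, ← Real.rpow_mul (stableConst_pos_aux hγ1 hγ2).2.le,
    one_div_mul_cancel (by linarith), Real.rpow_one]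

lemma compExp_neg (x : ℝ) : compExp (-x) = (starRingEnd ℂ) (compExp x) := by
  simp [compExp, ← Complex.exp_conj]

/-- Scaling w by y/c_γ extracts y^γ / c_γ^γ. The constant c_γ is made to cancel the Gamma factor and
the cosine, since e^{-iθ} = cos θ (1 - i tan θ). Negative y conjugates the exponent, which is where
the skewness arises. -/
lemma integral_rpow_mul_compExp_mul {γ : ℝ} (hγ1 : 1 < γ) (hγ2 : γ < 2) (y : ℝ) :
    ∫ w in Ioi (0 : ℝ), (w ^ (-γ - 1)) • compExp (w * (y / stableConst γ)) =
      -(((|y| ^ γ : ℝ) : ℂ) - Complex.I * (((max y 0 ^ γ - (-min y 0) ^ γ) *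
        Real.tan (Real.pi * γ / 2) : ℝ) : ℂ)) := by
  have hγ0 : γ ≠ 0 := by linarith
  obtain ⟨hcos, hpos⟩ := stableConst_pos_aux hγ1 hγ2
  have hc := stableConst_pos hγ1 hγ2
  have hcc := stableConst_rpow hγ1 hγ2
  set c := stableConst γ
  have hbase : ∀ z : ℝ, 0 < z → ∫ w in Ioi (0 : ℝ), (w ^ (-γ - 1)) • compExp (w * (z / c)) =
      -(((z ^ γ : ℝ) : ℂ) * (1 - Complex.I * (Real.tan (Real.pi * γ / 2) : ℝ))) := by
    intro z hz
    have hzc : 0 < z / c := div_pos hz hc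
    have h1 := integral_comp_mul_left_Ioi
      (fun w : ℝ => compExp w * ((w ^ (-γ - 1) : ℝ) : ℂ)) 0 hzc
    rw [mul_zero, integral_rpow_mul_compExp hγ1 hγ2] at h1
    have h2 : ∫ w in Ioi (0 : ℝ), (w ^ (-γ - 1)) • compExp (w * (z / c)) =
        ((z / c) ^ (γ + 1)) • ∫ w in Ioi (0 : ℝ), compExp (z / c * w) *
          (((z / c * w) ^ (-γ - 1) : ℝ) : ℂ) := by
      rw [← integral_smul]
      refine setIntegral_congr_fun measurableSet_Ioi fun w (hw : 0 < w) => ?_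
      have e : (z / c) ^ (γ + 1) * (z / c * w) ^ (-γ - 1) = w ^ (-γ - 1) := by
        rw [Real.mul_rpow hzc.le hw.le, ← mul_assoc, ← Real.rpow_add hzc]
        simp
      simp only [Complex.real_smul]
      rw [← e, mul_comm w]
      push_cast
      ring
    rw [h2, h1]
    have e2 : (z / c) ^ (γ + 1) * (z / c)⁻¹ = z ^ γ / c ^ γ := by
      rw [Real.rpow_add hzc, Real.rpow_one, mul_assoc, mul_inv_cancel₀ hzc.ne', mul_one,
        Real.div_rpow hz.le hc.le]
    rw [smul_smul, e2, hcc]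
    have e3 : Complex.exp (-((Real.pi * γ / 2 : ℝ) : ℂ) * Complex.I) =
        ((Real.cos (Real.pi * γ / 2) : ℝ) : ℂ) *
          (1 - Complex.I * (Real.tan (Real.pi * γ / 2) : ℝ)) := by
      rw [← Complex.ofReal_neg, Complex.exp_mul_I, ← Complex.ofReal_cos, ← Complex.ofReal_sin,
        Real.cos_neg, Real.sin_neg, Real.tan_eq_sin_div_cos]
      have : ((Real.cos (Real.pi * γ / 2) : ℝ) : ℂ) ≠ 0 := by exact_mod_cast hcos.ne
      push_cast at this ⊢
      field_simp
      ring
    rw [e3, Complex.real_smul]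
    set G := Real.Gamma (2 - γ) / (γ * (γ - 1))
    set C := Real.cos (Real.pi * γ / 2)
    have hGC : G * C ≠ 0 := by linarith
    have hGC' : (G : ℂ) * (C : ℂ) ≠ 0 := by exact_mod_cast hGC
    have hG' : (G : ℂ) ≠ 0 := left_ne_zero_of_mul hGC'
    have hC' : (C : ℂ) ≠ 0 := right_ne_zero_of_mul hGC'
    push_cast
    field_simp
  rcases lt_trichotomy y 0 with hy | rfl | hy
  · have h1 := hbase (-y) (by linarith)
    have h2 : ∫ w in Ioi (0 : ℝ), (w ^ (-γ - 1)) • compExp (w * (y / c)) =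
        (starRingEnd ℂ) (∫ w in Ioi (0 : ℝ), (w ^ (-γ - 1)) • compExp (w * (-y / c))) := by
      rw [← integral_conj]
      refine integral_congr_ae (ae_of_all _ fun w => ?_)
      have : w * (y / c) = -(w * (-y / c)) := by ring
      simp only [this, compExp_neg, Complex.real_smul, map_mul, Complex.conj_ofReal]
    rw [h2, h1, max_eq_right hy.le, min_eq_left hy.le, abs_of_neg hy, Real.zero_rpow hγ0]
    simp only [map_neg, map_mul, map_sub, map_one, Complex.conj_ofReal, Complex.conj_I]
    push_cast
    ring
  · simp [compExp_zero, Real.zero_rpow hγ0]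
  · rw [hbase y hy, max_eq_left hy.le, min_eq_right hy.le, abs_of_pos hy, neg_zero,
      Real.zero_rpow hγ0]
    push_cast
    ring

/-! ### The mass of a grain -/

section GrainMass

variable {d : ℕ} {C : Set (EuclideanSpace ℝ (Fin d))}

/-- The mass that the measure `m` gives to the grain of location `p.1` and volume `p.2`, defined
through the indicator of `C` so as to be measurable in `p`. -/
def grainMass (C : Set (EuclideanSpace ℝ (Fin d))) (m : Measure (EuclideanSpace ℝ (Fin d)))
    (p : EuclideanSpace ℝ (Fin d) × ℝ) : ℝ≥0∞ :=
  m {y | p.2 ^ (-(1 / (d : ℝ))) • (y - p.1) ∈ C}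

lemma measurable_grainScale : Measurable fun q : (EuclideanSpace ℝ (Fin d) × ℝ) ×
    EuclideanSpace ℝ (Fin d) => q.1.2 ^ (-(1 / (d : ℝ))) • (q.2 - q.1.1) := by
  fun_prop

lemma measurableSet_grainSection (hC : MeasurableSet C) (x : EuclideanSpace ℝ (Fin d)) (v : ℝ) :
    MeasurableSet {y | v ^ (-(1 / (d : ℝ))) • (y - x) ∈ C} := by
  have : Measurable fun y : EuclideanSpace ℝ (Fin d) => v ^ (-(1 / (d : ℝ))) • (y - x) := by
    fun_prop
  exact this hC

lemma measurable_grainMass (hC : MeasurableSet C) (m : Measure (EuclideanSpace ℝ (Fin d)))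
    [SFinite m] : Measurable (grainMass C m) :=
  measurable_measure_prodMk_left (measurable_grainScale hC)

lemma grain_eq (C : Set (EuclideanSpace ℝ (Fin d))) (x : EuclideanSpace ℝ (Fin d))
    {v : ℝ} (hv : 0 < v) : grain C x v = {y | v ^ (-(1 / (d : ℝ))) • (y - x) ∈ C} := by
  have hp : (0 : ℝ) < v ^ (1 / (d : ℝ)) := Real.rpow_pos_of_pos hv _
  ext y
  simp only [grain, mem_image, mem_ofPred_eq, Real.rpow_neg hv.le]
  constructor
  · rintro ⟨c, hc, rfl⟩
    rw [add_sub_cancel_left, inv_smul_smul₀ hp.ne']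
    exact hc
  · intro h
    exact ⟨_, h, by rw [smul_inv_smul₀ hp.ne']; abel⟩

/-- Substitute c = r(y - x) with r = v^{-1/d}. Then r(z - x) = c - r(y - z), and the Jacobian
contributes r^{-d} = v. -/
lemma volume_grainCentres_inter (hd : 0 < d) (A B : Set (EuclideanSpace ℝ (Fin d)))
    (hA : MeasurableSet A) (hB : MeasurableSet B)
    (y z : EuclideanSpace ℝ (Fin d)) {v : ℝ} (hv : 0 < v) :
    volume {x | v ^ (-(1 / (d : ℝ))) • (y - x) ∈ A ∧ v ^ (-(1 / (d : ℝ))) • (z - x) ∈ B} =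
      ENNReal.ofReal v *
        volume (((fun c => v ^ (-(1 / (d : ℝ))) • (y - z) + c) '' B) ∩ A) := by
  set r := v ^ (-(1 / (d : ℝ))) with hr
  have hr0 : 0 < r := Real.rpow_pos_of_pos hv _
  have himg : ((fun c => r • (y - z) + c) '' B) = {c | c - r • (y - z) ∈ B} := by
    ext c
    simp only [mem_image, mem_ofPred_eq]
    constructor
    · rintro ⟨b, hb, rfl⟩
      rwa [add_sub_cancel_left]
    · intro h
      exact ⟨_, h, by abel⟩
  have hset : {x | r • (y - x) ∈ A ∧ r • (z - x) ∈ B} =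
      (fun x => y - x) ⁻¹' ((fun x => r • x) ⁻¹' (((fun c => r • (y - z) + c) '' B) ∩ A)) := by
    ext x
    rw [himg]
    simp only [mem_ofPred_eq, mem_preimage, mem_inter_iff]
    have : r • (y - x) - r • (y - z) = r • (z - x) := by rw [← smul_sub]; congr 1; abel
    rw [this, and_comm]
  have hm : MeasurableSet (((fun c => r • (y - z) + c) '' B) ∩ A) := by
    rw [himg]
    have : Measurable fun c : EuclideanSpace ℝ (Fin d) => c - r • (y - z) := by fun_prop
    exact (this hB).inter hA
  rw [hset, (Measure.measurePreserving_sub_left volume y).measure_preimage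
    ((measurable_const_smul r) hm).nullMeasurableSet, Measure.addHaar_preimage_smul _ hr0.ne']
  congr 2
  rw [finrank_euclideanSpace_fin, hr, ← Real.rpow_natCast, ← Real.rpow_mul hv.le]
  have : -(1 / (d : ℝ)) * d = -1 := by
    have : (d : ℝ) ≠ 0 := by positivity
    field_simp
  rw [this, Real.rpow_neg_one, inv_inv, abs_of_pos hv]

lemma volume_grainCentres (hd : 0 < d) (A : Set (EuclideanSpace ℝ (Fin d)))
    (hA : MeasurableSet A) (y : EuclideanSpace ℝ (Fin d)) {v : ℝ} (hv : 0 < v) :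
    volume {x | v ^ (-(1 / (d : ℝ))) • (y - x) ∈ A} = ENNReal.ofReal v * volume A := by
  have := volume_grainCentres_inter hd A A hA hA y y hv
  simpa using this

/-- Fubini for the mean mass of a grain. -/
lemma lintegral_grainMass (hd : 0 < d) (hC : MeasurableSet C)
    (m : Measure (EuclideanSpace ℝ (Fin d))) [SFinite m] {v : ℝ} (hv : 0 < v) :
    ∫⁻ x, grainMass C m (x, v) = ENNReal.ofReal v * volume C * m univ := by
  have hm : MeasurableSet {q : EuclideanSpace ℝ (Fin d) × EuclideanSpace ℝ (Fin d) |
      v ^ (-(1 / (d : ℝ))) • (q.2 - q.1) ∈ C} := by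
    have : Measurable fun q : EuclideanSpace ℝ (Fin d) × EuclideanSpace ℝ (Fin d) =>
      v ^ (-(1 / (d : ℝ))) • (q.2 - q.1) := by fun_prop
    exact this hC
  have h1 := Measure.prod_apply (μ := volume) (ν := m) hm
  have h2 := Measure.prod_apply_symm (μ := volume) (ν := m) hm
  have h3 : ∫⁻ x, grainMass C m (x, v) = ∫⁻ x, m (Prod.mk x ⁻¹'
    {q : EuclideanSpace ℝ (Fin d) × EuclideanSpace ℝ (Fin d) |
      v ^ (-(1 / (d : ℝ))) • (q.2 - q.1) ∈ C}) := rfl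
  rw [h3, ← h1, h2]
  have h4 : ∀ y, volume ((fun x => (x, y)) ⁻¹'
    {q : EuclideanSpace ℝ (Fin d) × EuclideanSpace ℝ (Fin d) |
      v ^ (-(1 / (d : ℝ))) • (q.2 - q.1) ∈ C}) = ENNReal.ofReal v * volume C :=
    fun y => volume_grainCentres hd C hC y hv
  simp_rw [h4]
  rw [lintegral_const]

/-- The volume of the intersection of `C` with its translate by `v ^ (-1 / d) x`. -/
def grainOverlap (C : Set (EuclideanSpace ℝ (Fin d))) (v : ℝ) (x : EuclideanSpace ℝ (Fin d)) :
    ℝ≥0∞ :=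
  volume (((fun c => v ^ (-(1 / (d : ℝ))) • x + c) '' C) ∩ C)

lemma measurable_grainOverlap (hC : MeasurableSet C) :
    Measurable fun q : ℝ × EuclideanSpace ℝ (Fin d) => grainOverlap C q.1 q.2 := by
  have h : ∀ q : ℝ × EuclideanSpace ℝ (Fin d), grainOverlap C q.1 q.2 =
      volume (Prod.mk q ⁻¹' {z : (ℝ × EuclideanSpace ℝ (Fin d)) × EuclideanSpace ℝ (Fin d) |
        z.2 - z.1.1 ^ (-(1 / (d : ℝ))) • z.1.2 ∈ C ∧ z.2 ∈ C}) := by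
    intro q
    rw [grainOverlap]
    congr 1
    ext c
    simp only [mem_inter_iff, mem_image, mem_preimage, mem_ofPred_eq]
    refine and_congr_left fun _ => ⟨?_, fun h => ⟨_, h, by abel⟩⟩
    rintro ⟨b, hb, rfl⟩
    rwa [add_sub_cancel_left]
  simp_rw [h]
  refine measurable_measure_prodMk_left (MeasurableSet.inter ?_ (measurable_snd hC))
  have : Measurable fun z : (ℝ × EuclideanSpace ℝ (Fin d)) × EuclideanSpace ℝ (Fin d) =>
    z.2 - z.1.1 ^ (-(1 / (d : ℝ))) • z.1.2 := by fun_prop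
  exact this hC

lemma measurable_grainOverlap_sub (hC : MeasurableSet C) (v : ℝ) :
    Measurable fun q : EuclideanSpace ℝ (Fin d) × EuclideanSpace ℝ (Fin d) =>
      grainOverlap C v (q.1 - q.2) := by
  have h := measurable_grainOverlap hC
  have hp : Measurable fun q : EuclideanSpace ℝ (Fin d) × EuclideanSpace ℝ (Fin d) =>
    (v, q.1 - q.2) := by fun_prop
  generalize grainOverlap C = k at h ⊢
  exact h.comp hp

/-- The product of the two masses is the `m.prod n` measure of the pairs (y, z) lying in the same
grain. Tonelli integrates over the centre first. -/
lemma lintegral_grainMass_mul (hd : 0 < d) (hC : MeasurableSet C)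
    (m n : Measure (EuclideanSpace ℝ (Fin d))) [SFinite m] [SFinite n] {v : ℝ} (hv : 0 < v) :
    ∫⁻ x, grainMass C m (x, v) * grainMass C n (x, v) =
      ENNReal.ofReal v * ∫⁻ y, ∫⁻ z, grainOverlap C v (y - z) ∂n ∂m := by
  obtain ⟨T, hT⟩ : ∃ T : Set (EuclideanSpace ℝ (Fin d) × (EuclideanSpace ℝ (Fin d) ×
      EuclideanSpace ℝ (Fin d))), T = {q | v ^ (-(1 / (d : ℝ))) • (q.2.1 - q.1) ∈ C ∧
        v ^ (-(1 / (d : ℝ))) • (q.2.2 - q.1) ∈ C} := ⟨_, rfl⟩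
  have hm : MeasurableSet T := by
    have h1 : Measurable fun q : EuclideanSpace ℝ (Fin d) × (EuclideanSpace ℝ (Fin d) ×
      EuclideanSpace ℝ (Fin d)) => v ^ (-(1 / (d : ℝ))) • (q.2.1 - q.1) := by fun_prop
    have h2 : Measurable fun q : EuclideanSpace ℝ (Fin d) × (EuclideanSpace ℝ (Fin d) ×
      EuclideanSpace ℝ (Fin d)) => v ^ (-(1 / (d : ℝ))) • (q.2.2 - q.1) := by fun_prop
    rw [hT]
    exact (h1 hC).inter (h2 hC)
  have h1 := Measure.prod_apply (μ := volume) (ν := m.prod n) hm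
  have h2 := Measure.prod_apply_symm (μ := volume) (ν := m.prod n) hm
  have h3 : ∀ x : EuclideanSpace ℝ (Fin d), grainMass C m (x, v) * grainMass C n (x, v) =
      (m.prod n) (Prod.mk x ⁻¹' T) := by
    intro x
    have : (Prod.mk x ⁻¹' T) = {y : EuclideanSpace ℝ (Fin d) | v ^ (-(1 / (d : ℝ))) • (y - x) ∈ C}
        ×ˢ {y : EuclideanSpace ℝ (Fin d) | v ^ (-(1 / (d : ℝ))) • (y - x) ∈ C} := by
      rw [hT]; rfl
    rw [this, Measure.prod_prod, grainMass, grainMass]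
  have h4 : ∀ q : EuclideanSpace ℝ (Fin d) × EuclideanSpace ℝ (Fin d),
      volume ((fun x => (x, q)) ⁻¹' T) = ENNReal.ofReal v * grainOverlap C v (q.1 - q.2) := by
    intro q
    rw [grainOverlap, ← volume_grainCentres_inter hd C C hC hC q.1 q.2 hv, hT]
    rfl
  have hmo := measurable_grainOverlap_sub hC v
  rw [lintegral_congr h3, ← h1, h2, lintegral_congr h4, lintegral_const_mul _ hmo,
    lintegral_prod _ hmo.aemeasurable]

lemma grainOverlap_le_volume (v : ℝ) (x : EuclideanSpace ℝ (Fin d)) :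
    grainOverlap C v x ≤ volume C := measure_mono inter_subset_right

/-- A set of radius R cannot meet its translate by a vector longer than 2R. -/
lemma grainOverlap_eq_zero {R : ℝ} (hR : C ⊆ Metric.closedBall 0 R) {v : ℝ} (hv : 0 < v)
    {x : EuclideanSpace ℝ (Fin d)} (hx : 2 * R * v ^ (1 / (d : ℝ)) < ‖x‖) :
    grainOverlap C v x = 0 := by
  rw [grainOverlap]
  convert measure_empty (μ := volume)
  rw [← disjoint_iff_inter_eq_empty, Set.disjoint_left]
  rintro _ ⟨c, hc, rfl⟩ hc'
  have h1 := mem_closedBall_zero_iff.1 (hR hc)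
  have h2 := mem_closedBall_zero_iff.1 (hR hc')
  have hp : (0 : ℝ) < v ^ (1 / (d : ℝ)) := Real.rpow_pos_of_pos hv _
  have h3 : ‖v ^ (-(1 / (d : ℝ))) • x‖ ≤ 2 * R := by
    calc ‖v ^ (-(1 / (d : ℝ))) • x‖ = ‖(v ^ (-(1 / (d : ℝ))) • x + c) - c‖ := by rw [add_sub_cancel_right]
      _ ≤ R + R := (norm_sub_le _ _).trans (add_le_add h2 h1)
      _ = 2 * R := by ring
  rw [norm_smul, Real.rpow_neg hv.le, norm_inv, Real.norm_of_nonneg hp.le, inv_mul_le_iff₀ hp] at h3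
  linarith

/-- The overlap is dominated by a Riesz kernel. -/
lemma grainOverlap_le (hd : 0 < d) {R : ℝ} (hR0 : 0 < R) (hR : C ⊆ Metric.closedBall 0 R)
    (hC1 : volume C ≤ 1) {v s : ℝ} (hv : 0 < v) (hs : 0 < s) (x : EuclideanSpace ℝ (Fin d)) :
    grainOverlap C v x ≤
      ENNReal.ofReal ((2 * R) ^ (s * d) * v ^ s) * ‖x‖ₑ ^ (-(s * d)) := by
  have hd' : (0 : ℝ) < d := by exact_mod_cast hd
  have hsd : 0 < s * d := mul_pos hs hd'
  have hp : (0 : ℝ) < v ^ (1 / (d : ℝ)) := Real.rpow_pos_of_pos hv _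
  rcases lt_or_ge (2 * R * v ^ (1 / (d : ℝ))) ‖x‖ with h | h
  · rw [grainOverlap_eq_zero hR hv h]; exact zero_le
  · refine ((grainOverlap_le_volume v x).trans hC1).trans ?_
    have e : (2 * R) ^ (s * d) * v ^ s = (2 * R * v ^ (1 / (d : ℝ))) ^ (s * d) := by
      rw [Real.mul_rpow (by positivity) hp.le, ← Real.rpow_mul hv.le]
      congr 2
      field_simp
    have hxle : ‖x‖ₑ ≤ ENNReal.ofReal (2 * R * v ^ (1 / (d : ℝ))) := by
      rw [← ofReal_norm]; exact ENNReal.ofReal_le_ofReal h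
    rw [e, ← ENNReal.ofReal_rpow_of_pos (by positivity), ENNReal.rpow_neg]
    -- Where the overlap can be nonzero, |x| ≤ 2R v^{1/d}, so the kernel on the right is at least 1.
    calc (1 : ℝ≥0∞) = ENNReal.ofReal (2 * R * v ^ (1 / (d : ℝ))) ^ (s * d) *
          (ENNReal.ofReal (2 * R * v ^ (1 / (d : ℝ))) ^ (s * d))⁻¹ := by
          rw [ENNReal.mul_inv_cancel]
          · refine (ENNReal.rpow_pos ?_ (by simp)).ne'
            rw [ENNReal.ofReal_pos]; positivity
          · exact (ENNReal.rpow_lt_top_of_nonneg hsd.le (by simp)).ne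
      _ ≤ _ := by gcongr

/-- The second moment of the mass of a grain, for measures of finite energy. -/
lemma lintegral_grainMass_sq_le (hd : 0 < d) (hC : MeasurableSet C) {R : ℝ} (hR0 : 0 < R)
    (hR : C ⊆ Metric.closedBall 0 R) (hC1 : volume C ≤ 1)
    (m : Measure (EuclideanSpace ℝ (Fin d))) [SFinite m] {v s : ℝ} (hv : 0 < v) (hs : 0 < s) :
    ∫⁻ x, grainMass C m (x, v) ^ 2 ≤
      ENNReal.ofReal ((2 * R) ^ (s * d) * v ^ (1 + s)) *
        ∫⁻ y, ∫⁻ z, ‖y - z‖ₑ ^ (-(s * d)) ∂m ∂m := by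
  simp_rw [pow_two]
  rw [lintegral_grainMass_mul hd hC m m hv]
  have e : ENNReal.ofReal ((2 * R) ^ (s * d) * v ^ (1 + s)) =
      ENNReal.ofReal v * ENNReal.ofReal ((2 * R) ^ (s * d) * v ^ s) := by
    rw [← ENNReal.ofReal_mul hv.le, Real.rpow_add hv, Real.rpow_one]; congr 1; ring
  rw [e, mul_assoc]
  gcongr
  have hmeas : Measurable fun q : EuclideanSpace ℝ (Fin d) × EuclideanSpace ℝ (Fin d) =>
      ‖q.1 - q.2‖ₑ ^ (-(s * d)) := by fun_prop
  have hin : ∀ y : EuclideanSpace ℝ (Fin d), Measurable fun z => ‖y - z‖ₑ ^ (-(s * d)) := by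
    intro y; fun_prop
  rw [← lintegral_const_mul _ hmeas.lintegral_prod_right']
  refine lintegral_mono fun y => ?_
  rw [← lintegral_const_mul _ (hin y)]
  exact lintegral_mono fun z => grainOverlap_le hd hR0 hR hC1 hv hs _

end GrainMass

/-! ### The value of a signed measure on a grain -/

section GrainValue

variable {d : ℕ} {C : Set (EuclideanSpace ℝ (Fin d))}

/-- The value of the signed measure `φ` on the grain of location `p.1` and volume `p.2`, defined
through the indicator of `C` so as to be measurable in `p`. -/
def grainValue (C : Set (EuclideanSpace ℝ (Fin d))) (φ : SignedMeasure (EuclideanSpace ℝ (Fin d)))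
    (p : EuclideanSpace ℝ (Fin d) × ℝ) : ℝ :=
  φ {y | p.2 ^ (-(1 / (d : ℝ))) • (y - p.1) ∈ C}

lemma grainValue_eq (φ : SignedMeasure (EuclideanSpace ℝ (Fin d)))
    (x : EuclideanSpace ℝ (Fin d)) {v : ℝ} (hv : 0 < v) :
    φ (grain C x v) = grainValue C φ (x, v) := by
  rw [grain_eq C x hv, grainValue]

lemma grainValue_eq_sub (hC : MeasurableSet C) (φ : SignedMeasure (EuclideanSpace ℝ (Fin d)))
    (p : EuclideanSpace ℝ (Fin d) × ℝ) :
    grainValue C φ p = (grainMass C φ.toJordanDecomposition.posPart p).toReal -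
      (grainMass C φ.toJordanDecomposition.negPart p).toReal := by
  rw [grainValue, φ.apply_eq_posPart_real_sub_negPart_real (measurableSet_grainSection hC p.1 p.2)]
  rfl

lemma measurable_grainValue (hC : MeasurableSet C) (φ : SignedMeasure (EuclideanSpace ℝ (Fin d))) :
    Measurable (grainValue C φ) := by
  have h := (measurable_grainMass hC φ.toJordanDecomposition.posPart).ennreal_toReal.sub
    (measurable_grainMass hC φ.toJordanDecomposition.negPart).ennreal_toReal
  exact (funext fun p => grainValue_eq_sub hC φ p : grainValue C φ = _) ▸ h

lemma enorm_grainValue_le (φ : SignedMeasure (EuclideanSpace ℝ (Fin d)))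
    (p : EuclideanSpace ℝ (Fin d) × ℝ) :
    ‖grainValue C φ p‖ₑ ≤ grainMass C φ.totalVariation p :=
  φ.enorm_le_totalVariation _

lemma grainMass_le (m : Measure (EuclideanSpace ℝ (Fin d))) (p : EuclideanSpace ℝ (Fin d) × ℝ) :
    grainMass C m p ≤ m univ := measure_mono (subset_univ _)

lemma grainValue_sum {κ : Type*} (s : Finset κ) (t : κ → ℝ)
    (φ : κ → SignedMeasure (EuclideanSpace ℝ (Fin d))) (p : EuclideanSpace ℝ (Fin d) × ℝ) :
    grainValue C (∑ k ∈ s, t k • φ k) p = ∑ k ∈ s, t k * grainValue C (φ k) p := by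
  classical
  induction s using Finset.induction_on with
  | empty => simp [grainValue]
  | insert a s ha ih =>
    rw [Finset.sum_insert ha, Finset.sum_insert ha, ← ih]
    simp [grainValue]

lemma lintegral_grainValue_le (hd : 0 < d) (hC : MeasurableSet C) (hC1 : volume C ≤ 1)
    (φ : SignedMeasure (EuclideanSpace ℝ (Fin d))) {v : ℝ} (hv : 0 < v) :
    ∫⁻ x, ‖grainValue C φ (x, v)‖ₑ ≤ ENNReal.ofReal v * φ.totalVariation univ := by
  refine (lintegral_mono fun x => enorm_grainValue_le φ (x, v)).trans ?_
  rw [lintegral_grainMass hd hC _ hv]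
  calc ENNReal.ofReal v * volume C * φ.totalVariation univ
      ≤ ENNReal.ofReal v * 1 * φ.totalVariation univ := by gcongr
    _ = _ := by rw [mul_one]

/-- One of the two factors is bounded by the total variation. This linear growth controls large
grains, for which the power 2 - α is too big. -/
lemma lintegral_grainValue_sq_le (hd : 0 < d) (hC : MeasurableSet C) (hC1 : volume C ≤ 1)
    (φ : SignedMeasure (EuclideanSpace ℝ (Fin d))) {v : ℝ} (hv : 0 < v) :
    ∫⁻ x, ‖grainValue C φ (x, v)‖ₑ ^ 2 ≤ ENNReal.ofReal v * φ.totalVariation univ ^ 2 := by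
  have h : ∀ x, ‖grainValue C φ (x, v)‖ₑ ^ 2 ≤
      φ.totalVariation univ * ‖grainValue C φ (x, v)‖ₑ := by
    intro x
    rw [pow_two]
    gcongr
    exact (enorm_grainValue_le φ (x, v)).trans (grainMass_le _ _)
  have hm : Measurable fun x => ‖grainValue C φ (x, v)‖ₑ :=
    ((measurable_grainValue hC φ).comp measurable_prodMk_right).enorm
  refine (lintegral_mono h).trans ?_
  rw [lintegral_const_mul _ hm]
  refine (mul_le_mul_right (lintegral_grainValue_le hd hC hC1 φ hv) _).trans (le_of_eq ?_)
  ring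

/-- `p`-th power growth, in the volume of the grain, of the integral of the square of `f` over the
location of the grain. -/
def HasSquareGrowth (f : EuclideanSpace ℝ (Fin d) × ℝ → ℝ) (p : ℝ) : Prop :=
  ∃ K : ℝ, 0 ≤ K ∧ ∀ v, 0 < v → ∫⁻ x, ‖f (x, v)‖ₑ ^ 2 ≤ ENNReal.ofReal (K * v ^ p)

lemma enorm_sq_eq_ofReal (a : ℝ) : ‖a‖ₑ ^ 2 = ENNReal.ofReal (a ^ 2) := by
  rw [Real.enorm_eq_ofReal_abs, ← ENNReal.ofReal_pow (abs_nonneg a), sq_abs]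

lemma HasSquareGrowth.const_mul {f : EuclideanSpace ℝ (Fin d) × ℝ → ℝ} {p : ℝ}
    (hf : HasSquareGrowth f p) (a : ℝ) : HasSquareGrowth (fun q => a * f q) p := by
  obtain ⟨K, hK, h⟩ := hf
  refine ⟨a ^ 2 * K, by positivity, fun v hv => ?_⟩
  have e : ∀ x, ‖a * f (x, v)‖ₑ ^ 2 = ENNReal.ofReal (a ^ 2) * ‖f (x, v)‖ₑ ^ 2 := by
    intro x
    rw [enorm_mul, mul_pow, enorm_sq_eq_ofReal a]
  simp_rw [e]
  rw [lintegral_const_mul' _ _ ENNReal.ofReal_ne_top, mul_assoc,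
    ENNReal.ofReal_mul (sq_nonneg a)]
  gcongr
  exact h v hv

lemma HasSquareGrowth.add {f g : EuclideanSpace ℝ (Fin d) × ℝ → ℝ} {p : ℝ}
    (hf : HasSquareGrowth f p) (hg : HasSquareGrowth g p) (hfm : Measurable f) :
    HasSquareGrowth (fun q => f q + g q) p := by
  obtain ⟨K, hK, h⟩ := hf
  obtain ⟨L, hL, h'⟩ := hg
  refine ⟨2 * (K + L), by positivity, fun v hv => ?_⟩
  have hp : (0 : ℝ) ≤ v ^ p := Real.rpow_nonneg hv.le _
  have hm : Measurable fun x => ‖f (x, v)‖ₑ ^ 2 :=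
    ((hfm.comp measurable_prodMk_right).enorm).pow_const 2
  calc ∫⁻ x, ‖f (x, v) + g (x, v)‖ₑ ^ 2
      ≤ ∫⁻ x, 2 * (‖f (x, v)‖ₑ ^ 2 + ‖g (x, v)‖ₑ ^ 2) :=
        lintegral_mono fun x => by
          rw [enorm_sq_eq_ofReal, enorm_sq_eq_ofReal, enorm_sq_eq_ofReal,
            ← ENNReal.ofReal_add (sq_nonneg _) (sq_nonneg _), ← ENNReal.ofReal_ofNat 2,
            ← ENNReal.ofReal_mul (by norm_num)]
          exact ENNReal.ofReal_le_ofReal add_sq_le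
    _ = 2 * ((∫⁻ x, ‖f (x, v)‖ₑ ^ 2) + ∫⁻ x, ‖g (x, v)‖ₑ ^ 2) := by
        rw [lintegral_const_mul' _ _ (by simp), lintegral_add_left hm]
    _ ≤ ENNReal.ofReal 2 * (ENNReal.ofReal (K * v ^ p) + ENNReal.ofReal (L * v ^ p)) := by
        rw [ENNReal.ofReal_ofNat]
        gcongr
        · exact h v hv
        · exact h' v hv
    _ = ENNReal.ofReal (2 * (K + L) * v ^ p) := by
        rw [← ENNReal.ofReal_add (by positivity) (by positivity),
          ← ENNReal.ofReal_mul (by positivity)]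
        congr 1; ring

lemma HasSquareGrowth.zero (p : ℝ) :
    HasSquareGrowth (fun _ : EuclideanSpace ℝ (Fin d) × ℝ => (0 : ℝ)) p :=
  ⟨0, le_rfl, fun v _ => by simp⟩

/-- The Riesz bound with s = 1 - α gives v^{1+s} = v^{2-α}. For α < 2 - γ this exponent exceeds γ
strictly, as the rescaling theorem requires at small volumes. -/
lemma hasSquareGrowth_grainValue (hd : 0 < d) (hC : MeasurableSet C) (hCb : Bornology.IsBounded C)
    (hC1 : volume C ≤ 1) {α : ℝ} (hα : α < 1) {φ : SignedMeasure (EuclideanSpace ℝ (Fin d))}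
    (hφ : φ ∈ rieszSpace d α) : HasSquareGrowth (grainValue C φ) (2 - α) := by
  obtain ⟨R, hR0, hR⟩ : ∃ R : ℝ, 0 < R ∧ C ⊆ Metric.closedBall 0 R := by
    obtain ⟨R, hR⟩ := hCb.subset_closedBall 0
    exact ⟨max R 1, by positivity, hR.trans (Metric.closedBall_subset_closedBall (le_max_left _ _))⟩
  have hfin : ∫⁻ x, ∫⁻ y, ‖x - y‖ₑ ^ (-((1 - α) * d)) ∂φ.totalVariation ∂φ.totalVariation < ∞ := hφ
  refine ⟨(2 * R) ^ ((1 - α) * d) * (∫⁻ x, ∫⁻ y, ‖x - y‖ₑ ^ (-((1 - α) * d))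
    ∂φ.totalVariation ∂φ.totalVariation).toReal, by positivity, fun v hv => ?_⟩
  refine (lintegral_mono fun x => pow_le_pow_left₀ zero_le (enorm_grainValue_le φ (x, v)) 2).trans ?_
  refine (lintegral_grainMass_sq_le hd hC hR0 hR hC1 _ hv (s := 1 - α) (by linarith)).trans ?_
  rw [mul_right_comm, ENNReal.ofReal_mul' ENNReal.toReal_nonneg, ENNReal.ofReal_toReal hfin.ne]
  have : 1 + (1 - α) = 2 - α := by ring
  rw [this]

/-- The growth is summed at the level of the functions of (x, v), so that `rieszSpace` need not be
shown to be closed under sums. -/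
lemma hasSquareGrowth_sum (hd : 0 < d) (hC : MeasurableSet C) (hCb : Bornology.IsBounded C)
    (hC1 : volume C ≤ 1) {α : ℝ} (hα : α < 1) {κ : Type*} (s : Finset κ) (t : κ → ℝ)
    (φ : κ → SignedMeasure (EuclideanSpace ℝ (Fin d))) (hφ : ∀ k, φ k ∈ rieszSpace d α) :
    HasSquareGrowth (grainValue C (∑ k ∈ s, t k • φ k)) (2 - α) := by
  classical
  have h : grainValue C (∑ k ∈ s, t k • φ k) = fun p => ∑ k ∈ s, t k * grainValue C (φ k) p :=
    funext fun p => grainValue_sum s t φ p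
  rw [h]
  clear h
  induction s using Finset.induction_on with
  | empty => simpa using HasSquareGrowth.zero _
  | insert a s ha ih =>
    simp_rw [Finset.sum_insert ha]
    exact ((hasSquareGrowth_grainValue hd hC hCb hC1 hα (hφ a)).const_mul (t a)).add ih
      ((measurable_grainValue hC (φ a)).const_mul _)

/-- The mass of almost every grain depends continuously on its volume. -/
lemma tendsto_grainMass (hd : 0 < d) (hC : MeasurableSet C) (hCf : volume (frontier C) = 0)
    (m : Measure (EuclideanSpace ℝ (Fin d))) [IsFiniteMeasure m] {v₀ : ℝ} (hv₀ : 0 < v₀) :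
    ∀ᵐ x : EuclideanSpace ℝ (Fin d), ∀ {ι : Type*} {l : Filter ι} [l.IsCountablyGenerated]
      {v : ι → ℝ}, Tendsto v l (𝓝 v₀) →
      Tendsto (fun i => grainMass C m (x, v i)) l (𝓝 (grainMass C m (x, v₀))) := by
  -- As |∂C| = 0, Fubini shows that for almost every centre the boundary of the grain is `m`-null.
  -- Off the boundary, membership in the grain is locally constant in the volume.
  have h0 : ∫⁻ x, grainMass (frontier C) m (x, v₀) = 0 := by
    rw [lintegral_grainMass hd isClosed_frontier.measurableSet m hv₀, hCf, mul_zero, zero_mul]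
  have hm : Measurable fun x => grainMass (frontier C) m (x, v₀) :=
    (measurable_grainMass isClosed_frontier.measurableSet m).comp measurable_prodMk_right
  rw [lintegral_eq_zero_iff hm] at h0
  filter_upwards [h0] with x hx ι l _ v hv
  refine tendsto_measure_of_ae_tendsto_indicator_of_isFiniteMeasure l
    (measurableSet_grainSection hC x v₀) (fun i => measurableSet_grainSection hC x (v i)) ?_
  have hx' : m {y | v₀ ^ (-(1 / (d : ℝ))) • (y - x) ∈ frontier C} = 0 := hx
  rw [measure_eq_zero_iff_ae_notMem] at hx'
  filter_upwards [hx'] with y hy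
  have hy : v₀ ^ (-(1 / (d : ℝ))) • (y - x) ∉ frontier C := hy
  change ∀ᶠ i in l, v i ^ (-(1 / (d : ℝ))) • (y - x) ∈ C ↔ v₀ ^ (-(1 / (d : ℝ))) • (y - x) ∈ C
  have hlim : Tendsto (fun i => v i ^ (-(1 / (d : ℝ))) • (y - x)) l
      (𝓝 (v₀ ^ (-(1 / (d : ℝ))) • (y - x))) :=
    (hv.rpow_const (Or.inl hv₀.ne')).smul_const _
  by_cases hyC : v₀ ^ (-(1 / (d : ℝ))) • (y - x) ∈ C
  · have hint : v₀ ^ (-(1 / (d : ℝ))) • (y - x) ∈ interior C := by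
      by_contra h
      exact hy ⟨subset_closure hyC, h⟩
    filter_upwards [hlim.eventually (isOpen_interior.mem_nhds hint)] with i hi
    exact ⟨fun _ => hyC, fun _ => interior_subset hi⟩
  · have hext : v₀ ^ (-(1 / (d : ℝ))) • (y - x) ∈ (closure C)ᶜ := by
      intro h
      exact hy ⟨h, fun h' => hyC (interior_subset h')⟩
    filter_upwards [hlim.eventually (isClosed_closure.isOpen_compl.mem_nhds hext)] with i hi
    exact ⟨fun h => absurd (subset_closure h) hi, fun h => absurd h hyC⟩

lemma tendsto_grainValue (hd : 0 < d) (hC : MeasurableSet C) (hCf : volume (frontier C) = 0)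
    (φ : SignedMeasure (EuclideanSpace ℝ (Fin d))) {v₀ : ℝ} (hv₀ : 0 < v₀)
    {ι : Type*} {l : Filter ι} [l.IsCountablyGenerated] {v : ι → ℝ} (hv : Tendsto v l (𝓝 v₀)) :
    ∀ᵐ x : EuclideanSpace ℝ (Fin d),
      Tendsto (fun i => grainValue C φ (x, v i)) l (𝓝 (grainValue C φ (x, v₀))) := by
  filter_upwards [tendsto_grainMass hd hC hCf φ.toJordanDecomposition.posPart hv₀,
    tendsto_grainMass hd hC hCf φ.toJordanDecomposition.negPart hv₀] with x h1 h2
  simp_rw [grainValue_eq_sub hC]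
  refine ((ENNReal.tendsto_toReal ?_).comp (h1 hv)).sub ((ENNReal.tendsto_toReal ?_).comp (h2 hv))
  · exact ((grainMass_le _ _).trans_lt (measure_lt_top _ _)).ne
  · exact ((grainMass_le _ _).trans_lt (measure_lt_top _ _)).ne

/-- Grains with a common centre need not be nested as v grows, but enclosing balls are. This
supplies a majorant uniform in v ≤ w. -/
lemma grainMass_le_closedBall {R : ℝ} (hR : C ⊆ Metric.closedBall 0 R)
    (m : Measure (EuclideanSpace ℝ (Fin d))) (x : EuclideanSpace ℝ (Fin d)) {v w : ℝ}
    (hv : 0 < v) (hvw : v ≤ w) :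
    grainMass C m (x, v) ≤ grainMass (Metric.closedBall 0 R) m (x, w) := by
  refine measure_mono fun y hy => ?_
  simp only [mem_ofPred_eq, mem_closedBall_zero_iff] at hy ⊢
  refine le_trans ?_ (mem_closedBall_zero_iff.1 (hR hy))
  rw [norm_smul, norm_smul]
  have h0 := Real.rpow_nonneg (hv.trans_le hvw).le (-(1 / (d : ℝ)))
  rw [Real.norm_of_nonneg h0, Real.norm_of_nonneg (Real.rpow_nonneg hv.le _)]
  exact mul_le_mul_of_nonneg_right
    (Real.rpow_le_rpow_of_nonpos hv hvw (neg_nonpos.2 (by positivity))) (norm_nonneg _)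

/-- Continuity in the volume, uniformly in the nonlinearity, of integrals over the location. -/
lemma tendsto_integral_comp_grainValue (hd : 0 < d) (hC : MeasurableSet C)
    (hCb : Bornology.IsBounded C) (hCf : volume (frontier C) = 0)
    (φ : SignedMeasure (EuclideanSpace ℝ (Fin d))) {ι : Type*} {l : Filter ι}
    [l.IsCountablyGenerated] {h : ι → ℝ → ℂ} {h₀ : ℝ → ℂ} (hcont : ∀ i, Continuous (h i))
    (hsq : ∀ i y, ‖h i y‖ ≤ y ^ 2 / 2)
    (hlim : ∀ (y : ι → ℝ) (y₀ : ℝ), Tendsto y l (𝓝 y₀) →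
      Tendsto (fun i => h i (y i)) l (𝓝 (h₀ y₀))) {v : ι → ℝ} {v₀ : ℝ} (hv₀ : 0 < v₀)
    (hv : Tendsto v l (𝓝 v₀)) :
    Tendsto (fun i => ∫ x, h i (grainValue C φ (x, v i))) l
      (𝓝 (∫ x, h₀ (grainValue C φ (x, v₀)))) := by
  obtain ⟨R, hR⟩ := hCb.subset_closedBall 0
  have hBm : MeasurableSet (Metric.closedBall (0 : EuclideanSpace ℝ (Fin d)) R) :=
    Metric.isClosed_closedBall.measurableSet
  have hGm : Measurable fun x => grainMass (Metric.closedBall 0 R) φ.totalVariation (x, 2 * v₀) :=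
    (measurable_grainMass hBm _).comp measurable_prodMk_right
  have hM : φ.totalVariation univ ≠ ∞ := (measure_lt_top _ _).ne
  -- In the square, one factor is bounded by the total variation and the other by the mass of the
  -- enclosing ball at volume 2v₀. The latter is integrable in x.
  refine tendsto_integral_filter_of_dominated_convergence
    (fun x => (φ.totalVariation univ).toReal *
      (grainMass (Metric.closedBall 0 R) φ.totalVariation (x, 2 * v₀)).toReal) ?_ ?_ ?_ ?_
  · exact Eventually.of_forall fun i => ((hcont i).measurable.comp
      ((measurable_grainValue hC φ).comp measurable_prodMk_right)).aestronglyMeasurable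
  · filter_upwards [hv.eventually (lt_mem_nhds hv₀),
      hv.eventually (gt_mem_nhds (by linarith : v₀ < 2 * v₀))] with i hi1 hi2
    refine Eventually.of_forall fun x => (hsq i _).trans ?_
    have h1 : |grainValue C φ (x, v i)| ≤ (φ.totalVariation univ).toReal := by
      have := (enorm_grainValue_le (C := C) φ (x, v i)).trans (grainMass_le _ _)
      rw [Real.enorm_eq_ofReal_abs] at this
      exact (ENNReal.ofReal_le_iff_le_toReal hM).1 this
    have h2 : |grainValue C φ (x, v i)| ≤
        (grainMass (Metric.closedBall 0 R) φ.totalVariation (x, 2 * v₀)).toReal := by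
      have := (enorm_grainValue_le (C := C) φ (x, v i)).trans
        (grainMass_le_closedBall hR φ.totalVariation x hi1 hi2.le)
      rw [Real.enorm_eq_ofReal_abs] at this
      exact (ENNReal.ofReal_le_iff_le_toReal ((grainMass_le _ _).trans_lt hM.lt_top).ne).1 this
    rw [← sq_abs]
    nlinarith [abs_nonneg (grainValue C φ (x, v i)),
      mul_le_mul h1 h2 (abs_nonneg _) ENNReal.toReal_nonneg]
  · refine Integrable.const_mul (integrable_toReal_of_lintegral_ne_top hGm.aemeasurable ?_) _
    rw [lintegral_grainMass hd hBm _ (by positivity)]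
    refine ENNReal.mul_ne_top (ENNReal.mul_ne_top ENNReal.ofReal_ne_top ?_) hM
    exact (Metric.isBounded_closedBall.measure_lt_top).ne
  · filter_upwards [tendsto_grainValue hd hC hCf φ hv₀ hv] with x hx
    exact hlim _ _ hx

end GrainValue

/-! ### Integration against the intensities -/

section Intensity

variable {d : ℕ} {C : Set (EuclideanSpace ℝ (Fin d))} {F : Measure ℝ} {lam ρ γ : ℝ}

instance [IsProbabilityMeasure F] : SigmaFinite (grainIntensity d F lam ρ) := by
  have : SigmaFinite (lam.toNNReal •
    (volume : Measure (EuclideanSpace ℝ (Fin d))).prod (scaledLaw F ρ)) := inferInstance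
  exact this

instance : SigmaFinite (stableIntensity d γ) := by
  unfold stableIntensity; infer_instance

lemma ae_prod_snd_pos {μ : Measure ℝ} [SFinite μ] (h : μ (Iic 0) = 0) :
    ∀ᵐ p ∂((volume : Measure (EuclideanSpace ℝ (Fin d))).prod μ), 0 < p.2 := by
  refine Measure.quasiMeasurePreserving_snd.ae (p := fun v => 0 < v) ?_
  rw [ae_iff]
  convert h using 2
  ext v; simp

lemma ae_grainIntensity_pos [IsProbabilityMeasure F] (hF0 : F (Iic 0) = 0) (hρ : 0 < ρ) :
    ∀ᵐ p ∂(grainIntensity d F lam ρ), 0 < p.2 :=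
  Measure.ae_smul_measure (ae_prod_snd_pos (scaledLaw_Iic_zero hF0 hρ)) _

lemma ae_stableIntensity_pos : ∀ᵐ p ∂(stableIntensity d γ), 0 < p.2 := by
  refine ae_prod_snd_pos ?_
  refine withDensity_absolutelyContinuous _ _ ?_
  rw [Measure.restrict_apply measurableSet_Iic, Iic_inter_Ioi, Ioc_self, measure_empty]

lemma lintegral_grainIntensity [IsProbabilityMeasure F]
    {g : EuclideanSpace ℝ (Fin d) × ℝ → ℝ≥0∞} (hg : Measurable g) :
    ∫⁻ p, g p ∂(grainIntensity d F lam ρ) =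
      ENNReal.ofReal lam * ∫⁻ v, (∫⁻ x, g (x, ρ * v)) ∂F := by
  rw [grainIntensity, lintegral_smul_measure, lintegral_prod_symm' _ hg, scaledLaw,
    lintegral_map hg.lintegral_prod_left' (measurable_const_mul ρ), smul_eq_mul]

lemma integral_grainIntensity [IsProbabilityMeasure F] (hlam : 0 < lam)
    {g : EuclideanSpace ℝ (Fin d) × ℝ → ℂ} (hg : StronglyMeasurable g)
    (hgi : Integrable g (grainIntensity d F lam ρ)) :
    ∫ p, g p ∂(grainIntensity d F lam ρ) = lam • ∫ v, (∫ x, g (x, ρ * v)) ∂F := by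
  rw [grainIntensity, integrable_smul_measure (by simpa using hlam) ENNReal.ofReal_ne_top] at hgi
  rw [grainIntensity, integral_smul_measure, integral_prod_symm _ hgi, scaledLaw,
    integral_map (measurable_const_mul ρ).aemeasurable
      hg.integral_prod_left'.aestronglyMeasurable, ENNReal.toReal_ofReal hlam.le]

lemma integral_stableIntensity {E : Type*} [NormedAddCommGroup E] [NormedSpace ℝ E]
    {g : EuclideanSpace ℝ (Fin d) × ℝ → E} (hgi : Integrable g (stableIntensity d γ)) :
    ∫ p, g p ∂(stableIntensity d γ) = ∫ v in Ioi (0 : ℝ), v ^ (-γ - 1) • ∫ x, g (x, v) := by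
  rw [stableIntensity] at hgi ⊢
  rw [integral_prod_symm _ hgi, integral_withDensity_eq_integral_toReal_smul (by fun_prop) (by simp)]
  refine setIntegral_congr_fun measurableSet_Ioi fun v hv => ?_
  rw [ENNReal.toReal_ofReal (Real.rpow_nonneg (le_of_lt hv) _)]

lemma lintegral_stableIntensity {g : EuclideanSpace ℝ (Fin d) × ℝ → ℝ≥0∞} (hg : Measurable g) :
    ∫⁻ p, g p ∂(stableIntensity d γ) =
      ∫⁻ v in Ioi (0 : ℝ), ENNReal.ofReal (v ^ (-γ - 1)) * ∫⁻ x, g (x, v) := by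
  rw [stableIntensity, lintegral_prod_symm' _ hg,
    lintegral_withDensity_eq_lintegral_mul _ (by fun_prop) hg.lintegral_prod_left']
  rfl

lemma lintegral_ofReal_lt_top_of_mean (hmean : ∫ v, v ∂F = 1) :
    ∫⁻ v, ENNReal.ofReal v ∂F < ∞ := by
  have hi : Integrable (fun v : ℝ => v) F := by
    by_contra h
    rw [integral_undef h] at hmean
    exact zero_ne_one hmean
  refine lt_of_le_of_lt (lintegral_mono fun v => ?_) hi.2
  rw [Real.enorm_eq_ofReal_abs]
  exact ENNReal.ofReal_le_ofReal (le_abs_self v)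

lemma ae_pos_of_Iic_zero (hF0 : F (Iic 0) = 0) : ∀ᵐ v ∂F, 0 < v := by
  rw [ae_iff]
  convert hF0 using 2
  ext v; simp

/-- The integral over the intensity `λ dx F_ρ(dv)` is finite when the integral over the location
grows linearly in the volume. -/
lemma lintegral_grainIntensity_lt_top [IsProbabilityMeasure F] (hF0 : F (Iic 0) = 0)
    (hmean : ∫ v, v ∂F = 1) (hρ : 0 < ρ) {g : EuclideanSpace ℝ (Fin d) × ℝ → ℝ≥0∞}
    (hg : Measurable g) {M : ℝ≥0∞} (hM : M ≠ ∞)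
    (h : ∀ v, 0 < v → ∫⁻ x, g (x, v) ≤ ENNReal.ofReal v * M) :
    ∫⁻ p, g p ∂(grainIntensity d F lam ρ) < ∞ := by
  rw [lintegral_grainIntensity hg]
  refine ENNReal.mul_lt_top ENNReal.ofReal_lt_top ?_
  calc ∫⁻ v, (∫⁻ x, g (x, ρ * v)) ∂F
      ≤ ∫⁻ v, ENNReal.ofReal v * (ENNReal.ofReal ρ * M) ∂F := by
        refine lintegral_mono_ae ?_
        filter_upwards [ae_pos_of_Iic_zero hF0] with v hv
        refine (h _ (mul_pos hρ hv)).trans (le_of_eq ?_)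
        rw [ENNReal.ofReal_mul hρ.le]; ring
    _ < ∞ := by
        rw [lintegral_mul_const _ (by fun_prop)]
        exact ENNReal.mul_lt_top (lintegral_ofReal_lt_top_of_mean hmean)
          (ENNReal.mul_lt_top ENNReal.ofReal_lt_top hM.lt_top)

lemma integrable_grainValue [IsProbabilityMeasure F] (hd : 0 < d) (hC : MeasurableSet C)
    (hC1 : volume C ≤ 1) (hF0 : F (Iic 0) = 0) (hmean : ∫ v, v ∂F = 1) (hρ : 0 < ρ)
    (φ : SignedMeasure (EuclideanSpace ℝ (Fin d))) :
    Integrable (grainValue C φ) (grainIntensity d F lam ρ) :=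
  ⟨(measurable_grainValue hC φ).aestronglyMeasurable,
    lintegral_grainIntensity_lt_top hF0 hmean hρ (measurable_grainValue hC φ).enorm
      (measure_lt_top _ _).ne fun _ hv => lintegral_grainValue_le hd hC hC1 φ hv⟩

/-- The centred grain field is a compensated Poisson integral. -/
lemma centredGrainField_ae_eq [IsProbabilityMeasure F] {Ω : Type*} [MeasurableSpace Ω]
    {P : Measure Ω} {N : Ω → Measure (EuclideanSpace ℝ (Fin d) × ℝ)}
    (hN : IsPoissonRandomMeasure N (grainIntensity d F lam ρ) P)
    (hd : 0 < d) (hC : MeasurableSet C)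
    (hC1 : volume C ≤ 1) (hF0 : F (Iic 0) = 0) (hmean : ∫ v, v ∂F = 1) (hρ : 0 < ρ)
    (φ : SignedMeasure (EuclideanSpace ℝ (Fin d))) :
    centredGrainField C N P φ =ᵐ[P]
      compensatedIntegral N (grainIntensity d F lam ρ) (grainValue C φ) := by
  have h1 : grainField C N φ =ᵐ[P] fun ω => ∫ p, grainValue C φ p ∂(N ω) := by
    filter_upwards [hN.ae_ae (ae_grainIntensity_pos hF0 hρ)] with ω hω
    refine integral_congr_ae ?_
    filter_upwards [hω] with p hp
    exact grainValue_eq φ p.1 hp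
  have h2 : ∫ ω, grainField C N φ ω ∂P = ∫ p, grainValue C φ p ∂(grainIntensity d F lam ρ) := by
    rw [integral_congr_ae h1]
    exact hN.integral_integral (integrable_grainValue hd hC hC1 hF0 hmean hρ φ)
  filter_upwards [h1] with ω hω
  rw [centredGrainField, compensatedIntegral, hω, h2]

lemma sum_mul_compensatedIntegral_ae_eq {S Ω κ : Type*} [MeasurableSpace S] [MeasurableSpace Ω]
    {N : Ω → Measure S} {η : Measure S} [SigmaFinite η] {P : Measure Ω}
    (hN : IsPoissonRandomMeasure N η P) (s : Finset κ) {f : κ → S → ℝ}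
    (hf : ∀ k, Integrable (f k) η) (t : κ → ℝ) :
    (fun ω => ∑ k ∈ s, t k * compensatedIntegral N η (f k) ω) =ᵐ[P]
      compensatedIntegral N η (fun p => ∑ k ∈ s, t k * f k p) := by
  have h : ∀ᵐ ω ∂P, ∀ k ∈ s, Integrable (f k) (N ω) :=
    (Finset.eventually_all s).2 fun k _ => hN.ae_integrable (hf k)
  filter_upwards [h] with ω hω
  simp only [compensatedIntegral]
  rw [integral_finsetSum _ fun k hk => (hω k hk).const_mul _,
    integral_finsetSum _ fun k _ => (hf k).const_mul _, ← Finset.sum_sub_distrib]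
  refine Finset.sum_congr rfl fun k _ => ?_
  rw [integral_const_mul, integral_const_mul, mul_sub]

/-- The joint characteristic function of the normalised centred grain field. -/
lemma integral_exp_sum_centredGrainField [IsProbabilityMeasure F] {Ω : Type*} [MeasurableSpace Ω]
    {P : Measure Ω} [IsProbabilityMeasure P] {N : Ω → Measure (EuclideanSpace ℝ (Fin d) × ℝ)}
    (hN : IsPoissonRandomMeasure N (grainIntensity d F lam ρ) P)
    (hd : 0 < d) (hC : MeasurableSet C)
    (hC1 : volume C ≤ 1) (hF0 : F (Iic 0) = 0) (hmean : ∫ v, v ∂F = 1) (hρ : 0 < ρ)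
    {κ : Type*} (s : Finset κ) (t : κ → ℝ) (φ : κ → SignedMeasure (EuclideanSpace ℝ (Fin d)))
    (b : ℝ) :
    ∫ ω, Complex.exp ((∑ k ∈ s, t k * (centredGrainField C N P (φ k) ω / b) : ℝ) * Complex.I) ∂P =
      Complex.exp (∫ p, compExp (grainValue C (∑ k ∈ s, t k • φ k) p / b)
        ∂(grainIntensity d F lam ρ)) := by
  have hi := fun k => integrable_grainValue (lam := lam) hd hC hC1 hF0 hmean hρ (φ k)
  have hae : ∀ᵐ ω ∂P, ∑ k ∈ s, t k * (centredGrainField C N P (φ k) ω / b) =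
      compensatedIntegral N (grainIntensity d F lam ρ)
        (fun p => grainValue C (∑ k ∈ s, t k • φ k) p / b) ω := by
    have h1 : ∀ᵐ ω ∂P, ∀ k ∈ s, centredGrainField C N P (φ k) ω =
        compensatedIntegral N (grainIntensity d F lam ρ) (grainValue C (φ k)) ω :=
      (Finset.eventually_all s).2 fun k _ => centredGrainField_ae_eq hN hd hC hC1 hF0 hmean hρ (φ k)
    filter_upwards [h1, sum_mul_compensatedIntegral_ae_eq hN s hi fun k => t k / b] with ω h1 h2
    have e : (fun p => grainValue C (∑ k ∈ s, t k • φ k) p / b) =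
        fun p => ∑ k ∈ s, t k / b * grainValue C (φ k) p := by
      funext p
      rw [grainValue_sum, Finset.sum_div]
      exact Finset.sum_congr rfl fun k _ => by ring
    rw [e, ← h2]
    refine Finset.sum_congr rfl fun k hk => ?_
    rw [h1 k hk]; ring
  rw [integral_congr_ae (hae.mono fun ω hω => by
    exact congrArg (fun r : ℝ => Complex.exp ((r : ℂ) * Complex.I)) hω)]
  exact hN.integral_exp_sub ((integrable_grainValue hd hC hC1 hF0 hmean hρ _).div_const b)

lemma norm_integral_comp_le {α : Type*} [MeasurableSpace α] {μ : Measure α} {f : α → ℝ}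
    {h : ℝ → ℂ} (hsq : ∀ y, ‖h y‖ ≤ y ^ 2 / 2) {B : ℝ} (hB : 0 ≤ B)
    (hf : ∫⁻ x, ‖f x‖ₑ ^ 2 ∂μ ≤ ENNReal.ofReal B) : ‖∫ x, h (f x) ∂μ‖ ≤ B := by
  have h1 : ‖∫ x, h (f x) ∂μ‖ₑ ≤ ENNReal.ofReal B := by
    refine (enorm_integral_le_lintegral_enorm _).trans (le_trans (lintegral_mono fun x => ?_) hf)
    rw [enorm_sq_eq_ofReal, ← ofReal_norm]
    exact ENNReal.ofReal_le_ofReal ((hsq _).trans (by nlinarith [sq_nonneg (f x)]))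
  rw [← ofReal_norm] at h1
  exact (ENNReal.ofReal_le_ofReal_iff hB).1 h1

/-- Convergence of the cumulants of the grain field, in the large-grain and the intermediate
regimes. -/
theorem tendsto_integral_grainIntensity (hd : 0 < d) (hC : MeasurableSet C)
    (hCb : Bornology.IsBounded C) (hC1 : volume C ≤ 1) (hCf : volume (frontier C) = 0)
    [IsProbabilityMeasure F] (hF : HasRegularlyVaryingTail F γ) (hF0 : F (Iic 0) = 0)
    (hmean : ∫ v, v ∂F = 1) (hγ : 1 < γ) {γ' : ℝ} (hγ' : γ < γ')
    {φ : SignedMeasure (EuclideanSpace ℝ (Fin d))} (hφ : HasSquareGrowth (grainValue C φ) γ')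
    (hφ2 : MemLp (grainValue C φ) 2 (stableIntensity d γ))
    {ι : Type*} {l : Filter ι} [l.IsCountablyGenerated] {lam ρ : ι → ℝ} (hlam0 : ∀ i, 0 < lam i)
    (hρ0 : ∀ i, 0 < ρ i) (hρ : Tendsto ρ l (𝓝 0))
    {h : ι → ℝ → ℂ} {h₀ : ℝ → ℂ} (hcont : ∀ i, Continuous (h i))
    (hsq : ∀ i y, ‖h i y‖ ≤ y ^ 2 / 2) (hcont₀ : Continuous h₀) (hsq₀ : ∀ y, ‖h₀ y‖ ≤ y ^ 2 / 2)
    (hlim : ∀ (y : ι → ℝ) (y₀ : ℝ), Tendsto y l (𝓝 y₀) →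
      Tendsto (fun i => h i (y i)) l (𝓝 (h₀ y₀))) :
    Tendsto (fun i => (lam i * tail (scaledLaw F (ρ i)) 1)⁻¹ •
        ∫ p, h i (grainValue C φ p) ∂(grainIntensity d F (lam i) (ρ i))) l
      (𝓝 (γ • ∫ p, h₀ (grainValue C φ p) ∂(stableIntensity d γ))) := by
  have hm := measurable_grainValue hC φ
  have hsm : ∀ i, StronglyMeasurable fun p => h i (grainValue C φ p) := fun i =>
    ((hcont i).measurable.comp hm).stronglyMeasurable
  have hint : ∀ i, Integrable (fun p => h i (grainValue C φ p))
      (grainIntensity d F (lam i) (ρ i)) := by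
    intro i
    refine ⟨(hsm i).aestronglyMeasurable, lt_of_le_of_lt (lintegral_mono fun p => ?_)
      (lintegral_grainIntensity_lt_top hF0 hmean (hρ0 i) (hm.enorm.pow_const 2)
        (M := φ.totalVariation univ ^ 2) (by finiteness)
        fun v hv => lintegral_grainValue_sq_le hd hC hC1 φ hv)⟩
    rw [enorm_sq_eq_ofReal, ← ofReal_norm]
    exact ENNReal.ofReal_le_ofReal
      ((hsq i _).trans (by nlinarith [sq_nonneg (grainValue C φ p)]))
  have hint₀ : Integrable (fun p => h₀ (grainValue C φ p)) (stableIntensity d γ) := by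
    refine Integrable.mono' hφ2.integrable_sq
      (hcont₀.measurable.comp hm).aestronglyMeasurable (ae_of_all _ fun p => ?_)
    exact (hsq₀ _).trans (by nlinarith [sq_nonneg (grainValue C φ p)])
  -- The scaled tail at 1 is F̄(1/ρ), so the rescaling theorem is applied at x = 1/ρ, and λ cancels.
  have e1 : ∀ i, (lam i * tail (scaledLaw F (ρ i)) 1)⁻¹ •
        ∫ p, h i (grainValue C φ p) ∂(grainIntensity d F (lam i) (ρ i)) =
      (tail F (1 / ρ i))⁻¹ • ∫ v, (∫ x, h i (grainValue C φ (x, v / (1 / ρ i)))) ∂F := by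
    intro i
    rw [integral_grainIntensity (hlam0 i) (hsm i) (hint i), tail_scaledLaw (hρ0 i), smul_smul]
    have : (lam i * tail F (1 / ρ i))⁻¹ * lam i = (tail F (1 / ρ i))⁻¹ := by
      rw [mul_inv, mul_right_comm, inv_mul_cancel₀ (hlam0 i).ne', one_mul]
    rw [this]
    congr 2
    funext v
    rw [div_div_eq_mul_div, div_one, mul_comm]
  have e2 : γ • ∫ p, h₀ (grainValue C φ p) ∂(stableIntensity d γ) =
      ∫ v in Ioi (0 : ℝ), (γ * v ^ (-γ - 1)) • ∫ x, h₀ (grainValue C φ (x, v)) := by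
    rw [integral_stableIntensity hint₀, ← integral_smul]
    simp_rw [mul_smul]
  simp_rw [e1, e2]
  obtain ⟨K, hK, hKb⟩ := hφ
  have hx : Tendsto (fun i => 1 / ρ i) l atTop := by
    simp_rw [one_div]
    exact tendsto_inv_nhdsGT_zero.comp
      (tendsto_nhdsWithin_iff.2 ⟨hρ, Eventually.of_forall fun i => hρ0 i⟩)
  set K' := (φ.totalVariation univ ^ 2).toReal with hK'
  have hK'0 : 0 ≤ K' := ENNReal.toReal_nonneg
  refine hF.tendsto_integral_rescaled hF0 hγ hγ' hx
    (g := fun i v => ∫ x, h i (grainValue C φ (x, v)))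
    (g₀ := fun v => ∫ x, h₀ (grainValue C φ (x, v))) (K := max K K')
    (fun i => (hsm i).integral_prod_left') ?_ ?_ ?_
  · refine Eventually.of_forall fun i v hv => ?_
    have hp := Real.rpow_nonneg hv.le γ'
    refine norm_integral_comp_le (hsq i) (by positivity) ((hKb v hv).trans ?_)
    exact ENNReal.ofReal_le_ofReal (mul_le_mul_of_nonneg_right (le_max_left _ _) hp)
  · refine Eventually.of_forall fun i v hv => ?_
    refine norm_integral_comp_le (hsq i) (by positivity)
      ((lintegral_grainValue_sq_le hd hC hC1 φ hv).trans ?_)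
    rw [mul_comm _ v, ENNReal.ofReal_mul hv.le]
    gcongr
    rw [← ENNReal.ofReal_toReal (a := φ.totalVariation univ ^ 2) (by finiteness)]
    exact ENNReal.ofReal_le_ofReal (le_max_right _ _)
  · intro v v₀ hv₀ hv
    exact tendsto_integral_comp_grainValue hd hC hCb hCf φ hcont hsq hlim hv₀ hv

end Intensity

/-! ### Convergence of finite-dimensional distributions through characteristic functions -/

lemma charFun_map_toLp {Ω₀ : Type*} [MeasurableSpace Ω₀] (Q : Measure Ω₀) {n : ℕ}
    {Z : Ω₀ → Fin n → ℝ} (hZ : AEMeasurable Z Q) (t : EuclideanSpace ℝ (Fin n)) :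
    charFun (Q.map fun ω => WithLp.toLp 2 (Z ω)) t =
      ∫ ω, Complex.exp ((∑ k, t k * Z ω k : ℝ) * Complex.I) ∂Q := by
  have hZ' : AEMeasurable (fun ω => WithLp.toLp 2 (Z ω)) Q :=
    (WithLp.measurable_toLp 2 _).comp_aemeasurable hZ
  rw [charFun_apply, integral_map hZ']
  · congr 1
  · have : Continuous fun x : EuclideanSpace ℝ (Fin n) =>
        Complex.exp ((inner ℝ x t : ℝ) * Complex.I) := by fun_prop
    exact this.aestronglyMeasurable

/-- A countably generated filter can be tested along sequences, where Lévy's continuity theorem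
applies. It needs an inner product, hence the passage to `EuclideanSpace` and back by the continuous
map `WithLp.ofLp`. -/
lemma tendstoInDistribution_of_tendsto_integral_exp {ι Ω' : Type*} {Ω : ι → Type*}
    [∀ i, MeasurableSpace (Ω i)] [MeasurableSpace Ω'] {P : (i : ι) → Measure (Ω i)}
    [∀ i, IsProbabilityMeasure (P i)] {Q : Measure Ω'} [IsProbabilityMeasure Q] {l : Filter ι}
    [l.IsCountablyGenerated] {n : ℕ} {X : (i : ι) → Ω i → Fin n → ℝ} {Y : Ω' → Fin n → ℝ}
    (hX : ∀ i, AEMeasurable (X i) (P i)) (hY : AEMeasurable Y Q)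
    (h : ∀ t : Fin n → ℝ, Tendsto
      (fun i => ∫ ω, Complex.exp ((∑ k, t k * X i ω k : ℝ) * Complex.I) ∂(P i)) l
      (𝓝 (∫ ω, Complex.exp ((∑ k, t k * Y ω k : ℝ) * Complex.I) ∂Q))) :
    TendstoInDistribution X l Y P Q := by
  have hT : Measurable (WithLp.toLp 2 : (Fin n → ℝ) → EuclideanSpace ℝ (Fin n)) :=
    WithLp.measurable_toLp 2 _
  have main : TendstoInDistribution (fun i ω => WithLp.toLp 2 (X i ω)) l
      (fun ω => WithLp.toLp 2 (Y ω)) P Q := by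
    refine ⟨fun i => hT.comp_aemeasurable (hX i), hT.comp_aemeasurable hY, ?_⟩
    refine tendsto_of_seq_tendsto fun x hx => ?_
    refine ProbabilityMeasure.tendsto_iff_tendsto_charFun.2 fun t => ?_
    have := (h t).comp hx
    refine (this.congr fun m => ?_).trans (le_of_eq ?_)
    · exact (charFun_map_toLp (P (x m)) (hX (x m)) t).symm
    · exact congrArg 𝓝 (charFun_map_toLp Q hY t).symm
  have := main.continuous_comp (g := WithLp.ofLp) (PiLp.continuous_ofLp 2 _)
  exact this

/-! ### The covariance kernel -/

section Kernel

variable {d : ℕ} {C : Set (EuclideanSpace ℝ (Fin d))} {γ : ℝ}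

/-- The kernel `K_{γ,C}`, as an extended nonnegative number. -/
def egrainKernel (γ : ℝ) (C : Set (EuclideanSpace ℝ (Fin d))) (x : EuclideanSpace ℝ (Fin d)) :
    ℝ≥0∞ :=
  ∫⁻ v in Ioi (0 : ℝ), ENNReal.ofReal (v ^ (-γ)) * grainOverlap C v x

lemma measurable_uncurry_grainOverlap (hC : MeasurableSet C) :
    Measurable fun q : ℝ × EuclideanSpace ℝ (Fin d) =>
      ENNReal.ofReal (q.1 ^ (-γ)) * grainOverlap C q.1 q.2 := by
  have h : Measurable fun q : ℝ × EuclideanSpace ℝ (Fin d) => ENNReal.ofReal (q.1 ^ (-γ)) := by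
    fun_prop
  exact h.mul (measurable_grainOverlap hC)

lemma measurable_egrainKernel (hC : MeasurableSet C) : Measurable (egrainKernel γ C) :=
  (measurable_uncurry_grainOverlap hC).lintegral_prod_left'

/-- Where the integral diverges, as at x = 0 when C has positive volume, both sides take the value
0. -/
lemma grainKernel_eq (hC : MeasurableSet C) (hC1 : volume C ≠ ∞) (x : EuclideanSpace ℝ (Fin d)) :
    grainKernel γ C x = (egrainKernel γ C x).toReal := by
  have hm : Measurable fun v => grainOverlap C v x := by
    have h := measurable_grainOverlap hC
    generalize grainOverlap C = k at h ⊢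
    exact h.comp measurable_prodMk_right
  rw [grainKernel, egrainKernel, integral_eq_lintegral_of_nonneg_ae]
  · congr 1
    refine setLIntegral_congr_fun measurableSet_Ioi fun v _ => ?_
    have hfin : grainOverlap C v x ≠ ∞ := ((grainOverlap_le_volume v x).trans_lt hC1.lt_top).ne
    change ENNReal.ofReal ((grainOverlap C v x).toReal * v ^ (-γ)) = _
    rw [ENNReal.ofReal_mul ENNReal.toReal_nonneg, ENNReal.ofReal_toReal hfin, mul_comm]
  · refine (ae_restrict_mem measurableSet_Ioi).mono fun v hv => ?_
    exact mul_nonneg ENNReal.toReal_nonneg (Real.rpow_nonneg (le_of_lt hv) _)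
  · have h2 : Measurable fun v : ℝ => v ^ (-γ) := by fun_prop
    exact (hm.ennreal_toReal.mul h2).aestronglyMeasurable

/-- The covariance kernel is dominated by a Riesz kernel. -/
lemma egrainKernel_le (hd : 0 < d) {R : ℝ} (hR0 : 0 < R) (hR : C ⊆ Metric.closedBall 0 R)
    (hC1 : volume C ≤ 1) (hγ : 1 < γ) (x : EuclideanSpace ℝ (Fin d)) :
    egrainKernel γ C x ≤
      ENNReal.ofReal ((2 * R) ^ ((γ - 1) * d) / (γ - 1)) * ‖x‖ₑ ^ (-((γ - 1) * d)) := by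
  have hd' : (0 : ℝ) < d := by exact_mod_cast hd
  have hγ' : 0 < γ - 1 := by linarith
  rcases eq_or_ne x 0 with rfl | hx
  · rw [enorm_zero, ENNReal.zero_rpow_of_neg (by nlinarith [mul_pos hγ' hd'])]
    rw [ENNReal.mul_top]
    · exact le_top
    · rw [Ne, ENNReal.ofReal_eq_zero, not_le]; positivity
  · have hx0 : 0 < ‖x‖ := norm_pos_iff.2 hx
    -- Below the volume a = (|x|/2R)^d the overlap vanishes, and above it the overlap is at most 1.
    -- Thus the kernel is at most ∫_a^∞ v^{-γ} dv.
    set a : ℝ := (‖x‖ / (2 * R)) ^ (d : ℝ) with ha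
    have ha0 : 0 < a := by positivity
    have hle : ∀ v, 0 < v → v < a → grainOverlap C v x = 0 := by
      intro v hv hva
      refine grainOverlap_eq_zero hR hv ?_
      have : v ^ (1 / (d : ℝ)) < ‖x‖ / (2 * R) := by
        calc v ^ (1 / (d : ℝ)) < a ^ (1 / (d : ℝ)) :=
              Real.rpow_lt_rpow hv.le hva (by positivity)
          _ = ‖x‖ / (2 * R) := by
              rw [ha, ← Real.rpow_mul (by positivity), mul_one_div_cancel hd'.ne', Real.rpow_one]
      rw [lt_div_iff₀ (by positivity)] at this
      linarith
    have h1 : egrainKernel γ C x ≤ ∫⁻ v in Ioi a, ENNReal.ofReal (v ^ (-γ)) := by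
      rw [egrainKernel, ← lintegral_indicator measurableSet_Ioi,
        ← lintegral_indicator measurableSet_Ioi]
      refine lintegral_mono_ae ?_
      have hne : ∀ᵐ v : ℝ, v ≠ a := by simp [ae_iff]
      filter_upwards [hne] with v hva
      by_cases hv : v ∈ Ioi (0 : ℝ)
      · rw [indicator_of_mem hv]
        by_cases h : v ∈ Ioi a
        · rw [indicator_of_mem h]
          calc _ ≤ ENNReal.ofReal (v ^ (-γ)) * 1 := by
                gcongr
                exact (grainOverlap_le_volume v x).trans hC1
            _ = _ := mul_one _
        · rw [hle v hv (lt_of_le_of_ne (not_lt.1 h) hva), mul_zero]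
          exact zero_le
      · rw [indicator_of_notMem hv]; exact zero_le
    refine h1.trans (le_of_eq ?_)
    rw [← ofReal_integral_eq_lintegral_ofReal (integrableOn_Ioi_rpow_of_lt (by linarith) ha0)
      ((ae_restrict_mem measurableSet_Ioi).mono fun v hv =>
        Real.rpow_nonneg (ha0.le.trans (le_of_lt hv)) _),
      integral_Ioi_rpow_of_lt (by linarith) ha0, ← ofReal_norm,
      ENNReal.ofReal_rpow_of_pos hx0, ← ENNReal.ofReal_mul (by positivity)]
    congr 1
    rw [ha, ← Real.rpow_mul (by positivity), Real.div_rpow hx0.le (by positivity)]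
    have e : (d : ℝ) * (-γ + 1) = -((γ - 1) * d) := by ring
    rw [e, Real.rpow_neg (by positivity : (0 : ℝ) ≤ 2 * R)]
    have : -γ + 1 = -(γ - 1) := by ring
    rw [this]
    have h2 : (2 * R) ^ ((γ - 1) * d) ≠ 0 := by positivity
    field_simp

/-- The mixed second moment of grain masses under the stable intensity. -/
lemma lintegral_grainMass_mul_stableIntensity (hd : 0 < d) (hC : MeasurableSet C)
    (m n : Measure (EuclideanSpace ℝ (Fin d))) [SFinite m] [SFinite n] :
    ∫⁻ p, grainMass C m p * grainMass C n p ∂(stableIntensity d γ) =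
      ∫⁻ q, egrainKernel γ C (q.1 - q.2) ∂(m.prod n) := by
  have hM : Measurable fun p => grainMass C m p * grainMass C n p :=
    (measurable_grainMass hC m).mul (measurable_grainMass hC n)
  have hov : ∀ v, Measurable fun q : EuclideanSpace ℝ (Fin d) × EuclideanSpace ℝ (Fin d) =>
    grainOverlap C v (q.1 - q.2) := fun v => measurable_grainOverlap_sub hC v
  have h1 : ∫⁻ p, grainMass C m p * grainMass C n p ∂(stableIntensity d γ) =
      ∫⁻ v in Ioi (0 : ℝ), ∫⁻ q, ENNReal.ofReal (v ^ (-γ)) * grainOverlap C v (q.1 - q.2)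
        ∂(m.prod n) := by
    rw [lintegral_stableIntensity hM]
    refine setLIntegral_congr_fun measurableSet_Ioi fun v hv => ?_
    have hv : 0 < v := hv
    change ENNReal.ofReal (v ^ (-γ - 1)) * ∫⁻ x, grainMass C m (x, v) * grainMass C n (x, v) = _
    rw [lintegral_grainMass_mul hd hC m n hv, lintegral_const_mul _ (hov v),
      lintegral_prod _ (hov v).aemeasurable, ← mul_assoc,
      ← ENNReal.ofReal_mul (Real.rpow_nonneg hv.le _), Real.rpow_sub_one hv.ne',
      div_mul_cancel₀ _ hv.ne']
  rw [h1, lintegral_lintegral_swap]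
  · rfl
  · have h := measurable_uncurry_grainOverlap (γ := γ) hC
    have hp : Measurable fun q : ℝ × (EuclideanSpace ℝ (Fin d) × EuclideanSpace ℝ (Fin d)) =>
      (q.1, q.2.1 - q.2.2) := by fun_prop
    exact (h.comp hp).aemeasurable

lemma exists_subset_closedBall (hCb : Bornology.IsBounded C) :
    ∃ R : ℝ, 0 < R ∧ C ⊆ Metric.closedBall 0 R := by
  obtain ⟨R, hR⟩ := hCb.subset_closedBall 0
  exact ⟨max R 1, by positivity, hR.trans (Metric.closedBall_subset_closedBall (le_max_left _ _))⟩

/-- The kernel is dominated by |x|^{-(γ-1)d}, which is the Riesz kernel defining M^{2-γ}. -/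
lemma lintegral_sq_grainMass_lt_top (hd : 0 < d) (hC : MeasurableSet C)
    (hCb : Bornology.IsBounded C) (hC1 : volume C ≤ 1) (hγ : 1 < γ)
    {φ : SignedMeasure (EuclideanSpace ℝ (Fin d))} (hφ : φ ∈ rieszSpace d (2 - γ)) :
    ∫⁻ p, grainMass C φ.totalVariation p * grainMass C φ.totalVariation p
      ∂(stableIntensity d γ) < ∞ := by
  obtain ⟨R, hR0, hR⟩ := exists_subset_closedBall hCb
  have hφ' : ∫⁻ x, ∫⁻ y, ‖x - y‖ₑ ^ (-((1 - (2 - γ)) * d)) ∂φ.totalVariation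
    ∂φ.totalVariation < ∞ := hφ
  rw [lintegral_grainMass_mul_stableIntensity hd hC]
  have hm : Measurable fun q : EuclideanSpace ℝ (Fin d) × EuclideanSpace ℝ (Fin d) =>
    ‖q.1 - q.2‖ₑ ^ (-((γ - 1) * d)) := by fun_prop
  refine lt_of_le_of_lt (lintegral_mono fun q => egrainKernel_le hd hR0 hR hC1 hγ (q.1 - q.2)) ?_
  rw [lintegral_const_mul _ hm, lintegral_prod _ hm.aemeasurable]
  refine ENNReal.mul_lt_top ENNReal.ofReal_lt_top ?_
  have e : (1 - (2 - γ)) = γ - 1 := by ring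
  rwa [e] at hφ'

/-- The function `(x, v) ↦ φ(x + v ^ (1 / d) C)` is square integrable for the stable intensity. -/
lemma memLp_grainValue (hd : 0 < d) (hC : MeasurableSet C)
    (hCb : Bornology.IsBounded C) (hC1 : volume C ≤ 1) (hγ : 1 < γ)
    {φ : SignedMeasure (EuclideanSpace ℝ (Fin d))} (hφ : φ ∈ rieszSpace d (2 - γ)) :
    MemLp (grainValue C φ) 2 (stableIntensity d γ) := by
  refine ⟨(measurable_grainValue hC φ).aestronglyMeasurable, ?_⟩
  rw [eLpNorm_two_eq]
  refine ENNReal.rpow_lt_top_of_nonneg (by norm_num) (ne_of_lt ?_)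
  refine lt_of_le_of_lt (lintegral_mono fun p => ?_)
    (lintegral_sq_grainMass_lt_top hd hC hCb hC1 hγ hφ)
  rw [pow_two]
  exact mul_le_mul' (enorm_grainValue_le φ p) (enorm_grainValue_le φ p)

/-- From ab ≤ a² + b². -/
lemma lintegral_grainMass_mul_lt_top (hd : 0 < d) (hC : MeasurableSet C)
    (hCb : Bornology.IsBounded C) (hC1 : volume C ≤ 1) (hγ : 1 < γ)
    {φ ψ : SignedMeasure (EuclideanSpace ℝ (Fin d))} (hφ : φ ∈ rieszSpace d (2 - γ))
    (hψ : ψ ∈ rieszSpace d (2 - γ)) :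
    ∫⁻ p, grainMass C φ.totalVariation p * grainMass C ψ.totalVariation p
      ∂(stableIntensity d γ) < ∞ := by
  have hm := measurable_grainMass hC φ.totalVariation
  refine lt_of_le_of_lt (lintegral_mono fun p => ?_)
    ((lintegral_add_left (hm.mul hm) _).trans_lt (ENNReal.add_lt_top.2
      ⟨lintegral_sq_grainMass_lt_top hd hC hCb hC1 hγ hφ,
        lintegral_sq_grainMass_lt_top hd hC hCb hC1 hγ hψ⟩))
  rcases le_total (grainMass C φ.totalVariation p) (grainMass C ψ.totalVariation p) with h | h
  · exact (mul_le_mul' h le_rfl).trans le_add_self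
  · exact (mul_le_mul' le_rfl h).trans le_self_add

lemma integral_signedMeasure {X : Type*} [MeasurableSpace X] (φ : SignedMeasure X) {f : X → ℝ}
    (hf : Integrable f φ.totalVariation) :
    ∫ᵛ x, f x ∂<•φ = (∫ x, f x ∂φ.toJordanDecomposition.posPart) -
      ∫ x, f x ∂φ.toJordanDecomposition.negPart := by
  have h1 : Integrable f φ.toJordanDecomposition.posPart :=
    hf.mono_measure (Measure.le_add_right le_rfl)
  have h2 : Integrable f φ.toJordanDecomposition.negPart :=
    hf.mono_measure (Measure.le_add_left le_rfl)
  conv_lhs => rw [← φ.toSignedMeasure_toJordanDecomposition]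
  rw [JordanDecomposition.toSignedMeasure, VectorMeasure.integral_sub_vectorMeasure,
    VectorMeasure.integral_toSignedMeasure, VectorMeasure.integral_toSignedMeasure]
  · simpa [VectorMeasure.Integrable] using h1
  · simpa [VectorMeasure.Integrable] using h2

/-- Fubini for the covariance kernel, for nonnegative measures. -/
lemma integral_toReal_grainMass_mul (hd : 0 < d) (hC : MeasurableSet C) (hC1 : volume C ≠ ∞)
    (m n : Measure (EuclideanSpace ℝ (Fin d))) [IsFiniteMeasure m] [IsFiniteMeasure n]
    (hfin : ∫⁻ p, grainMass C m p * grainMass C n p ∂(stableIntensity d γ) < ∞) :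
    Integrable (fun p => (grainMass C m p).toReal * (grainMass C n p).toReal)
        (stableIntensity d γ) ∧
      Integrable (fun q : EuclideanSpace ℝ (Fin d) × EuclideanSpace ℝ (Fin d) =>
        grainKernel γ C (q.1 - q.2)) (m.prod n) ∧
      ∫ p, (grainMass C m p).toReal * (grainMass C n p).toReal ∂(stableIntensity d γ) =
        ∫ x, ∫ y, grainKernel γ C (x - y) ∂n ∂m := by
  have hM : Measurable fun p => grainMass C m p * grainMass C n p :=
    (measurable_grainMass hC m).mul (measurable_grainMass hC n)
  have hK : Measurable fun q : EuclideanSpace ℝ (Fin d) × EuclideanSpace ℝ (Fin d) =>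
    egrainKernel γ C (q.1 - q.2) :=
    (measurable_egrainKernel hC).comp (measurable_fst.sub measurable_snd)
  have hfin' := hfin
  rw [lintegral_grainMass_mul_stableIntensity hd hC] at hfin'
  have hKi : Integrable (fun q : EuclideanSpace ℝ (Fin d) × EuclideanSpace ℝ (Fin d) =>
      grainKernel γ C (q.1 - q.2)) (m.prod n) := by
    simp_rw [grainKernel_eq hC hC1]
    exact integrable_toReal_of_lintegral_ne_top hK.aemeasurable hfin'.ne
  simp_rw [← ENNReal.toReal_mul]
  refine ⟨integrable_toReal_of_lintegral_ne_top hM.aemeasurable hfin.ne, hKi, ?_⟩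
  rw [integral_toReal hM.aemeasurable (ae_lt_top hM hfin.ne),
    lintegral_grainMass_mul_stableIntensity hd hC, ← integral_toReal hK.aemeasurable
      (ae_lt_top hK hfin'.ne), ← integral_prod _ hKi]
  simp_rw [grainKernel_eq hC hC1]

/-- The inner product of the functions `(x, v) ↦ φ(x + v ^ (1 / d) C)`. -/
lemma integral_grainValue_mul (hd : 0 < d) (hC : MeasurableSet C)
    (hCb : Bornology.IsBounded C) (hC1 : volume C ≤ 1) (hγ : 1 < γ)
    {φ ψ : SignedMeasure (EuclideanSpace ℝ (Fin d))} (hφ : φ ∈ rieszSpace d (2 - γ))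
    (hψ : ψ ∈ rieszSpace d (2 - γ)) :
    ∫ p, grainValue C φ p * grainValue C ψ p ∂(stableIntensity d γ) =
      ∫ᵛ x, (∫ᵛ y, grainKernel γ C (x - y) ∂<•ψ) ∂<•φ := by
  have hC1' : volume C ≠ ∞ := (hC1.trans_lt ENNReal.one_lt_top).ne
  have hfin := lintegral_grainMass_mul_lt_top (γ := γ) hd hC hCb hC1 hγ hφ hψ
  obtain ⟨-, hKi, -⟩ := integral_toReal_grainMass_mul hd hC hC1' _ _ hfin
  set φp := φ.toJordanDecomposition.posPart with hφp
  set φn := φ.toJordanDecomposition.negPart with hφn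
  set ψp := ψ.toJordanDecomposition.posPart with hψp
  set ψn := ψ.toJordanDecomposition.negPart with hψn
  have lφp : φp ≤ φ.totalVariation := Measure.le_add_right le_rfl
  have lφn : φn ≤ φ.totalVariation := Measure.le_add_left le_rfl
  have lψp : ψp ≤ ψ.totalVariation := Measure.le_add_right le_rfl
  have lψn : ψn ≤ ψ.totalVariation := Measure.le_add_left le_rfl
  -- The four products of Jordan parts are all dominated by the product of total variations, so each
  -- may be treated by Fubini separately.
  have key : ∀ m n : Measure (EuclideanSpace ℝ (Fin d)), m ≤ φ.totalVariation →
      n ≤ ψ.totalVariation →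
      ∫⁻ p, grainMass C m p * grainMass C n p ∂(stableIntensity d γ) < ∞ := fun m n hm hn =>
    lt_of_le_of_lt (lintegral_mono fun p => mul_le_mul' (hm _) (hn _)) hfin
  obtain ⟨i1, j1, e1⟩ := integral_toReal_grainMass_mul hd hC hC1' _ _ (key φp ψp lφp lψp)
  obtain ⟨i2, j2, e2⟩ := integral_toReal_grainMass_mul hd hC hC1' _ _ (key φp ψn lφp lψn)
  obtain ⟨i3, j3, e3⟩ := integral_toReal_grainMass_mul hd hC hC1' _ _ (key φn ψp lφn lψp)
  obtain ⟨i4, j4, e4⟩ := integral_toReal_grainMass_mul hd hC hC1' _ _ (key φn ψn lφn lψn)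
  have hL : ∫ p, grainValue C φ p * grainValue C ψ p ∂(stableIntensity d γ) =
      ((∫ x, ∫ y, grainKernel γ C (x - y) ∂ψp ∂φp) - ∫ x, ∫ y, grainKernel γ C (x - y) ∂ψn ∂φp) -
      ((∫ x, ∫ y, grainKernel γ C (x - y) ∂ψp ∂φn) -
        ∫ x, ∫ y, grainKernel γ C (x - y) ∂ψn ∂φn) := by
    rw [← e1, ← e2, ← e3, ← e4, ← integral_sub i1 i2, ← integral_sub i3 i4]
    refine Eq.trans ?_ (integral_sub (i1.sub i2) (i3.sub i4))
    refine integral_congr_ae (ae_of_all _ fun p => ?_)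
    simp only [grainValue_eq_sub hC φ, grainValue_eq_sub hC ψ]
    ring
  -- The kernel need not be integrable against |ψ| for every x, so the Jordan formula for the inner
  -- integral is available only |φ|-almost everywhere.
  have hinner : (fun x => ∫ᵛ y, grainKernel γ C (x - y) ∂<•ψ) =ᵐ[φ.totalVariation]
      fun x => (∫ y, grainKernel γ C (x - y) ∂ψp) - ∫ y, grainKernel γ C (x - y) ∂ψn := by
    filter_upwards [hKi.prod_right_ae] with x hx
    exact integral_signedMeasure ψ hx
  have hiP : Integrable (fun x => ∫ y, grainKernel γ C (x - y) ∂ψp) φ.totalVariation :=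
    (integral_toReal_grainMass_mul hd hC hC1' _ _ (key _ ψp le_rfl lψp)).2.1.integral_prod_left
  have hiN : Integrable (fun x => ∫ y, grainKernel γ C (x - y) ∂ψn) φ.totalVariation :=
    (integral_toReal_grainMass_mul hd hC hC1' _ _ (key _ ψn le_rfl lψn)).2.1.integral_prod_left
  have hsub : Integrable (fun x => (∫ y, grainKernel γ C (x - y) ∂ψp) -
    ∫ y, grainKernel γ C (x - y) ∂ψn) φ.totalVariation := hiP.sub hiN
  rw [φ.totalVariation_eq_variation] at hinner
  rw [VectorMeasure.integral_congr_ae hinner, integral_signedMeasure φ hsub, hL,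
    integral_sub (hiP.mono_measure lφp) (hiN.mono_measure lφp),
    integral_sub (hiP.mono_measure lφn) (hiN.mono_measure lφn)]

/-- Raising the index weakens the singularity on the diagonal. Away from it the kernel is bounded by
1, which a finite measure integrates. -/
lemma rieszSpace_subset_rieszSpace {α β : ℝ} (hαβ : α ≤ β) (hβ : β < 1) :
    rieszSpace d α ⊆ rieszSpace d β := by
  intro φ hφ
  have hφ' : ∫⁻ x, ∫⁻ y, ‖x - y‖ₑ ^ (-((1 - α) * d)) ∂φ.totalVariation
    ∂φ.totalVariation < ∞ := hφ
  have hle : ∀ z : EuclideanSpace ℝ (Fin d),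
      ‖z‖ₑ ^ (-((1 - β) * d)) ≤ 1 + ‖z‖ₑ ^ (-((1 - α) * d)) := by
    intro z
    have hd0 : (0 : ℝ) ≤ d := Nat.cast_nonneg d
    rcases le_total 1 ‖z‖ₑ with h | h
    · refine le_trans ?_ le_self_add
      calc ‖z‖ₑ ^ (-((1 - β) * d)) ≤ ‖z‖ₑ ^ (0 : ℝ) :=
            ENNReal.rpow_le_rpow_of_exponent_le h (by nlinarith)
        _ = 1 := ENNReal.rpow_zero
    · refine le_trans ?_ le_add_self
      exact ENNReal.rpow_le_rpow_of_exponent_ge h (by nlinarith)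
  have : ∫⁻ x, ∫⁻ y, ‖x - y‖ₑ ^ (-((1 - β) * d)) ∂φ.totalVariation ∂φ.totalVariation < ∞ := by
    refine lt_of_le_of_lt (lintegral_mono fun x => lintegral_mono fun y => hle (x - y)) ?_
    simp_rw [lintegral_add_left measurable_const, lintegral_const]
    exact ENNReal.add_lt_top.2 ⟨by finiteness, hφ'⟩
  exact this

end Kernel

/-! ### The isonormal Gaussian process -/

section Isonormal

lemma norm_integral_exp_sub_le {Ω : Type*} [MeasurableSpace Ω] {Q : Measure Ω}
    [IsProbabilityMeasure Q] (f g : Lp ℝ 2 Q) :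
    ‖(∫ ω, Complex.exp ((f ω : ℝ) * Complex.I) ∂Q) - ∫ ω, Complex.exp ((g ω : ℝ) * Complex.I) ∂Q‖ ≤
      ‖f - g‖ := by
  have hint : ∀ h : Lp ℝ 2 Q, Integrable (fun ω => Complex.exp ((h ω : ℝ) * Complex.I)) Q := by
    intro h
    refine Integrable.of_bound (C := 1) ?_ (ae_of_all _ fun ω => ?_)
    · have : Continuous fun x : ℝ => Complex.exp ((x : ℂ) * Complex.I) := by fun_prop
      exact this.comp_aestronglyMeasurable (Lp.aestronglyMeasurable h)
    · rw [Complex.norm_exp_ofReal_mul_I]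
  rw [← integral_sub (hint f) (hint g)]
  have h1 : ‖∫ ω, (Complex.exp ((f ω : ℝ) * Complex.I) - Complex.exp ((g ω : ℝ) * Complex.I)) ∂Q‖ₑ ≤
      eLpNorm (f - g : Lp ℝ 2 Q) 2 Q := by
    calc _ ≤ ∫⁻ ω, ‖Complex.exp ((f ω : ℝ) * Complex.I) -
            Complex.exp ((g ω : ℝ) * Complex.I)‖ₑ ∂Q := enorm_integral_le_lintegral_enorm _
      _ ≤ ∫⁻ ω, ‖(f - g : Lp ℝ 2 Q) ω‖ₑ ∂Q := by
          refine lintegral_mono_ae ?_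
          filter_upwards [Lp.coeFn_sub f g] with ω hω
          rw [hω, Pi.sub_apply, ← ofReal_norm, ← ofReal_norm]
          exact ENNReal.ofReal_le_ofReal (norm_exp_mul_I_sub_exp_le _ _)
      _ = eLpNorm (f - g : Lp ℝ 2 Q) 1 Q := (eLpNorm_one_eq_lintegral_enorm).symm
      _ ≤ eLpNorm (f - g : Lp ℝ 2 Q) 2 Q :=
          eLpNorm_le_eLpNorm_of_exponent_le (by norm_num) (Lp.aestronglyMeasurable _)
  rw [Lp.norm_def]
  rw [← ofReal_norm] at h1
  exact (ENNReal.ofReal_le_iff_le_toReal (Lp.eLpNorm_ne_top _)).1 h1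

/-- The isonormal Gaussian process over a real Hilbert space. -/
theorem exists_isonormal {H : Type*} [NormedAddCommGroup H] [InnerProductSpace ℝ H]
    [CompleteSpace H] :
    ∃ (κ : Set H) (Q : Measure (κ → ℝ)) (_ : IsProbabilityMeasure Q) (Φ : H →ₗᵢ[ℝ] Lp ℝ 2 Q),
      ∀ h : H, ∫ ω, Complex.exp ((Φ h ω : ℝ) * Complex.I) ∂Q =
        Complex.exp (-(‖h‖ ^ 2 / 2 : ℝ)) := by
  -- Independent standard Gaussian coordinates indexed by a Hilbert basis are orthonormal in L²(Q).
  -- Sending the basis to them defines the isometry.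
  obtain ⟨κ, b, -⟩ := exists_hilbertBasis ℝ H
  set Q : Measure (κ → ℝ) := Measure.infinitePi fun _ => gaussianReal 0 1 with hQ
  have hev : ∀ k : κ, Measurable fun ω : κ → ℝ => ω k := fun k => measurable_pi_apply k
  have hlaw : ∀ k : κ, Q.map (fun ω => ω k) = gaussianReal 0 1 := fun k =>
    Measure.infinitePi_map_eval _ k
  have hind : iIndepFun (fun (k : κ) (ω : κ → ℝ) => ω k) Q :=
    iIndepFun_infinitePi (X := fun _ x => x) fun _ => measurable_id
  have hmem : ∀ k : κ, MemLp (fun ω : κ → ℝ => ω k) 2 Q := by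
    intro k
    have h := memLp_id_gaussianReal (μ := 0) (v := 1) 2
    rw [← hlaw k, memLp_map_measure_iff (by fun_prop) (hev k).aemeasurable] at h
    exact h
  have hmean : ∀ k : κ, ∫ ω : κ → ℝ, ω k ∂Q = 0 := by
    intro k
    have h := integral_id_gaussianReal (μ := 0) (v := 1)
    rwa [← hlaw k, integral_map (hev k).aemeasurable (by fun_prop)] at h
  have hvar : ∀ k : κ, ∫ ω : κ → ℝ, ω k * ω k ∂Q = 1 := by
    intro k
    have h := variance_id_gaussianReal (μ := 0) (v := 1)
    rw [variance_of_integral_eq_zero (by fun_prop) (by simp), ← hlaw k,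
      integral_map (hev k).aemeasurable (by fun_prop)] at h
    simpa [pow_two] using h
  have hchar : ∀ (k : κ) (c : ℝ), ∫ ω : κ → ℝ, Complex.exp ((c * ω k : ℝ) * Complex.I) ∂Q =
      Complex.exp (-(c ^ 2 / 2 : ℝ)) := by
    intro k c
    have h := charFun_gaussianReal (μ := 0) (v := 1) c
    rw [charFun_apply_real, ← hlaw k, integral_map (hev k).aemeasurable (by fun_prop)] at h
    push_cast
    rw [h]
    congr 1
    push_cast
    ring
  set v : κ → Lp ℝ 2 Q := fun k => (hmem k).toLp with hv
  have hvcoe : ∀ k, (v k : (κ → ℝ) → ℝ) =ᵐ[Q] fun ω => ω k := fun k => (hmem k).coeFn_toLp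
  have horth : Orthonormal ℝ v := by
    classical
    rw [orthonormal_iff_ite]
    intro j k
    have e : inner ℝ (v j) (v k) = ∫ ω : κ → ℝ, ω j * ω k ∂Q := by
      rw [L2.inner_def]
      refine integral_congr_ae ?_
      filter_upwards [hvcoe j, hvcoe k] with ω h1 h2
      rw [h1, h2]
      simp [mul_comm]
    rw [e]
    split_ifs with h
    · rw [h, hvar]
    · have := (hind.indepFun h).integral_fun_mul_eq_mul_integral
        (hev j).aestronglyMeasurable (hev k).aestronglyMeasurable
      rw [this, hmean, zero_mul]
  have hpartial : ∀ (s : Finset κ) (c : κ → ℝ),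
      ∫ ω, Complex.exp (((∑ k ∈ s, c k • v k : Lp ℝ 2 Q) ω : ℝ) * Complex.I) ∂Q =
        Complex.exp (-(‖∑ k ∈ s, c k • v k‖ ^ 2 / 2 : ℝ)) := by
    intro s c
    have hco : ∀ᵐ ω ∂Q, (∑ k ∈ s, c k • v k : Lp ℝ 2 Q) ω = ∑ k ∈ s, c k * ω k := by
      have h1 : ∀ᵐ ω ∂Q, ∀ k ∈ s, (c k • v k : Lp ℝ 2 Q) ω = c k * ω k := by
        refine (Finset.eventually_all s).2 fun k _ => ?_
        filter_upwards [Lp.coeFn_smul (c k) (v k), hvcoe k] with ω h1 h2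
        rw [h1, Pi.smul_apply, h2, smul_eq_mul]
      filter_upwards [Lp.coeFn_finsetSum s fun k => c k • v k, h1] with ω h2 h1
      rw [h2, Finset.sum_apply]
      exact Finset.sum_congr rfl h1
    have hn : ‖∑ k ∈ s, c k • v k‖ ^ 2 = ∑ k ∈ s, c k ^ 2 := by
      rw [← real_inner_self_eq_norm_sq, horth.inner_sum]
      simp [pow_two]
    have hind' := hind.precomp (Subtype.val_injective (p := fun k => k ∈ s))
    have hm : ∀ k : s, Measurable fun x : ℝ => Complex.exp ((c k * x : ℝ) * Complex.I) := by
      intro k; fun_prop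
    have hprod := (hind'.comp (fun (k : s) (x : ℝ) => Complex.exp ((c k * x : ℝ) * Complex.I))
      hm).integral_fun_prod_eq_prod_integral (fun k =>
        ((hm k).comp (measurable_pi_apply _)).aestronglyMeasurable)
    have e : ∫ ω, Complex.exp (((∑ k ∈ s, c k • v k : Lp ℝ 2 Q) ω : ℝ) * Complex.I) ∂Q =
        ∫ ω : κ → ℝ, ∏ k : s, Complex.exp ((c k * ω k : ℝ) * Complex.I) ∂Q := by
      refine integral_congr_ae ?_
      filter_upwards [hco] with ω hω
      rw [hω, ← Complex.exp_sum, Finset.sum_coe_sort s fun k => ((c k * ω k : ℝ) : ℂ) * Complex.I,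
        ← Finset.sum_mul]
      push_cast
      rfl
    rw [e]
    refine hprod.trans ?_
    simp only [Function.comp_def]
    rw [Fintype.prod_congr _ _ fun k : s => hchar k (c k), ← Complex.exp_sum,
      Finset.sum_coe_sort s fun k => (-((c k ^ 2 / 2 : ℝ) : ℂ)), hn, Finset.sum_div]
    push_cast
    rw [Finset.sum_neg_distrib]
  refine ⟨κ, Q, inferInstance, horth.orthogonalFamily.linearIsometry.comp
    b.repr.toLinearIsometry, fun h => ?_⟩
  set Φ := horth.orthogonalFamily.linearIsometry.comp b.repr.toLinearIsometry with hΦ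
  have hsum : HasSum (fun k => b.repr h k • v k) (Φ h) := by
    exact horth.orthogonalFamily.hasSum_linearIsometry (b.repr h)
  -- The finite partial sums have Gaussian characteristic functions by independence. Both sides are
  -- continuous for the L² norm.
  have h1 : Tendsto (fun s : Finset κ => ∫ ω, Complex.exp
      (((∑ k ∈ s, b.repr h k • v k : Lp ℝ 2 Q) ω : ℝ) * Complex.I) ∂Q) atTop
      (𝓝 (∫ ω, Complex.exp ((Φ h ω : ℝ) * Complex.I) ∂Q)) := by
    rw [tendsto_iff_norm_sub_tendsto_zero]
    exact squeeze_zero (fun _ => norm_nonneg _) (fun s => norm_integral_exp_sub_le _ _)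
      (tendsto_iff_norm_sub_tendsto_zero.1 hsum)
  have h2 : Tendsto (fun s : Finset κ => Complex.exp (-(‖∑ k ∈ s, b.repr h k • v k‖ ^ 2 / 2 : ℝ)))
      atTop (𝓝 (Complex.exp (-(‖Φ h‖ ^ 2 / 2 : ℝ)))) := by
    have hc : Continuous fun x : Lp ℝ 2 Q => Complex.exp (-(‖x‖ ^ 2 / 2 : ℝ)) := by fun_prop
    exact (hc.tendsto _).comp hsum
  simp_rw [hpartial] at h1
  rw [tendsto_nhds_unique h1 h2, Φ.norm_map]

/-- Evaluating the hypothesis at t • h gives the whole characteristic function of Φ(h). -/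
lemma map_isonormal {H Ω : Type*} [NormedAddCommGroup H] [InnerProductSpace ℝ H]
    [MeasurableSpace Ω] {Q : Measure Ω} [IsProbabilityMeasure Q] {Φ : H →ₗᵢ[ℝ] Lp ℝ 2 Q}
    (hΦ : ∀ h : H, ∫ ω, Complex.exp ((Φ h ω : ℝ) * Complex.I) ∂Q =
      Complex.exp (-(‖h‖ ^ 2 / 2 : ℝ))) (h : H) :
    Q.map (Φ h) = gaussianReal 0 (‖h‖₊ ^ 2) := by
  have hm : AEMeasurable (Φ h) Q := (Lp.aestronglyMeasurable _).aemeasurable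
  have := Measure.isProbabilityMeasure_map hm
  refine Measure.ext_of_charFun (funext fun t => ?_)
  rw [charFun_apply_real, integral_map hm (by fun_prop), charFun_gaussianReal]
  have e : ∫ ω, Complex.exp (t * (Φ h ω : ℝ) * Complex.I) ∂Q =
      ∫ ω, Complex.exp ((Φ (t • h) ω : ℝ) * Complex.I) ∂Q := by
    refine integral_congr_ae ?_
    rw [map_smul]
    filter_upwards [Lp.coeFn_smul t (Φ h)] with ω hω
    rw [hω]
    simp
  rw [e, hΦ]
  congr 1
  rw [norm_smul, mul_pow, Real.norm_eq_abs, sq_abs]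
  push_cast
  ring

end Isonormal

/-! ### The large-grain limit -/

section LargeGrain

variable {d : ℕ} {C : Set (EuclideanSpace ℝ (Fin d))} {γ : ℝ}

/-- W(φ) is the isonormal process evaluated at (x, v) ↦ φ(x + v^{1/d} C), an element of L²(dx
v^{-γ-1} dv) for φ ∈ M^{2-γ}. The isometry gives the covariance, and Fubini rewrites it with
K_{γ,C}. -/
theorem exists_isLargeGrainLimit (hd : 0 < d) (hC : MeasurableSet C)
    (hCb : Bornology.IsBounded C) (hC1 : volume C ≤ 1) (hγ : 1 < γ) :
    ∃ (Ω' : Type) (_ : MeasurableSpace Ω') (Q : Measure Ω') (_ : IsProbabilityMeasure Q)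
      (W : SignedMeasure (EuclideanSpace ℝ (Fin d)) → Ω' → ℝ), IsLargeGrainLimit γ C W Q := by
  classical
  obtain ⟨κ, Q, hQ, Φ, hΦ⟩ := exists_isonormal (H := Lp ℝ 2 (stableIntensity d γ))
  have hmem : ∀ φ : rieszSpace d (2 - γ), MemLp (grainValue C φ.1) 2 (stableIntensity d γ) :=
    fun φ => memLp_grainValue hd hC hCb hC1 hγ φ.2
  set W : SignedMeasure (EuclideanSpace ℝ (Fin d)) → (κ → ℝ) → ℝ := fun φ =>
    if h : MemLp (grainValue C φ) 2 (stableIntensity d γ) then (Φ h.toLp : (κ → ℝ) → ℝ) else 0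
    with hW
  have hWeq : ∀ φ (h : MemLp (grainValue C φ) 2 (stableIntensity d γ)),
      W φ = (Φ h.toLp : (κ → ℝ) → ℝ) := fun φ h => by simp only [hW, dif_pos h]
  have hmap : ∀ φ : rieszSpace d (2 - γ),
      Q.map (W φ) = gaussianReal 0 (‖(hmem φ).toLp‖₊ ^ 2) := by
    intro φ
    rw [hWeq φ (hmem φ)]
    exact map_isonormal hΦ _
  refine ⟨κ → ℝ, inferInstance, Q, hQ, W, ⟨?_, ⟨fun I => ⟨?_⟩⟩, ?_, ?_⟩⟩
  · intro φ hφ ψ hψ a b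
    have e : grainValue C (a • φ + b • ψ) = a • grainValue C φ + b • grainValue C ψ := by
      funext p; simp [grainValue]
    have hab : MemLp (grainValue C (a • φ + b • ψ)) 2 (stableIntensity d γ) := by
      rw [e]; exact ((hmem ⟨φ, hφ⟩).const_smul a).add ((hmem ⟨ψ, hψ⟩).const_smul b)
    have e2 : hab.toLp = a • (hmem ⟨φ, hφ⟩).toLp + b • (hmem ⟨ψ, hψ⟩).toLp := by
      rw [← MemLp.toLp_const_smul, ← MemLp.toLp_const_smul, ← MemLp.toLp_add]
      exact MemLp.toLp_congr _ _ (ae_of_all _ fun p => congrFun e p)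
    rw [hWeq _ hab, hWeq _ (hmem ⟨φ, hφ⟩), hWeq _ (hmem ⟨ψ, hψ⟩), e2, map_add, map_smul, map_smul]
    filter_upwards [Lp.coeFn_add (a • Φ (hmem ⟨φ, hφ⟩).toLp) (b • Φ (hmem ⟨ψ, hψ⟩).toLp),
      Lp.coeFn_smul a (Φ (hmem ⟨φ, hφ⟩).toLp), Lp.coeFn_smul b (Φ (hmem ⟨ψ, hψ⟩).toLp)]
      with ω h1 h2 h3
    rw [h1, Pi.add_apply, h2, h3]
    rfl
  · have hWm : ∀ φ : rieszSpace d (2 - γ), AEMeasurable (W φ) Q := fun φ => by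
      rw [hWeq _ (hmem φ)]; exact (Lp.aestronglyMeasurable _).aemeasurable
    have hRm : AEMeasurable (fun ω => I.restrict fun φ : rieszSpace d (2 - γ) => W φ ω) Q :=
      aemeasurable_pi_lambda _ fun φ => hWm φ
    refine isGaussian_of_map_eq_gaussianReal fun L => ?_
    -- A linear functional of finitely many values of W is the isonormal process at this single
    -- vector, hence Gaussian.
    set h := ∑ φ : I, L (Pi.single φ 1) • (hmem φ).toLp with hh
    refine ⟨0, ‖h‖₊ ^ 2, ?_⟩
    rw [← map_isonormal hΦ h, AEMeasurable.map_map_of_aemeasurable (by fun_prop) hRm]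
    refine Measure.map_congr ?_
    rw [hh, map_sum]
    have h1 : ∀ᵐ ω ∂Q, ∀ φ : I, (Φ (L (Pi.single φ 1) • (hmem φ).toLp) : (κ → ℝ) → ℝ) ω =
        L (Pi.single φ 1) * W φ ω := by
      refine ae_all_iff.2 fun φ => ?_
      rw [map_smul, hWeq _ (hmem φ)]
      filter_upwards [Lp.coeFn_smul (L (Pi.single φ 1)) (Φ (hmem φ).toLp)] with ω hω
      rw [hω]; rfl
    filter_upwards [Lp.coeFn_finsetSum Finset.univ
      fun φ : I => Φ (L (Pi.single φ 1) • (hmem φ).toLp), h1] with ω h2 h1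
    rw [h2, Finset.sum_apply, Finset.sum_congr rfl fun φ _ => h1 φ, Function.comp_apply]
    conv_lhs => rw [← Finset.univ_sum_single (I.restrict fun φ : rieszSpace d (2 - γ) => W φ ω)]
    rw [map_sum]
    refine Finset.sum_congr rfl fun φ _ => ?_
    have : (Pi.single φ (I.restrict (fun φ : rieszSpace d (2 - γ) => W φ ω) φ) : I → ℝ) =
        W φ ω • Pi.single φ 1 := by
      rw [← Pi.single_smul]; simp
    rw [this, map_smul, smul_eq_mul, mul_comm]
  · intro φ hφ
    have h := integral_id_gaussianReal (μ := 0) (v := ‖(hmem ⟨φ, hφ⟩).toLp‖₊ ^ 2)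
    have hm : AEMeasurable (W φ) Q := by
      rw [hWeq _ (hmem ⟨φ, hφ⟩)]; exact (Lp.aestronglyMeasurable _).aemeasurable
    rwa [← hmap ⟨φ, hφ⟩, integral_map hm (by fun_prop)] at h
  · intro φ hφ ψ hψ
    rw [← integral_grainValue_mul hd hC hCb hC1 hγ hφ hψ]
    have h1 := Φ.inner_map_map (hmem ⟨φ, hφ⟩).toLp (hmem ⟨ψ, hψ⟩).toLp
    rw [L2.inner_def, L2.inner_def] at h1
    rw [hWeq _ (hmem ⟨φ, hφ⟩), hWeq _ (hmem ⟨ψ, hψ⟩)]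
    calc _ = _ := integral_congr_ae (ae_of_all _ fun ω => mul_comm _ _)
      _ = _ := h1
      _ = _ := by
        refine integral_congr_ae ?_
        filter_upwards [(hmem ⟨φ, hφ⟩).coeFn_toLp, (hmem ⟨ψ, hψ⟩).coeFn_toLp] with p h1 h2
        rw [h1, h2]
        exact mul_comm _ _

end LargeGrain

/-! ### Large-grain scaling -/

section Scaling

variable {d : ℕ} {C : Set (EuclideanSpace ℝ (Fin d))} {γ : ℝ}

/-- A linear combination of the W(φ_k) is centred Gaussian. Expanding its variance by the covariance
formula reassembles the squared L² norm of the grain values of ∑ t_k φ_k. -/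
lemma IsLargeGrainLimit.integral_exp (hd : 0 < d) (hC : MeasurableSet C)
    (hCb : Bornology.IsBounded C) (hC1 : volume C ≤ 1) (hγ : 1 < γ) {Ω : Type*}
    [MeasurableSpace Ω] {Q : Measure Ω} [IsProbabilityMeasure Q]
    {W : SignedMeasure (EuclideanSpace ℝ (Fin d)) → Ω → ℝ} (hW : IsLargeGrainLimit γ C W Q)
    {n : ℕ} (t : Fin n → ℝ) {φ : Fin n → SignedMeasure (EuclideanSpace ℝ (Fin d))}
    (hφ : ∀ k, φ k ∈ rieszSpace d (2 - γ)) :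
    ∫ ω, Complex.exp ((∑ k, t k * W (φ k) ω : ℝ) * Complex.I) ∂Q =
      Complex.exp (∫ p, (-(grainValue C (∑ k, t k • φ k) p ^ 2 / 2 : ℝ) : ℂ)
        ∂(stableIntensity d γ)) := by
  have hG : IsGaussianProcess (fun (k : Fin n) => W (φ k)) Q :=
    hW.gaussian.comp_right fun k => ⟨φ k, hφ k⟩
  have hL : HasGaussianLaw (fun ω => ∑ k, t k * W (φ k) ω) Q := (hG.smul t).hasGaussianLaw_fun_sum
  have h2 : ∀ k, MemLp (W (φ k)) 2 Q := fun k => (hG.hasGaussianLaw_eval k).memLp_two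
  have hf : ∀ k, MemLp (grainValue C (φ k)) 2 (stableIntensity d γ) :=
    fun k => memLp_grainValue hd hC hCb hC1 hγ (hφ k)
  have hmean : ∫ ω, ∑ k, t k * W (φ k) ω ∂Q = 0 := by
    rw [integral_finsetSum _ fun k _ => ((h2 k).integrable one_le_two).const_mul _]
    refine Finset.sum_eq_zero fun k _ => ?_
    rw [integral_const_mul, hW.mean_eq _ (hφ k), mul_zero]
  have hsq : ∀ (a : Fin n → ℝ), (∑ k, a k) ^ 2 = ∑ j, ∑ k, a j * a k := by
    intro a
    rw [pow_two, Finset.sum_mul_sum]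
  have hvar : ∫ ω, (∑ k, t k * W (φ k) ω) ^ 2 ∂Q =
      ∫ p, grainValue C (∑ k, t k • φ k) p ^ 2 ∂(stableIntensity d γ) := by
    simp_rw [grainValue_sum, hsq]
    have hi1 : ∀ j k, Integrable (fun ω => t j * W (φ j) ω * (t k * W (φ k) ω)) Q := fun j k =>
      ((h2 j).const_mul (t j)).integrable_mul ((h2 k).const_mul (t k))
    have hi2 : ∀ j k, Integrable (fun p => t j * grainValue C (φ j) p *
        (t k * grainValue C (φ k) p)) (stableIntensity d γ) := fun j k =>
      ((hf j).const_mul (t j)).integrable_mul ((hf k).const_mul (t k))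
    rw [integral_finsetSum _ fun j _ => integrable_finsetSum _ fun k _ => hi1 j k,
      integral_finsetSum _ fun j _ => integrable_finsetSum _ fun k _ => hi2 j k]
    refine Finset.sum_congr rfl fun j _ => ?_
    rw [integral_finsetSum _ fun k _ => hi1 j k, integral_finsetSum _ fun k _ => hi2 j k]
    refine Finset.sum_congr rfl fun k _ => ?_
    simp_rw [mul_mul_mul_comm (t j)]
    rw [integral_const_mul, integral_const_mul, hW.cov_eq _ (hφ j) _ (hφ k),
      integral_grainValue_mul hd hC hCb hC1 hγ (hφ j) (hφ k)]
  have hnn : 0 ≤ ∫ p, grainValue C (∑ k, t k • φ k) p ^ 2 ∂(stableIntensity d γ) :=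
    integral_nonneg fun p => sq_nonneg _
  have hch := congrArg (fun μ => charFun μ 1) hL.map_eq_gaussianReal
  simp only [charFun_gaussianReal, hmean] at hch
  rw [charFun_apply_real, integral_map hL.aemeasurable (by fun_prop),
    variance_of_integral_eq_zero hL.aemeasurable hmean, hvar] at hch
  simp only [Complex.ofReal_one, one_mul] at hch
  rw [hch, integral_neg, integral_complex_ofReal, integral_div]
  congr 1
  rw [Real.coe_toNNReal _ hnn]
  push_cast
  ring

theorem tendstoFDD_largeGrain (hd : 0 < d) (hC : MeasurableSet C)
    (hCb : Bornology.IsBounded C) (hC1 : volume C ≤ 1) (hCf : volume (frontier C) = 0)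
    {F : Measure ℝ} [IsProbabilityMeasure F] (hF : HasRegularlyVaryingTail F γ)
    (hF0 : F (Iic 0) = 0) (hmean : ∫ v, v ∂F = 1) (hγ : 1 < γ) {α : ℝ} (hα : α < 2 - γ)
    {ι : Type*} {l : Filter ι} [l.IsCountablyGenerated] {lam ρ : ι → ℝ} (hlam0 : ∀ i, 0 < lam i)
    (hρ0 : ∀ i, 0 < ρ i) (hρ : Tendsto ρ l (𝓝 0)) {Ω : ι → Type*} [∀ i, MeasurableSpace (Ω i)]
    {P : (i : ι) → Measure (Ω i)} [∀ i, IsProbabilityMeasure (P i)]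
    {N : (i : ι) → Ω i → Measure (EuclideanSpace ℝ (Fin d) × ℝ)}
    (hN : ∀ i, IsPoissonRandomMeasure (N i) (grainIntensity d F (lam i) (ρ i)) (P i))
    (hlim : Tendsto (fun i => lam i * tail (scaledLaw F (ρ i)) 1) l atTop)
    {Ω' : Type*} [MeasurableSpace Ω'] {Q : Measure Ω'} [IsProbabilityMeasure Q]
    {W : SignedMeasure (EuclideanSpace ℝ (Fin d)) → Ω' → ℝ} (hW : IsLargeGrainLimit γ C W Q) :
    TendstoFDD (rieszSpace d α)
      (fun i φ ω => centredGrainField C (N i) (P i) φ ω /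
        (γ * lam i * tail (scaledLaw F (ρ i)) 1) ^ (1 / 2 : ℝ)) l W P Q := by
  intro n φ hφ
  have hφ' : ∀ k, φ k ∈ rieszSpace d (2 - γ) := fun k =>
    rieszSpace_subset_rieszSpace hα.le (by linarith) (hφ k)
  have hγ0 : 0 < γ := by linarith
  set s : ι → ℝ := fun i => (γ * lam i * tail (scaledLaw F (ρ i)) 1) ^ (1 / 2 : ℝ) with hs
  have hT : ∀ i, 0 < tail (scaledLaw F (ρ i)) 1 := fun i => by
    rw [tail_scaledLaw (hρ0 i)]; exact hF.tail_pos _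
  have hs0 : ∀ i, 0 < s i := fun i =>
    Real.rpow_pos_of_pos (mul_pos (mul_pos hγ0 (hlam0 i)) (hT i)) _
  have hs2 : ∀ i, s i ^ 2 = γ * (lam i * tail (scaledLaw F (ρ i)) 1) := fun i => by
    rw [hs, ← Real.rpow_natCast, ← Real.rpow_mul
      (mul_pos (mul_pos hγ0 (hlam0 i)) (hT i)).le]
    norm_num
    ring
  have hsT : Tendsto s l atTop := by
    refine (tendsto_rpow_atTop (by norm_num)).comp ?_
    simp_rw [mul_assoc]
    exact hlim.const_mul_atTop hγ0
  refine tendstoInDistribution_of_tendsto_integral_exp (fun i => ?_) ?_ fun t => ?_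
  · refine aemeasurable_pi_lambda _ fun k => AEMeasurable.div_const ?_ _
    exact ((hN i).aemeasurable_compensatedIntegral
      (integrable_grainValue hd hC hC1 hF0 hmean (hρ0 i) (φ k))).congr
      (centredGrainField_ae_eq (hN i) hd hC hC1 hF0 hmean (hρ0 i) (φ k)).symm
  · exact aemeasurable_pi_lambda _ fun k => hW.gaussian.aemeasurable ⟨φ k, hφ' k⟩
  · rw [hW.integral_exp hd hC hCb hC1 hγ t hφ']
    refine Tendsto.congr (fun i => (integral_exp_sum_centredGrainField (hN i) hd hC hC1 hF0 hmean
      (hρ0 i) Finset.univ t φ (s i)).symm) ?_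
    refine (Complex.continuous_exp.tendsto _).comp ?_
    have hL2 : MemLp (grainValue C (∑ k, t k • φ k)) 2 (stableIntensity d γ) := by
      have e : grainValue C (∑ k, t k • φ k) = fun p => ∑ k, t k * grainValue C (φ k) p :=
        funext fun p => grainValue_sum _ _ _ p
      rw [e]
      exact memLp_finsetSum _ fun k _ => (memLp_grainValue hd hC hCb hC1 hγ (hφ' k)).const_mul _
    have key := tendsto_integral_grainIntensity hd hC hCb hC1 hCf hF hF0 hmean hγ
      (γ' := 2 - α) (by linarith)
      (hasSquareGrowth_sum hd hC hCb hC1 (by linarith) Finset.univ t φ hφ) hL2 hlam0 hρ0 hρ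
      -- Since s² = γ λ F̄_ρ(1), multiplying Ψ(y/s) by s² offsets the prefactor in the cumulant
      -- limit up to γ, which is cancelled next.
      (h := fun i y => ((s i ^ 2 : ℝ) : ℂ) * compExp (y / s i))
      (h₀ := fun y => (-(y ^ 2 / 2 : ℝ) : ℂ))
      (fun i => by have := continuous_compExp; fun_prop) (fun i y => ?_) (by fun_prop)
      (fun y => ?_) (fun y y₀ hy => tendsto_sq_mul_compExp_div hsT hy)
    · have := key.const_smul γ⁻¹
      rw [inv_smul_smul₀ hγ0.ne'] at this
      refine this.congr fun i => ?_
      rw [integral_const_mul, smul_smul, ← mul_inv, ← hs2, Complex.real_smul, ← mul_assoc,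
        ← Complex.ofReal_mul, inv_mul_cancel₀ (pow_pos (hs0 i) 2).ne', Complex.ofReal_one, one_mul]
    · rw [norm_mul, Complex.norm_real, Real.norm_of_nonneg (sq_nonneg _)]
      have := mul_le_mul_of_nonneg_left (norm_compExp_le_sq (y / s i)) (sq_nonneg (s i))
      refine this.trans (le_of_eq ?_)
      have := (hs0 i).ne'
      field_simp
    · rw [norm_neg, Complex.norm_real, Real.norm_of_nonneg (by positivity)]

/-! ### Intermediate scaling -/

lemma IsCentredPoissonIntegral.congr {S Ω : Type*} [MeasurableSpace S] [MeasurableSpace Ω]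
    {N : Ω → Measure S} {η : Measure S} {P : Measure Ω} {f f' : S → ℝ} {X : Ω → ℝ}
    (h : IsCentredPoissonIntegral N η P f X) (hf : f =ᵐ[η] f') :
    IsCentredPoissonIntegral N η P f' X := by
  refine ⟨h.1, fun g hg hgi hb hlim => h.2 g hg hgi (fun n => ?_) ?_⟩
  · filter_upwards [hb n, hf] with s h1 h2
    rwa [h2]
  · filter_upwards [hlim, hf] with s h1 h2
    rwa [h2]

lemma grain_ae_eq (φ : SignedMeasure (EuclideanSpace ℝ (Fin d))) :
    (fun p : EuclideanSpace ℝ (Fin d) × ℝ => φ (grain C p.1 p.2)) =ᵐ[stableIntensity d γ]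
      grainValue C φ := by
  filter_upwards [ae_stableIntensity_pos] with p hp
  exact grainValue_eq φ p.1 hp

theorem exists_isCentredPoissonIntegral (hd : 0 < d) (hC : MeasurableSet C)
    (hCb : Bornology.IsBounded C) (hC1 : volume C ≤ 1) (hγ : 1 < γ)
    {Ω : Type*} [MeasurableSpace Ω] {Q : Measure Ω} [IsProbabilityMeasure Q]
    {N : Ω → Measure (EuclideanSpace ℝ (Fin d) × ℝ)}
    (hN : IsPoissonRandomMeasure N (stableIntensity d γ) Q)
    {φ : SignedMeasure (EuclideanSpace ℝ (Fin d))} (hφ : φ ∈ rieszSpace d (2 - γ)) :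
    ∃ X : Ω → ℝ, IsCentredPoissonIntegral N (stableIntensity d γ) Q
      (fun p => φ (grain C p.1 p.2)) X := by
  obtain ⟨X, hX⟩ := hN.exists_isL2CompensatedIntegral (memLp_grainValue hd hC hCb hC1 hγ hφ)
  exact ⟨X, (hX.isCentredPoissonIntegral hN).congr (grain_ae_eq φ).symm⟩

lemma isCentredPoissonIntegral_centredPoissonIntegral {S Ω : Type*} [MeasurableSpace S]
    [MeasurableSpace Ω] {N : Ω → Measure S} {η : Measure S} {P : Measure Ω} {f : S → ℝ}
    (h : ∃ X, IsCentredPoissonIntegral N η P f X) :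
    IsCentredPoissonIntegral N η P f (centredPoissonIntegral N η P f) := by
  rw [centredPoissonIntegral, dif_pos h]
  exact h.choose_spec

/-- Homogeneity of v^{-γ-1} dv: the change of variables v ↦ cv produces c^{γ+1} from the density and
c^{-1} from Lebesgue measure. -/
lemma map_mul_withDensity_rpow {c : ℝ} (hc : 0 < c) :
    ((volume.restrict (Ioi (0 : ℝ))).withDensity fun v => ENNReal.ofReal (v ^ (-γ - 1))).map
        (fun v => c * v) =
      ENNReal.ofReal (c ^ γ) •
        (volume.restrict (Ioi (0 : ℝ))).withDensity fun v => ENNReal.ofReal (v ^ (-γ - 1)) := by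
  have hw : Measurable fun v : ℝ => ENNReal.ofReal (v ^ (-γ - 1)) := by fun_prop
  refine Measure.ext fun A hA => ?_
  have hA' : MeasurableSet ((fun v => c * v) ⁻¹' A) := measurable_const_mul c hA
  rw [Measure.map_apply (measurable_const_mul c) hA, Measure.smul_apply, withDensity_apply _ hA',
    withDensity_apply _ hA, Measure.restrict_restrict hA', Measure.restrict_restrict hA,
    ← lintegral_indicator (hA.inter measurableSet_Ioi),
    ← lintegral_indicator (hA'.inter measurableSet_Ioi)]
  have hG : Measurable ((A ∩ Ioi 0).indicator fun v : ℝ => ENNReal.ofReal (v ^ (-γ - 1))) :=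
    hw.indicator (hA.inter measurableSet_Ioi)
  conv_rhs => rw [← Real.smul_map_volume_mul_left hc.ne']
  rw [lintegral_smul_measure, lintegral_map hG (measurable_const_mul c), smul_eq_mul, smul_eq_mul,
    ← mul_assoc, ← ENNReal.ofReal_mul (by positivity), abs_of_pos hc, ← Real.rpow_add_one hc.ne',
    ← lintegral_const_mul' _ _ ENNReal.ofReal_ne_top]
  refine lintegral_congr fun v => ?_
  by_cases hv : v ∈ (fun v => c * v) ⁻¹' A ∩ Ioi 0
  · have hv0 : 0 < v := hv.2
    have hcv : c * v ∈ A ∩ Ioi 0 := ⟨hv.1, mul_pos hc hv0⟩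
    rw [indicator_of_mem hv, indicator_of_mem hcv, ← ENNReal.ofReal_mul (by positivity),
      Real.mul_rpow hc.le hv0.le, ← mul_assoc, ← Real.rpow_add hc]
    have : γ + 1 + (-γ - 1) = 0 := by ring
    rw [this, Real.rpow_zero, one_mul]
  · have hcv : c * v ∉ A ∩ Ioi 0 := by
      intro h
      exact hv ⟨h.1, (pos_iff_pos_of_mul_pos h.2).1 hc⟩
    rw [indicator_of_notMem hv, indicator_of_notMem hcv, mul_zero]

/-- The stable intensity is self-similar. -/
lemma map_stableIntensity {s : ℝ} (hs : 0 < s) :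
    (stableIntensity d γ).map (fun p => (s • p.1, s ^ d * p.2)) =
      ENNReal.ofReal (s ^ ((γ - 1) * d)) • stableIntensity d γ := by
  have h := Measure.map_prod_map (volume : Measure (EuclideanSpace ℝ (Fin d)))
    ((volume.restrict (Ioi (0 : ℝ))).withDensity fun v => ENNReal.ofReal (v ^ (-γ - 1)))
    (f := fun x => s • x) (g := fun v => s ^ d * v) (measurable_const_smul s)
    (measurable_const_mul _)
  rw [map_mul_withDensity_rpow (pow_pos hs d), Measure.map_addHaar_smul _ hs.ne'] at h
  refine h.symm.trans ?_
  -- The factor s^{-d} comes from Lebesgue measure and (s^d)^γ from the volume variable.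
  rw [Measure.prod_smul_left, Measure.prod_smul_right, smul_smul, stableIntensity,
    ← ENNReal.ofReal_mul (by positivity), finrank_euclideanSpace_fin, abs_of_pos (by positivity)]
  congr 2
  rw [← Real.rpow_natCast, ← Real.rpow_mul hs.le, ← Real.rpow_neg hs.le, ← Real.rpow_add hs]
  congr 1
  ring

/-- This is s(x + v^{1/d} C) = sx + (s^d v)^{1/d} C. -/
lemma grainValue_dilate (hd : 0 < d) (hC : MeasurableSet C)
    (φ : SignedMeasure (EuclideanSpace ℝ (Fin d))) {s : ℝ} (hs : 0 < s)
    (x : EuclideanSpace ℝ (Fin d)) {v : ℝ} (hv : 0 < v) :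
    grainValue C (dilate s φ) (x, v) = grainValue C φ (s • x, s ^ d * v) := by
  have hm : Measurable fun y : EuclideanSpace ℝ (Fin d) => s⁻¹ • y := measurable_const_smul _
  rw [grainValue, dilate, VectorMeasure.map_apply _ hm (measurableSet_grainSection hC x v),
    grainValue]
  congr 1
  ext y
  simp only [mem_preimage, mem_ofPred_eq]
  have e : (s ^ d * v) ^ (-(1 / (d : ℝ))) = v ^ (-(1 / (d : ℝ))) * s⁻¹ := by
    rw [Real.mul_rpow (by positivity) hv.le, ← Real.rpow_natCast, ← Real.rpow_mul hs.le]
    have : (d : ℝ) * -(1 / d) = -1 := by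
      have : (d : ℝ) ≠ 0 := by positivity
      field_simp
    rw [this, Real.rpow_neg_one, mul_comm]
  rw [e, mul_smul, smul_sub s⁻¹ y, inv_smul_smul₀ hs.ne']

/-- The exponent converges to γσ₀ ∫∫ Ψ(φ). The dilation s is chosen with s^{(γ-1)d} = γσ₀, so
self-similarity of the intensity turns this into the exponent of J* at the dilated measure. -/
theorem tendstoFDD_intermediate (hd : 0 < d) (hC : MeasurableSet C)
    (hCb : Bornology.IsBounded C) (hC1 : volume C ≤ 1) (hCf : volume (frontier C) = 0)
    {F : Measure ℝ} [IsProbabilityMeasure F] (hF : HasRegularlyVaryingTail F γ)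
    (hF0 : F (Iic 0) = 0) (hmean : ∫ v, v ∂F = 1) (hγ : 1 < γ) {α : ℝ} (hα : α < 2 - γ)
    {ι : Type*} {l : Filter ι} [l.IsCountablyGenerated] {lam ρ : ι → ℝ} (hlam0 : ∀ i, 0 < lam i)
    (hρ0 : ∀ i, 0 < ρ i) (hρ : Tendsto ρ l (𝓝 0)) {Ω : ι → Type*} [∀ i, MeasurableSpace (Ω i)]
    {P : (i : ι) → Measure (Ω i)} [∀ i, IsProbabilityMeasure (P i)]
    {N : (i : ι) → Ω i → Measure (EuclideanSpace ℝ (Fin d) × ℝ)}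
    (hN : ∀ i, IsPoissonRandomMeasure (N i) (grainIntensity d F (lam i) (ρ i)) (P i))
    {σ₀ : ℝ} (hσ₀ : 0 < σ₀)
    (hlim : Tendsto (fun i => lam i * tail (scaledLaw F (ρ i)) 1) l (𝓝 σ₀))
    {Ω' : Type*} [MeasurableSpace Ω'] {Q : Measure Ω'} [IsProbabilityMeasure Q]
    {Nγ : Ω' → Measure (EuclideanSpace ℝ (Fin d) × ℝ)}
    (hNγ : IsPoissonRandomMeasure Nγ (stableIntensity d γ) Q) :
    TendstoFDD (rieszSpace d α) (fun i φ ω => centredGrainField C (N i) (P i) φ ω) l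
      (fun φ => intermediateField γ C Nγ Q (dilate ((γ * σ₀) ^ (1 / ((γ - 1) * d))) φ)) P Q := by
  intro n φ hφ
  have hφ' : ∀ k, φ k ∈ rieszSpace d (2 - γ) := fun k =>
    rieszSpace_subset_rieszSpace hα.le (by linarith) (hφ k)
  have hγ0 : 0 < γ := by linarith
  have hd' : (0 : ℝ) < d := by exact_mod_cast hd
  set s : ℝ := (γ * σ₀) ^ (1 / ((γ - 1) * d)) with hs
  have hs0 : 0 < s := by positivity
  have hspow : s ^ ((γ - 1) * d) = γ * σ₀ := by
    have : (γ - 1) * d ≠ 0 := (mul_pos (by linarith) hd').ne'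
    rw [hs, ← Real.rpow_mul (by positivity), one_div_mul_cancel this, Real.rpow_one]
  have hTm : Measurable fun p : EuclideanSpace ℝ (Fin d) × ℝ => (s • p.1, s ^ d * p.2) := by
    fun_prop
  -- Square integrability for the dilated measure is obtained by change of variables from that for
  -- φ, so its Riesz energy is not needed.
  have hmemT : ∀ k, MemLp (fun p : EuclideanSpace ℝ (Fin d) × ℝ =>
      grainValue C (φ k) (s • p.1, s ^ d * p.2)) 2 (stableIntensity d γ) := by
    intro k
    have h := (memLp_grainValue hd hC hCb hC1 hγ (hφ' k)).smul_measure
      (c := ENNReal.ofReal (s ^ ((γ - 1) * d))) ENNReal.ofReal_ne_top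
    rw [← map_stableIntensity hs0] at h
    exact h.comp_of_map hTm.aemeasurable
  have hae : ∀ k, (fun p : EuclideanSpace ℝ (Fin d) × ℝ => dilate s (φ k) (grain C p.1 p.2))
      =ᵐ[stableIntensity d γ] fun p => grainValue C (φ k) (s • p.1, s ^ d * p.2) := by
    intro k
    filter_upwards [grain_ae_eq (C := C) (γ := γ) (dilate s (φ k)), ae_stableIntensity_pos] with p h1 hp
    rw [h1]
    exact grainValue_dilate hd hC (φ k) hs0 p.1 hp
  -- Identifies the chosen random variables with L² integrals, for which linearity and the
  -- characteristic function are known.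
  have hX : ∀ k, IsL2CompensatedIntegral Nγ (stableIntensity d γ) Q
      (fun p => grainValue C (φ k) (s • p.1, s ^ d * p.2))
      (intermediateField γ C Nγ Q (dilate s (φ k))) := by
    intro k
    refine IsL2CompensatedIntegral.of_isCentredPoissonIntegral hNγ (hmemT k) ?_
    refine IsCentredPoissonIntegral.congr ?_ (hae k)
    refine isCentredPoissonIntegral_centredPoissonIntegral ?_
    obtain ⟨X, hX⟩ := hNγ.exists_isL2CompensatedIntegral (hmemT k)
    exact ⟨X, (hX.isCentredPoissonIntegral hNγ).congr (hae k).symm⟩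
  refine tendstoInDistribution_of_tendsto_integral_exp (fun i => ?_) ?_ fun t => ?_
  · refine aemeasurable_pi_lambda _ fun k => ?_
    exact ((hN i).aemeasurable_compensatedIntegral
      (integrable_grainValue hd hC hC1 hF0 hmean (hρ0 i) (φ k))).congr
      (centredGrainField_ae_eq (hN i) hd hC hC1 hF0 hmean (hρ0 i) (φ k)).symm
  · exact aemeasurable_pi_lambda _ fun k => (hX k).aemeasurable
  · have hL2 : MemLp (grainValue C (∑ k, t k • φ k)) 2 (stableIntensity d γ) := by
      have e : grainValue C (∑ k, t k • φ k) = fun p => ∑ k, t k * grainValue C (φ k) p :=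
        funext fun p => grainValue_sum _ _ _ p
      rw [e]
      exact memLp_finsetSum _ fun k _ => (memLp_grainValue hd hC hCb hC1 hγ (hφ' k)).const_mul _
    have hlimit : ∫ ω, Complex.exp ((∑ k, t k *
        intermediateField γ C Nγ Q (dilate s (φ k)) ω : ℝ) * Complex.I) ∂Q =
        Complex.exp ((γ * σ₀) •
          ∫ p, compExp (grainValue C (∑ k, t k • φ k) p) ∂(stableIntensity d γ)) := by
      have hsum := IsL2CompensatedIntegral.sum hNγ Finset.univ
        (fun k _ => (hX k).const_smul hNγ (t k))
      have h := hsum.integral_exp hNγ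
      simp only [Finset.sum_apply, Pi.smul_apply, smul_eq_mul] at h
      rw [h]
      congr 1
      simp_rw [← grainValue_sum]
      have hmc : AEStronglyMeasurable (fun p => compExp (grainValue C (∑ k, t k • φ k) p))
          ((stableIntensity d γ).map fun p => (s • p.1, s ^ d * p.2)) :=
        (continuous_compExp.measurable.comp (measurable_grainValue hC _)).aestronglyMeasurable
      rw [← integral_map (f := fun p => compExp (grainValue C (∑ k, t k • φ k) p))
        hTm.aemeasurable hmc, map_stableIntensity hs0, integral_smul_measure, hspow,
        ENNReal.toReal_ofReal (by positivity)]
    rw [hlimit]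
    have hpre : ∀ i, ∫ ω, Complex.exp ((∑ k, t k *
        centredGrainField C (N i) (P i) (φ k) ω : ℝ) * Complex.I) ∂(P i) =
        Complex.exp (∫ p, compExp (grainValue C (∑ k, t k • φ k) p)
          ∂(grainIntensity d F (lam i) (ρ i))) := by
      intro i
      have := integral_exp_sum_centredGrainField (hN i) hd hC hC1 hF0 hmean (hρ0 i)
        Finset.univ t φ 1
      simpa only [div_one] using this
    simp_rw [hpre]
    refine (Complex.continuous_exp.tendsto _).comp ?_
    have key := tendsto_integral_grainIntensity hd hC hCb hC1 hCf hF hF0 hmean hγ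
      (γ' := 2 - α) (by linarith)
      (hasSquareGrowth_sum hd hC hCb hC1 (by linarith) Finset.univ t φ hφ) hL2 hlam0 hρ0 hρ
      (h := fun _ => compExp) (h₀ := compExp) (fun _ => continuous_compExp)
      (fun _ => norm_compExp_le_sq) continuous_compExp norm_compExp_le_sq
      (fun y y₀ hy => (continuous_compExp.tendsto _).comp hy)
    have := hlim.smul key
    rw [smul_smul, mul_comm σ₀] at this
    refine this.congr fun i => ?_
    have hT : 0 < tail (scaledLaw F (ρ i)) 1 := by
      rw [tail_scaledLaw (hρ0 i)]; exact hF.tail_pos _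
    rw [smul_inv_smul₀ (mul_pos (hlam0 i) hT).ne']

end Scaling

/-! ### Grain values of absolutely continuous measures -/

section Density

variable {d : ℕ} {C : Set (EuclideanSpace ℝ (Fin d))}

lemma volume_grainSection (hd : 0 < d) (hC : MeasurableSet C) (x : EuclideanSpace ℝ (Fin d))
    {v : ℝ} (hv : 0 < v) :
    volume {y | v ^ (-(1 / (d : ℝ))) • (y - x) ∈ C} = ENNReal.ofReal v * volume C := by
  have hr0 : 0 < v ^ (-(1 / (d : ℝ))) := Real.rpow_pos_of_pos hv _
  have hset : {y | v ^ (-(1 / (d : ℝ))) • (y - x) ∈ C} =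
      (fun y => y - x) ⁻¹' ((fun y => v ^ (-(1 / (d : ℝ))) • y) ⁻¹' C) := rfl
  rw [hset, (measurePreserving_sub_right volume x).measure_preimage
    ((measurable_const_smul _) hC).nullMeasurableSet, Measure.addHaar_preimage_smul _ hr0.ne']
  congr 2
  rw [finrank_euclideanSpace_fin, ← Real.rpow_natCast, ← Real.rpow_mul hv.le]
  have : -(1 / (d : ℝ)) * d = -1 := by
    have : (d : ℝ) ≠ 0 := by positivity
    field_simp
  rw [this, Real.rpow_neg_one, inv_inv, abs_of_pos hv]

lemma grainValue_withDensityᵥ (hC : MeasurableSet C) {ψ : EuclideanSpace ℝ (Fin d) → ℝ}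
    (hψ : Integrable ψ) (x : EuclideanSpace ℝ (Fin d)) (v : ℝ) :
    grainValue C (volume.withDensityᵥ ψ) (x, v) =
      ∫ y in {y | v ^ (-(1 / (d : ℝ))) • (y - x) ∈ C}, ψ y := by
  rw [grainValue, withDensityᵥ_apply hψ (measurableSet_grainSection hC x v)]

/-- Cauchy–Schwarz on a grain of volume at most v gives one factor v, and Fubini over the centre,
applied to the measure ψ² dx, gives the other. The growth v² beats v^γ. -/
lemma lintegral_sq_grainValue_withDensityᵥ_le (hd : 0 < d) (hC : MeasurableSet C)
    (hC1 : volume C ≤ 1) {ψ : EuclideanSpace ℝ (Fin d) → ℝ} (hψm : Measurable ψ)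
    (hψ : Integrable ψ) {v : ℝ} (hv : 0 < v) :
    ∫⁻ x, ‖grainValue C (volume.withDensityᵥ ψ) (x, v)‖ₑ ^ 2 ≤
      ENNReal.ofReal (v ^ 2) * ∫⁻ x, ‖ψ x‖ₑ ^ 2 := by
  set m : Measure (EuclideanSpace ℝ (Fin d)) := volume.withDensity fun x => ‖ψ x‖ₑ ^ 2 with hm
  have hvol : ∀ x, volume {y | v ^ (-(1 / (d : ℝ))) • (y - x) ∈ C} ≤ ENNReal.ofReal v := by
    intro x
    rw [volume_grainSection hd hC x hv]
    calc ENNReal.ofReal v * volume C ≤ ENNReal.ofReal v * 1 := by gcongr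
      _ = _ := mul_one _
  have hpt : ∀ x, ‖grainValue C (volume.withDensityᵥ ψ) (x, v)‖ₑ ^ 2 ≤
      ENNReal.ofReal v * grainMass C m (x, v) := by
    intro x
    set A : Set (EuclideanSpace ℝ (Fin d)) := {y | v ^ (-(1 / (d : ℝ))) • (y - x) ∈ C} with hA
    have hAm : MeasurableSet A := measurableSet_grainSection hC x v
    have h1 : ‖grainValue C (volume.withDensityᵥ ψ) (x, v)‖ₑ ≤
        eLpNorm ψ 2 (volume.restrict A) * volume A ^ (1 / 2 : ℝ) := by
      rw [grainValue_withDensityᵥ hC hψ]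
      refine (enorm_integral_le_lintegral_enorm _).trans ?_
      rw [← eLpNorm_one_eq_lintegral_enorm]
      refine (eLpNorm_le_eLpNorm_mul_rpow_measure_univ (q := 2) (by norm_num)
        hψm.aestronglyMeasurable).trans (le_of_eq ?_)
      have he : 1 / (1 : ℝ≥0∞).toReal - 1 / (2 : ℝ≥0∞).toReal = 1 / 2 := by norm_num
      rw [Measure.restrict_apply_univ, he]
    have h2 : grainMass C m (x, v) = ∫⁻ y in A, ‖ψ y‖ₑ ^ 2 := withDensity_apply _ hAm
    calc ‖grainValue C (volume.withDensityᵥ ψ) (x, v)‖ₑ ^ 2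
        ≤ (eLpNorm ψ 2 (volume.restrict A) * volume A ^ (1 / 2 : ℝ)) ^ 2 :=
          pow_le_pow_left₀ zero_le h1 2
      _ = volume A * ∫⁻ y in A, ‖ψ y‖ₑ ^ 2 := by
          rw [eLpNorm_two_eq, mul_pow, ← ENNReal.rpow_natCast, ← ENNReal.rpow_natCast,
            ← ENNReal.rpow_mul, ← ENNReal.rpow_mul]
          norm_num
          rw [mul_comm]
      _ ≤ ENNReal.ofReal v * grainMass C m (x, v) := by
          rw [h2]; gcongr; exact hvol x
  have hmm : Measurable fun x => grainMass C m (x, v) :=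
    (measurable_grainMass hC m).comp measurable_prodMk_right
  refine (lintegral_mono hpt).trans ?_
  rw [lintegral_const_mul _ hmm, lintegral_grainMass hd hC m hv, hm,
    withDensity_apply _ MeasurableSet.univ, Measure.restrict_univ, pow_two,
    ENNReal.ofReal_mul hv.le]
  rw [← mul_assoc]
  gcongr
  calc ENNReal.ofReal v * volume C ≤ ENNReal.ofReal v * 1 := by gcongr
      _ = _ := mul_one _

/-- Continuity of translation in `L¹`. -/
lemma tendsto_lintegral_translate_sub {ψ : EuclideanSpace ℝ (Fin d) → ℝ} (hψ : Integrable ψ) :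
    Tendsto (fun h => ∫⁻ x, ‖ψ (h + x) - ψ x‖ₑ) (𝓝 0) (𝓝 0) := by
  have : Fact ((1 : ℝ≥0∞) ≠ ∞) := ⟨ENNReal.one_ne_top⟩
  have hψ1 : MemLp ψ 1 volume := memLp_one_iff_integrable.2 hψ
  have hc : Continuous fun h : EuclideanSpace ℝ (Fin d) =>
      (DomAddAct.mk h +ᵥ hψ1.toLp : Lp ℝ 1 volume) := by
    have h1 : Continuous fun h : EuclideanSpace ℝ (Fin d) => DomAddAct.mk h :=
      DomAddAct.continuous_mk
    exact h1.vadd continuous_const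
  have h0 := tendsto_iff_edist_tendsto_0.1 (hc.tendsto 0)
  have e0 : (DomAddAct.mk (0 : EuclideanSpace ℝ (Fin d)) +ᵥ hψ1.toLp : Lp ℝ 1 volume) =
      hψ1.toLp := by
    rw [DomAddAct.mk_zero, zero_vadd]
  rw [e0] at h0
  refine h0.congr fun h => ?_
  rw [DomAddAct.mk_vadd_toLp, Lp.edist_toLp_toLp, eLpNorm_one_eq_lintegral_enorm]
  rfl

/-- Averages of an integrable function over small grains converge in `L¹`. -/
lemma lintegral_grainValue_sub_le (hd : 0 < d) (hC : MeasurableSet C) (hC1 : volume C = 1)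
    {R : ℝ} (hR : C ⊆ Metric.closedBall 0 R)
    {ψ : EuclideanSpace ℝ (Fin d) → ℝ} (hψm : Measurable ψ) (hψ : Integrable ψ) {v : ℝ}
    (hv : 0 < v) {ε : ℝ≥0∞} (hε : ∀ h : EuclideanSpace ℝ (Fin d), ‖h‖ ≤ R * v ^ (1 / (d : ℝ)) →
      ∫⁻ x, ‖ψ (h + x) - ψ x‖ₑ ≤ ε) :
    ∫⁻ x, ‖grainValue C (volume.withDensityᵥ ψ) (x, v) - v * ψ x‖ₑ ≤ ENNReal.ofReal v * ε := by
  have hp : (0 : ℝ) < v ^ (1 / (d : ℝ)) := Real.rpow_pos_of_pos hv _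
  set B : Set (EuclideanSpace ℝ (Fin d)) := {h | v ^ (-(1 / (d : ℝ))) • h ∈ C} with hB
  have hBm : MeasurableSet B := measurable_const_smul _ hC
  have hBvol : volume B = ENNReal.ofReal v := by
    have := volume_grainSection hd hC 0 hv
    simp only [sub_zero, hC1, mul_one] at this
    exact this
  have hBn : ∀ h ∈ B, ‖h‖ ≤ R * v ^ (1 / (d : ℝ)) := by
    intro h hh
    have h1 := mem_closedBall_zero_iff.1 (hR hh)
    rw [norm_smul, Real.rpow_neg hv.le, norm_inv, Real.norm_of_nonneg hp.le,
      inv_mul_le_iff₀ hp] at h1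
    linarith
  have hpt : ∀ x, ‖grainValue C (volume.withDensityᵥ ψ) (x, v) - v * ψ x‖ₑ ≤
      ∫⁻ h in B, ‖ψ (h + x) - ψ x‖ₑ := by
    intro x
    have hAm := measurableSet_grainSection hC x v
    have hAv := volume_grainSection hd hC x hv
    rw [hC1, mul_one] at hAv
    have hAr : volume.real {y | v ^ (-(1 / (d : ℝ))) • (y - x) ∈ C} = v := by
      rw [measureReal_def, hAv, ENNReal.toReal_ofReal hv.le]
    -- Because |C| = 1 the grain has volume exactly v, so vψ(x) can be put inside the integral.
    have e1 : grainValue C (volume.withDensityᵥ ψ) (x, v) - v * ψ x =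
        ∫ y in {y | v ^ (-(1 / (d : ℝ))) • (y - x) ∈ C}, (ψ y - ψ x) := by
      rw [integral_sub hψ.integrableOn, setIntegral_const, hAr, grainValue_withDensityᵥ hC hψ,
        smul_eq_mul]
      rw [integrable_const_iff, isFiniteMeasure_restrict]
      exact Or.inr (by rw [hAv]; exact ENNReal.ofReal_ne_top)
    rw [e1]
    refine (enorm_integral_le_lintegral_enorm _).trans (le_of_eq ?_)
    rw [← lintegral_indicator hAm, ← lintegral_indicator hBm,
      ← lintegral_add_right_eq_self (fun y => indicator _ _ y) x]
    refine lintegral_congr fun h => ?_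
    have hiff : h + x ∈ {y | v ^ (-(1 / (d : ℝ))) • (y - x) ∈ C} ↔ h ∈ B := by
      rw [hB, mem_ofPred_eq, mem_ofPred_eq, add_sub_cancel_right]
    by_cases hh : h ∈ B
    · rw [indicator_of_mem hh, indicator_of_mem (hiff.2 hh)]
    · rw [indicator_of_notMem hh, indicator_of_notMem (mt hiff.1 hh)]
  refine (lintegral_mono hpt).trans ?_
  rw [lintegral_lintegral_swap]
  · calc ∫⁻ h in B, ∫⁻ x, ‖ψ (h + x) - ψ x‖ₑ ≤ ∫⁻ _ in B, ε :=
          setLIntegral_mono measurable_const fun h hh => hε h (hBn h hh)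
      _ = ENNReal.ofReal v * ε := by
          rw [setLIntegral_const, hBvol, mul_comm]
  · have : Measurable fun q : EuclideanSpace ℝ (Fin d) × EuclideanSpace ℝ (Fin d) =>
        ‖ψ (q.2 + q.1) - ψ q.1‖ₑ := by fun_prop
    exact this.aemeasurable

/-- As v → 0 the grain lies within distance R v^{1/d} of its centre, and translations are continuous
in L¹. The error is thus o(v). -/
lemma tendsto_lintegral_grainValue_sub (hd : 0 < d) (hC : MeasurableSet C)
    (hCb : Bornology.IsBounded C) (hC1 : volume C = 1)
    {ψ : EuclideanSpace ℝ (Fin d) → ℝ} (hψm : Measurable ψ) (hψ : Integrable ψ)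
    {ι : Type*} {l : Filter ι} {v : ι → ℝ} (hv : Tendsto v l (𝓝 0)) (hv0 : ∀ᶠ i in l, 0 < v i) :
    Tendsto (fun i => (ENNReal.ofReal (v i))⁻¹ *
      ∫⁻ x, ‖grainValue C (volume.withDensityᵥ ψ) (x, v i) - v i * ψ x‖ₑ) l (𝓝 0) := by
  obtain ⟨R, hR0, hR⟩ := exists_subset_closedBall hCb
  rw [ENNReal.tendsto_nhds_zero]
  intro ε hε
  have h1 := ENNReal.tendsto_nhds_zero.1 (tendsto_lintegral_translate_sub hψ) ε hε
  obtain ⟨δ, hδ, hball⟩ := Metric.eventually_nhds_iff.1 h1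
  have hd' : (0 : ℝ) < d := by exact_mod_cast hd
  have hlim : Tendsto (fun i => R * v i ^ (1 / (d : ℝ))) l (𝓝 0) := by
    have := (hv.rpow_const (p := 1 / (d : ℝ)) (Or.inr (by positivity))).const_mul R
    rwa [Real.zero_rpow (by positivity), mul_zero] at this
  filter_upwards [hlim.eventually (gt_mem_nhds hδ), hv0] with i hi hi0
  have h2 := lintegral_grainValue_sub_le hd hC hC1 hR hψm hψ hi0 (ε := ε) fun h hh =>
    hball (by rw [dist_zero_right]; exact hh.trans_lt hi)
  have hne : ENNReal.ofReal (v i) ≠ 0 := by simpa using hi0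
  calc _ ≤ (ENNReal.ofReal (v i))⁻¹ * (ENNReal.ofReal (v i) * ε) := by gcongr
    _ = ε := by rw [← mul_assoc, ENNReal.inv_mul_cancel hne ENNReal.ofReal_ne_top, one_mul]

end Density

/-! ### Small-grain scaling -/

section SmallGrain

variable {d : ℕ} {C : Set (EuclideanSpace ℝ (Fin d))} {γ : ℝ}

lemma enorm_integral_compExp_sub_le {α : Type*} [MeasurableSpace α] {μ : Measure α} {a b : α → ℝ}
    (ha : Integrable a μ) (hb : Integrable b μ) :
    ‖(∫ x, compExp (a x) ∂μ) - ∫ x, compExp (b x) ∂μ‖ₑ ≤ 2 * ∫⁻ x, ‖a x - b x‖ₑ ∂μ := by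
  rw [← integral_sub (integrable_compExp ha) (integrable_compExp hb),
    ← lintegral_const_mul' _ _ (by simp)]
  refine (enorm_integral_le_lintegral_enorm _).trans (lintegral_mono fun x => ?_)
  rw [← ofReal_norm, ← ofReal_norm]
  refine (ENNReal.ofReal_le_ofReal (norm_compExp_sub_le _ _)).trans (le_of_eq ?_)
  rw [ENNReal.ofReal_mul zero_le_two, ENNReal.ofReal_ofNat, Real.norm_eq_abs]

lemma integrable_grainValue_left (hd : 0 < d) (hC : MeasurableSet C) (hC1 : volume C ≤ 1)
    (φ : SignedMeasure (EuclideanSpace ℝ (Fin d))) {v : ℝ} (hv : 0 < v) :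
    Integrable fun x => grainValue C φ (x, v) :=
  ⟨((measurable_grainValue hC φ).comp measurable_prodMk_right).aestronglyMeasurable,
    (lintegral_grainValue_le hd hC hC1 φ hv).trans_lt
      (ENNReal.mul_lt_top ENNReal.ofReal_lt_top (measure_lt_top _ _))⟩

/-- Linear growth, for large volumes; the next lemma gives the quadratic growth for small ones. Both
depend on v/b only, hence are uniform once v and b are scaled by the same β. -/
lemma norm_integral_compExp_grainValue_le (hd : 0 < d) (hC : MeasurableSet C) (hC1 : volume C ≤ 1)
    (φ : SignedMeasure (EuclideanSpace ℝ (Fin d))) {b v : ℝ} (hb : 0 < b) (hv : 0 < v) :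
    ‖∫ x, compExp (grainValue C φ (x, v) / b)‖ ≤
      2 * (v / b * (φ.totalVariation univ).toReal) := by
  have h1 := enorm_integral_compExp_sub_le (μ := volume) (b := fun _ => 0)
    ((integrable_grainValue_left hd hC hC1 φ hv).div_const b) (integrable_zero _ ℝ volume)
  simp only [compExp_zero, integral_zero, sub_zero] at h1
  have h2 : ∫⁻ x, ‖grainValue C φ (x, v) / b‖ₑ ≤
      ENNReal.ofReal (v / b * (φ.totalVariation univ).toReal) := by
    have e : ∀ x, ‖grainValue C φ (x, v) / b‖ₑ =
        ENNReal.ofReal b⁻¹ * ‖grainValue C φ (x, v)‖ₑ := by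
      intro x
      rw [div_eq_inv_mul, enorm_mul, Real.enorm_of_nonneg (inv_nonneg.2 hb.le)]
    simp_rw [e]
    rw [lintegral_const_mul' _ _ ENNReal.ofReal_ne_top, div_eq_inv_mul,
      ENNReal.ofReal_mul (by positivity), ENNReal.ofReal_mul (by positivity),
      ENNReal.ofReal_toReal (measure_ne_top _ _), mul_assoc]
    gcongr
    exact lintegral_grainValue_le hd hC hC1 φ hv
  have h3 := h1.trans (mul_le_mul_right h2 2)
  have e2 : ∀ y : ℝ, (2 : ℝ≥0∞) * ENNReal.ofReal y = ENNReal.ofReal (2 * y) := fun y => by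
    rw [ENNReal.ofReal_mul zero_le_two, ENNReal.ofReal_ofNat]
  rw [← ofReal_norm, e2] at h3
  exact (ENNReal.ofReal_le_ofReal_iff (by positivity)).1 h3

lemma norm_integral_compExp_grainValue_withDensityᵥ_le (hd : 0 < d) (hC : MeasurableSet C)
    (hC1 : volume C ≤ 1) {ψ : EuclideanSpace ℝ (Fin d) → ℝ} (hψm : Measurable ψ)
    (hψ : Integrable ψ) (hψ2 : ∫⁻ x, ‖ψ x‖ₑ ^ 2 ≠ ∞) {b v : ℝ} (hv : 0 < v) :
    ‖∫ x, compExp (grainValue C (volume.withDensityᵥ ψ) (x, v) / b)‖ ≤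
      (v / b) ^ 2 * (∫⁻ x, ‖ψ x‖ₑ ^ 2).toReal := by
  refine norm_integral_comp_le norm_compExp_le_sq (by positivity) ?_
  have e : ∀ x, ‖grainValue C (volume.withDensityᵥ ψ) (x, v) / b‖ₑ ^ 2 =
      ENNReal.ofReal (b⁻¹ ^ 2) * ‖grainValue C (volume.withDensityᵥ ψ) (x, v)‖ₑ ^ 2 := by
    intro x
    rw [div_eq_inv_mul, enorm_mul, mul_pow, enorm_sq_eq_ofReal b⁻¹]
  simp_rw [e]
  rw [lintegral_const_mul' _ _ ENNReal.ofReal_ne_top, div_eq_inv_mul, mul_pow,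
    ENNReal.ofReal_mul (by positivity), ENNReal.ofReal_mul (by positivity),
    ENNReal.ofReal_toReal hψ2, mul_assoc]
  gcongr
  exact lintegral_sq_grainValue_withDensityᵥ_le hd hC hC1 hψm hψ hv

lemma tendsto_integral_compExp_grainValue_withDensityᵥ (hd : 0 < d) (hC : MeasurableSet C)
    (hCb : Bornology.IsBounded C) (hC1 : volume C = 1)
    {ψ : EuclideanSpace ℝ (Fin d) → ℝ} (hψm : Measurable ψ) (hψ : Integrable ψ) {c : ℝ}
    {ι : Type*} {l : Filter ι} {β : ι → ℝ} (hβ : Tendsto β l (𝓝 0))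
    (hβ0 : ∀ᶠ i in l, 0 < β i) {w : ι → ℝ} {w₀ : ℝ} (hw₀ : 0 < w₀) (hw : Tendsto w l (𝓝 w₀)) :
    Tendsto (fun i => ∫ x, compExp (grainValue C (volume.withDensityᵥ ψ) (x, β i * w i) /
        (c * β i))) l (𝓝 (∫ x, compExp (w₀ * (ψ x / c)))) := by
  have hv : Tendsto (fun i => β i * w i) l (𝓝 0) := by simpa using hβ.mul hw
  have hv0 : ∀ᶠ i in l, 0 < β i * w i := by
    filter_upwards [hβ0, hw.eventually (lt_mem_nhds hw₀)] with i h1 h2 using mul_pos h1 h2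
  have hD := tendsto_lintegral_grainValue_sub hd hC hCb hC1 hψm hψ hv hv0
  rw [tendsto_iff_edist_tendsto_0]
  -- One term measures the L¹ error of averaging ψ over small grains, the other the drift of w to
  -- w₀. The factor 2 is the Lipschitz constant of Ψ.
  have hb : Tendsto (fun i => 2 * (‖w i / c‖ₑ * ((ENNReal.ofReal (β i * w i))⁻¹ *
      ∫⁻ x, ‖grainValue C (volume.withDensityᵥ ψ) (x, β i * w i) - β i * w i * ψ x‖ₑ) +
      ‖(w i - w₀) / c‖ₑ * ∫⁻ x, ‖ψ x‖ₑ)) l (𝓝 0) := by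
    have t1 : Tendsto (fun i => ‖w i / c‖ₑ) l (𝓝 ‖w₀ / c‖ₑ) :=
      (continuous_enorm.tendsto _).comp (hw.div_const c)
    have t2 : Tendsto (fun i => ‖(w i - w₀) / c‖ₑ) l (𝓝 0) := by
      have h := (hw.sub_const w₀).div_const c
      rw [sub_self, zero_div] at h
      have := (continuous_enorm.tendsto (0 : ℝ)).comp h
      rwa [enorm_zero] at this
    have t3 := ENNReal.Tendsto.mul t1 (Or.inr ENNReal.zero_ne_top) hD (Or.inr enorm_ne_top)
    have t4 := ENNReal.Tendsto.mul_const (b := ∫⁻ x, ‖ψ x‖ₑ) t2 (Or.inr hψ.2.ne)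
    have := ENNReal.Tendsto.const_mul (a := 2) (t3.add t4) (Or.inr (by simp))
    simpa using this
  refine tendsto_of_tendsto_of_tendsto_of_le_of_le' tendsto_const_nhds hb
    (Eventually.of_forall fun _ => zero_le) ?_
  filter_upwards [hv0, hβ0] with i hi hi0
  have ha := (integrable_grainValue_left hd hC hC1.le (volume.withDensityᵥ ψ) hi).div_const
    (c * β i)
  have hb' : Integrable fun x => w₀ * (ψ x / c) := (hψ.div_const c).const_mul w₀
  rw [edist_eq_enorm_sub]
  refine (enorm_integral_compExp_sub_le ha hb').trans ?_
  gcongr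
  have hne : β i * w i ≠ 0 := hi.ne'
  have hpt : ∀ x, ‖grainValue C (volume.withDensityᵥ ψ) (x, β i * w i) / (c * β i) -
      w₀ * (ψ x / c)‖ₑ ≤ ‖w i / c‖ₑ * (ENNReal.ofReal (β i * w i))⁻¹ *
      ‖grainValue C (volume.withDensityᵥ ψ) (x, β i * w i) - β i * w i * ψ x‖ₑ +
      ‖(w i - w₀) / c‖ₑ * ‖ψ x‖ₑ := by
    intro x
    rw [← Real.enorm_of_nonneg hi.le, ← enorm_inv hne, ← enorm_mul, ← enorm_mul, ← enorm_mul]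
    refine le_trans (le_of_eq ?_) (enorm_add_le _ _)
    congr 1
    have h1 : β i ≠ 0 := hi0.ne'
    have h2 : w i ≠ 0 := right_ne_zero_of_mul hne
    by_cases hc : c = 0
    · simp [hc]
    · field_simp
      ring
  refine (lintegral_mono hpt).trans (le_of_eq ?_)
  have hm : Measurable fun x => ‖grainValue C (volume.withDensityᵥ ψ) (x, β i * w i) -
      β i * w i * ψ x‖ₑ :=
    (((measurable_grainValue hC _).comp measurable_prodMk_right).sub (hψm.const_mul _)).enorm
  rw [lintegral_add_left (hm.const_mul _), lintegral_const_mul _ hm,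
    lintegral_const_mul _ hψm.enorm, mul_assoc]

/-- Convergence of the cumulants of the grain field in the small-grain regime. -/
theorem tendsto_integral_smallGrain (hd : 0 < d) (hC : MeasurableSet C)
    (hCb : Bornology.IsBounded C) (hC1 : volume C = 1)
    {F : Measure ℝ} [IsProbabilityMeasure F] (hF : HasRegularlyVaryingTail F γ)
    (hF0 : F (Iic 0) = 0) (hmean : ∫ v, v ∂F = 1) (hγ : 1 < γ) (hγ2 : γ < 2) {c : ℝ} (hc : 0 < c)
    {ι : Type*} {l : Filter ι} [l.IsCountablyGenerated] {lam ρ : ι → ℝ} (hlam0 : ∀ i, 0 < lam i)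
    (hρ0 : ∀ i, 0 < ρ i) (hlam : Tendsto lam l atTop) (hρ : Tendsto ρ l (𝓝 0))
    (hlim : Tendsto (fun i => lam i * tail (scaledLaw F (ρ i)) 1) l (𝓝 0))
    {ψ : EuclideanSpace ℝ (Fin d) → ℝ} (hψm : Measurable ψ) (hψ : Integrable ψ)
    (hψ2 : ∫⁻ x, ‖ψ x‖ₑ ^ 2 ≠ ∞) :
    Tendsto (fun i => ∫ p, compExp (grainValue C (volume.withDensityᵥ ψ) p /
        (c * tailQuantile (scaledLaw F (ρ i)) (γ * lam i))) ∂(grainIntensity d F (lam i) (ρ i))) l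
      (𝓝 (∫ w in Ioi (0 : ℝ), w ^ (-γ - 1) • ∫ x, compExp (w * (ψ x / c)))) := by
  have hγ0 : 0 < γ := by linarith
  set φ : SignedMeasure (EuclideanSpace ℝ (Fin d)) := volume.withDensityᵥ ψ with hφ
  have hgl : Tendsto (fun i => γ * lam i) l atTop := hlam.const_mul_atTop hγ0
  -- Here x is the unscaled quantile at γλ and β = ρx the scaled one, i.e. the normalisation up to
  -- c. Volumes are measured in units of β, which tends to 0 in this regime.
  set x : ι → ℝ := fun i => tailQuantile F (γ * lam i) with hxdef
  have hx : Tendsto x l atTop := hF.tendsto_tailQuantile_atTop.comp hgl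
  set β : ι → ℝ := fun i => ρ i * x i with hβdef
  have hβ : Tendsto β l (𝓝 0) := by
    refine hF.tendsto_mul_tailQuantile_zero hγ0 hρ0 hlam hρ (hlim.congr fun i => ?_)
    rw [tail_scaledLaw (hρ0 i)]
  have hx0 : ∀ᶠ i in l, 0 < x i := hx.eventually_gt_atTop 0
  have hβ0 : ∀ᶠ i in l, 0 < β i := hx0.mono fun i hi => mul_pos (hρ0 i) hi
  set M := (φ.totalVariation univ).toReal with hM
  set S := (∫⁻ x, ‖ψ x‖ₑ ^ 2).toReal with hS
  set K := max (S / c ^ 2) (2 * M / c) with hK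
  have hm := measurable_grainValue hC φ
  have key := hF.tendsto_integral_rescaled hF0 hγ hγ2 hx
    (g := fun i w => ∫ y, compExp (grainValue C φ (y, β i * w) / (c * β i)))
    (g₀ := fun w => ∫ y, compExp (w * (ψ y / c))) (K := K) (fun i => ?_) ?_ ?_ ?_
  -- As γ λ F̄(x) → 1, the prefactor F̄(x)⁻¹ of the rescaling theorem may be replaced by γλ. The γ
  -- then cancels the one in the limiting density.
  · have h1 := (hF.tendsto_mul_tail_tailQuantile.comp hgl).smul key
    have h2 := h1.const_smul γ⁻¹
    rw [one_smul, ← integral_smul] at h2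
    simp_rw [mul_smul, inv_smul_smul₀ hγ0.ne'] at h2
    refine h2.congr' ?_
    filter_upwards [hx0] with i hi
    have hint : Integrable (fun p => compExp (grainValue C φ p / (c * β i)))
        (grainIntensity d F (lam i) (ρ i)) :=
      integrable_compExp ((integrable_grainValue hd hC hC1.le hF0 hmean (hρ0 i) φ).div_const _)
    have hsm : StronglyMeasurable fun p => compExp (grainValue C φ p / (c * β i)) :=
      (continuous_compExp.measurable.comp (hm.div_const _)).stronglyMeasurable
    rw [tailQuantile_scaledLaw (hρ0 i)]
    change _ = ∫ p, compExp (grainValue C φ p / (c * β i)) ∂_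
    rw [integral_grainIntensity (hlam0 i) hsm hint]
    have hβx : ∀ v, β i * (v / x i) = ρ i * v := fun v => by
      simp only [hβdef]; field_simp
    simp_rw [hβx, smul_smul]
    congr 1
    have := (hF.tail_pos (x i)).ne'
    simp only [Function.comp_apply]
    change γ⁻¹ * (γ * lam i * tail F (x i) * (tail F (x i))⁻¹) = lam i
    field_simp
  · have hmm : Measurable fun p : EuclideanSpace ℝ (Fin d) × ℝ =>
        grainValue C φ (p.1, β i * p.2) / (c * β i) :=
      (hm.comp (measurable_fst.prodMk (measurable_snd.const_mul _))).div_const _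
    exact (continuous_compExp.measurable.comp hmm).stronglyMeasurable.integral_prod_left'
  · filter_upwards [hβ0] with i hi w hw
    refine (norm_integral_compExp_grainValue_withDensityᵥ_le hd hC hC1.le hψm hψ hψ2
      (mul_pos hi hw)).trans ?_
    have e : (β i * w / (c * β i)) ^ 2 * S = S / c ^ 2 * w ^ 2 := by field_simp
    rw [e, Real.rpow_two]
    exact mul_le_mul_of_nonneg_right (le_max_left _ _) (sq_nonneg w)
  · filter_upwards [hβ0] with i hi w hw
    refine (norm_integral_compExp_grainValue_le hd hC hC1.le φ (mul_pos hc hi)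
      (mul_pos hi hw)).trans ?_
    have e : 2 * (β i * w / (c * β i) * M) = 2 * M / c * w := by field_simp
    rw [e]
    exact mul_le_mul_of_nonneg_right (le_max_right _ _) hw.le
  · intro w w₀ hw₀ hw
    exact tendsto_integral_compExp_grainValue_withDensityᵥ hd hC hCb hC1 hψm hψ hβ hβ0 hw₀ hw

end SmallGrain

/-! ### The stable limit -/

section StableLimit

variable {d : ℕ} {C : Set (EuclideanSpace ℝ (Fin d))} {γ : ℝ}

lemma rpow_le_add_sq {γ : ℝ} (hγ1 : 1 ≤ γ) (hγ2 : γ ≤ 2) {y : ℝ} (hy : 0 ≤ y) :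
    y ^ γ ≤ y + y ^ 2 := by
  rcases le_total y 1 with h | h
  · have := Real.rpow_le_rpow_of_exponent_ge' hy h zero_le_one hγ1
    rw [Real.rpow_one] at this
    nlinarith [sq_nonneg y]
  · have := Real.rpow_le_rpow_of_exponent_le h hγ2
    rw [Real.rpow_two] at this
    linarith

lemma integrable_rpow_of_memLp {α : Type*} [MeasurableSpace α] {μ : Measure α} (hγ1 : 1 ≤ γ)
    (hγ2 : γ ≤ 2) {ψ : α → ℝ} (h1 : MemLp ψ 1 μ) (h2 : MemLp ψ 2 μ) :
    Integrable (fun x => |ψ x| ^ γ) μ := by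
  refine Integrable.mono' ((memLp_one_iff_integrable.1 h1).abs.add h2.integrable_sq)
    ((h1.aestronglyMeasurable.aemeasurable.abs.pow_const γ).aestronglyMeasurable)
    (ae_of_all _ fun x => ?_)
  rw [Real.norm_of_nonneg (by positivity)]
  have := rpow_le_add_sq hγ1 hγ2 (abs_nonneg (ψ x))
  rwa [sq_abs] at this

lemma memLp_ofReal_of_memLp (hγ1 : 1 ≤ γ) (hγ2 : γ ≤ 2) {ψ : EuclideanSpace ℝ (Fin d) → ℝ}
    (h1 : MemLp ψ 1) (h2 : MemLp ψ 2) : MemLp ψ (ENNReal.ofReal γ) := by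
  have h0 : ENNReal.ofReal γ ≠ 0 := by simp; linarith
  rw [← integrable_norm_rpow_iff h1.aestronglyMeasurable h0 ENNReal.ofReal_ne_top,
    ENNReal.toReal_ofReal (by linarith)]
  exact integrable_rpow_of_memLp hγ1 hγ2 h1 h2

lemma stableNorm_rpow (hγ : 0 < γ) {ψ : EuclideanSpace ℝ (Fin d) → ℝ}
    (h : MemLp ψ (ENNReal.ofReal γ)) : stableNorm γ ψ ^ γ = ∫ x, |ψ x| ^ γ := by
  have h0 : ENNReal.ofReal γ ≠ 0 := by simpa using hγ
  have hI : 0 ≤ ∫ x, |ψ x| ^ γ := integral_nonneg fun x => by positivity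
  rw [stableNorm, h.eLpNorm_eq_integral_rpow_norm h0 ENNReal.ofReal_ne_top,
    ENNReal.toReal_ofReal hγ.le]
  simp_rw [Real.norm_eq_abs]
  rw [ENNReal.toReal_ofReal (by positivity), Real.rpow_inv_rpow hI hγ.ne']

lemma stableNorm_rpow_mul_stableSkewness (hγ : 0 < γ) {ψ : EuclideanSpace ℝ (Fin d) → ℝ}
    (h : MemLp ψ (ENNReal.ofReal γ)) :
    stableNorm γ ψ ^ γ * stableSkewness γ ψ =
      ∫ x, (max (ψ x) 0 ^ γ - (-min (ψ x) 0) ^ γ) := by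
  have h0 : ENNReal.ofReal γ ≠ 0 := by simpa using hγ
  have hp : MemLp (fun x => max (ψ x) 0) (ENNReal.ofReal γ) := h.pos_part
  have hn : MemLp (fun x => -min (ψ x) 0) (ENNReal.ofReal γ) := by
    have e : (fun x => -min (ψ x) 0) = fun x => max (-ψ x) 0 :=
      funext fun x => by rw [← max_neg_neg, neg_zero]
    rw [e]
    exact h.neg_part
  have hip := hp.integrable_norm_rpow h0 ENNReal.ofReal_ne_top
  have hin := hn.integrable_norm_rpow h0 ENNReal.ofReal_ne_top
  have hi := h.integrable_norm_rpow h0 ENNReal.ofReal_ne_top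
  rw [ENNReal.toReal_ofReal hγ.le] at hip hin hi
  have ap : ∀ x, |max (ψ x) 0| = max (ψ x) 0 := fun x => abs_of_nonneg (le_max_right _ _)
  have an : ∀ x, |(-min (ψ x) 0)| = -min (ψ x) 0 := fun x =>
    abs_of_nonneg (neg_nonneg.2 (min_le_right _ _))
  simp_rw [Real.norm_eq_abs, ap] at hip
  simp_rw [Real.norm_eq_abs, an] at hin
  simp_rw [Real.norm_eq_abs] at hi
  rw [integral_sub hip hin, stableSkewness, ← mul_assoc]
  have ep := stableNorm_rpow hγ hp
  have en := stableNorm_rpow hγ hn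
  simp_rw [ap] at ep
  simp_rw [an] at en
  rw [ep, en]
  -- For a null ψ the skewness contains 0^{-γ}; the left side is 0 all the same, and so are both
  -- integrals on the right.
  rcases eq_or_ne (stableNorm γ ψ) 0 with hz | hz
  · have e := stableNorm_rpow hγ h
    rw [hz, Real.zero_rpow hγ.ne'] at e
    have bp : ∫ x, max (ψ x) 0 ^ γ ≤ 0 := (integral_mono hip hi fun x =>
      Real.rpow_le_rpow (le_max_right _ _) (max_le (le_abs_self _) (abs_nonneg _)) hγ.le).trans_eq e.symm
    have bn : ∫ x, (-min (ψ x) 0) ^ γ ≤ 0 := (integral_mono hin hi fun x =>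
      Real.rpow_le_rpow (neg_nonneg.2 (min_le_right _ _))
        (neg_le.1 (le_min (neg_abs_le _) (neg_nonpos.2 (abs_nonneg _)))) hγ.le).trans_eq e.symm
    have cp : 0 ≤ ∫ x, max (ψ x) 0 ^ γ :=
      integral_nonneg fun x => Real.rpow_nonneg (le_max_right _ _) _
    have cn : 0 ≤ ∫ x, (-min (ψ x) 0) ^ γ :=
      integral_nonneg fun x => Real.rpow_nonneg (neg_nonneg.2 (min_le_right _ _)) _
    rw [le_antisymm bp cp, le_antisymm bn cn, sub_zero, mul_zero]
  · have hpos : 0 < stableNorm γ ψ := lt_of_le_of_ne ENNReal.toReal_nonneg hz.symm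
    rw [← Real.rpow_add hpos, add_neg_cancel, Real.rpow_zero, one_mul]

lemma stableNorm_congr {ψ ψ' : EuclideanSpace ℝ (Fin d) → ℝ} (h : ψ =ᵐ[volume] ψ') :
    stableNorm γ ψ = stableNorm γ ψ' := by
  rw [stableNorm, stableNorm, eLpNorm_congr_ae h]

lemma stableSkewness_congr {ψ ψ' : EuclideanSpace ℝ (Fin d) → ℝ} (h : ψ =ᵐ[volume] ψ') :
    stableSkewness γ ψ = stableSkewness γ ψ' := by
  have hp : (fun x => max (ψ x) 0) =ᵐ[volume] fun x => max (ψ' x) 0 :=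
    h.mono fun x hx => by simp only [hx]
  have hn : (fun x => -min (ψ x) 0) =ᵐ[volume] fun x => -min (ψ' x) 0 :=
    h.mono fun x hx => by simp only [hx]
  rw [stableSkewness, stableSkewness, stableNorm_congr h, stableNorm_congr hp, stableNorm_congr hn]

/-- Justifies Fubini for the stable exponent. The integral over x is at most min(Bw², Aw), which is
integrable against w^{-γ-1} because 1 < γ < 2. -/
lemma integrable_compExp_mul_stableIntensity (hγ1 : 1 < γ) (hγ2 : γ < 2)
    {y : EuclideanSpace ℝ (Fin d) → ℝ} (hym : Measurable y) (h1 : Integrable y)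
    (h2 : Integrable fun x => y x ^ 2) :
    Integrable (fun p : EuclideanSpace ℝ (Fin d) × ℝ => compExp (p.2 * y p.1))
      (stableIntensity d γ) := by
  have hm : Measurable fun p : EuclideanSpace ℝ (Fin d) × ℝ => compExp (p.2 * y p.1) :=
    continuous_compExp.measurable.comp (measurable_snd.mul (hym.comp measurable_fst))
  refine ⟨hm.aestronglyMeasurable, ?_⟩
  rw [HasFiniteIntegral, lintegral_stableIntensity hm.enorm]
  set A := ∫ x, 2 * |y x| with hA
  set B := ∫ x, y x ^ 2 / 2 with hB
  have hA0 : 0 ≤ A := integral_nonneg fun x => by positivity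
  have hB0 : 0 ≤ B := integral_nonneg fun x => by positivity
  set f : ℝ → ℝ := fun w => w ^ (-γ - 1) * min (B * w ^ 2) (A * w) with hf
  have hbd : ∀ w, 0 < w → ∫⁻ x, ‖compExp (w * y x)‖ₑ ≤
      ENNReal.ofReal (min (B * w ^ 2) (A * w)) := by
    intro w hw
    rw [ENNReal.ofReal_min]
    refine le_min ?_ ?_
    · rw [hB, ← integral_mul_const, ofReal_integral_eq_lintegral_ofReal
        ((h2.div_const 2).mul_const _) (ae_of_all _ fun x => by positivity)]
      refine lintegral_mono fun x => ?_
      rw [← ofReal_norm]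
      refine ENNReal.ofReal_le_ofReal ((norm_compExp_le_sq _).trans (le_of_eq ?_))
      ring
    · rw [hA, ← integral_mul_const, ofReal_integral_eq_lintegral_ofReal
        ((h1.abs.const_mul 2).mul_const _) (ae_of_all _ fun x => by positivity)]
      refine lintegral_mono fun x => ?_
      rw [← ofReal_norm]
      refine ENNReal.ofReal_le_ofReal ((norm_compExp_le_abs _).trans (le_of_eq ?_))
      rw [abs_mul, abs_of_pos hw]
      ring
  have hint : IntegrableOn f (Ioi 0) := by
    have hfm : Measurable f := by fun_prop
    refine integrableOn_Ioi_of_rpow_bounds (A := B) (B := A) (p := 1 - γ) (q := -γ)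
      hfm.aestronglyMeasurable (by linarith) (by linarith) (fun w hw => ?_) (fun w hw => ?_)
    all_goals
      have hnn : 0 ≤ min (B * w ^ 2) (A * w) := le_min (by positivity) (by positivity)
      have hp := Real.rpow_nonneg hw.le (-γ - 1)
      rw [hf, Real.norm_of_nonneg (mul_nonneg hp hnn)]
    · refine (mul_le_mul_of_nonneg_left (min_le_left _ _) hp).trans (le_of_eq ?_)
      rw [← Real.rpow_two, mul_left_comm, ← Real.rpow_add hw]
      congr 2; ring
    · refine (mul_le_mul_of_nonneg_left (min_le_right _ _) hp).trans (le_of_eq ?_)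
      nth_rewrite 2 [← Real.rpow_one w]
      rw [mul_left_comm, ← Real.rpow_add hw]
      congr 2; ring
  refine lt_of_le_of_lt ?_ hint.lintegral_lt_top
  refine setLIntegral_mono' measurableSet_Ioi fun w hw => ?_
  rw [hf, ENNReal.ofReal_mul (Real.rpow_nonneg (le_of_lt hw) _)]
  gcongr
  exact hbd w hw

/-- The cumulant of the stable random measure. -/
lemma integral_rpow_smul_integral_compExp (hγ1 : 1 < γ) (hγ2 : γ < 2)
    {ψ : EuclideanSpace ℝ (Fin d) → ℝ} (hψm : Measurable ψ) (h1 : MemLp ψ 1) (h2 : MemLp ψ 2) :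
    ∫ w in Ioi (0 : ℝ), w ^ (-γ - 1) • ∫ x, compExp (w * (ψ x / stableConst γ)) =
      -((stableNorm γ ψ ^ γ : ℝ) : ℂ) *
        (1 - Complex.I * ((stableSkewness γ ψ * Real.tan (Real.pi * γ / 2) : ℝ) : ℂ)) := by
  have hγ0 : 0 < γ := by linarith
  have hγm := memLp_ofReal_of_memLp hγ1.le hγ2.le h1 h2
  have h1' := memLp_one_iff_integrable.1 h1
  have hint := integrable_compExp_mul_stableIntensity hγ1 hγ2
    (hψm.div_const (stableConst γ)) (h1'.div_const _)
    (by simp_rw [div_pow]; exact h2.integrable_sq.div_const _)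
  have e1 := integral_stableIntensity hint
  rw [← e1]
  rw [stableIntensity] at hint ⊢
  -- Integrating over w first leaves, for each x, the one-dimensional stable exponent at ψ(x).
  rw [integral_prod _ hint]
  have e2 : ∀ x, ∫ w, compExp (w * (ψ x / stableConst γ)) ∂((volume.restrict (Ioi (0 : ℝ))).withDensity
      fun v => ENNReal.ofReal (v ^ (-γ - 1))) = -(((|ψ x| ^ γ : ℝ) : ℂ) - Complex.I *
      (((max (ψ x) 0 ^ γ - (-min (ψ x) 0) ^ γ) * Real.tan (Real.pi * γ / 2) : ℝ) : ℂ)) := by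
    intro x
    rw [← integral_rpow_mul_compExp_mul hγ1 hγ2 (ψ x),
      integral_withDensity_eq_integral_toReal_smul (by fun_prop) (by simp)]
    refine setIntegral_congr_fun measurableSet_Ioi fun v hv => ?_
    rw [ENNReal.toReal_ofReal (Real.rpow_nonneg (le_of_lt hv) _)]
  simp_rw [e2]
  have hi := integrable_rpow_of_memLp hγ1.le hγ2.le h1 h2
  have hsk : Integrable fun x => max (ψ x) 0 ^ γ - (-min (ψ x) 0) ^ γ := by
    refine Integrable.mono' hi (by fun_prop) (ae_of_all _ fun x => ?_)
    rcases le_total 0 (ψ x) with h | h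
    · rw [max_eq_left h, min_eq_right h, neg_zero, Real.zero_rpow hγ0.ne', sub_zero,
        Real.norm_of_nonneg (Real.rpow_nonneg h _), abs_of_nonneg h]
    · rw [max_eq_right h, min_eq_left h, Real.zero_rpow hγ0.ne', zero_sub, norm_neg,
        Real.norm_of_nonneg (Real.rpow_nonneg (neg_nonneg.2 h) _), abs_of_nonpos h]
  rw [integral_neg, integral_sub hi.ofReal ((hsk.mul_const _).ofReal.const_mul _),
    integral_const_mul, integral_complex_ofReal, integral_complex_ofReal, integral_mul_const,
    ← stableNorm_rpow hγ0 hγm, ← stableNorm_rpow_mul_stableSkewness hγ0 hγm]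
  push_cast
  ring

/-- The law of Λ is prescribed for one function at a time. Linearity converts joint characteristic
functions into values at linear combinations. -/
lemma IsStableRandomMeasure.sum_ae_eq {Ω' : Type*} [MeasurableSpace Ω'] {Q : Measure Ω'}
    {Λ : (EuclideanSpace ℝ (Fin d) → ℝ) → Ω' → ℝ} (hΛ : IsStableRandomMeasure γ Λ Q)
    {κ : Type*} (s : Finset κ) (t : κ → ℝ) {φ : κ → EuclideanSpace ℝ (Fin d) → ℝ}
    (hφ : ∀ k, MemLp (φ k) (ENNReal.ofReal γ)) :
    MemLp (∑ k ∈ s, t k • φ k) (ENNReal.ofReal γ) ∧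
      Λ (∑ k ∈ s, t k • φ k) =ᵐ[Q] fun ω => ∑ k ∈ s, t k * Λ (φ k) ω := by
  classical
  induction s using Finset.induction_on with
  | empty =>
    refine ⟨MemLp.zero, ?_⟩
    have := hΛ.linear 0 0 MemLp.zero MemLp.zero 0 0
    simpa using this
  | insert a s ha ih =>
    rw [Finset.sum_insert ha]
    refine ⟨((hφ a).const_smul (t a)).add ih.1, ?_⟩
    have := hΛ.linear (φ a) _ (hφ a) ih.1 (t a) 1
    rw [one_smul] at this
    filter_upwards [this, ih.2] with ω h1 h2
    rw [h1, h2, one_mul, Finset.sum_insert ha]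

lemma withDensityᵥ_sum {κ : Type*} (s : Finset κ) (t : κ → ℝ)
    {φ : κ → EuclideanSpace ℝ (Fin d) → ℝ} (hφ : ∀ k, Integrable (φ k)) :
    volume.withDensityᵥ (∑ k ∈ s, t k • φ k) = ∑ k ∈ s, t k • volume.withDensityᵥ (φ k) := by
  classical
  induction s using Finset.induction_on with
  | empty => simp
  | insert a s ha ih =>
    rw [Finset.sum_insert ha, Finset.sum_insert ha,
      withDensityᵥ_add ((hφ a).smul _) (integrable_finsetSum' _ fun k _ => (hφ k).smul _),
      withDensityᵥ_smul, ih]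

theorem tendstoFDD_smallGrain (hd : 0 < d) (hC : MeasurableSet C)
    (hCb : Bornology.IsBounded C) (hC1 : volume C = 1)
    {F : Measure ℝ} [IsProbabilityMeasure F] (hF : HasRegularlyVaryingTail F γ)
    (hF0 : F (Iic 0) = 0) (hmean : ∫ v, v ∂F = 1) (hγ : 1 < γ) (hγ2 : γ < 2)
    {ι : Type*} {l : Filter ι} [l.IsCountablyGenerated] {lam ρ : ι → ℝ} (hlam0 : ∀ i, 0 < lam i)
    (hρ0 : ∀ i, 0 < ρ i) (hlam : Tendsto lam l atTop) (hρ : Tendsto ρ l (𝓝 0))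
    {Ω : ι → Type*} [∀ i, MeasurableSpace (Ω i)]
    {P : (i : ι) → Measure (Ω i)} [∀ i, IsProbabilityMeasure (P i)]
    {N : (i : ι) → Ω i → Measure (EuclideanSpace ℝ (Fin d) × ℝ)}
    (hN : ∀ i, IsPoissonRandomMeasure (N i) (grainIntensity d F (lam i) (ρ i)) (P i))
    (hlim : Tendsto (fun i => lam i * tail (scaledLaw F (ρ i)) 1) l (𝓝 0))
    {Ω' : Type*} [MeasurableSpace Ω'] {Q : Measure Ω'} [IsProbabilityMeasure Q]
    {Λ : (EuclideanSpace ℝ (Fin d) → ℝ) → Ω' → ℝ} (hΛ : IsStableRandomMeasure γ Λ Q) :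
    TendstoFDD {φ : EuclideanSpace ℝ (Fin d) → ℝ | MemLp φ 1 volume ∧ MemLp φ 2 volume}
      (fun i φ ω => centredGrainField C (N i) (P i) (volume.withDensityᵥ φ) ω /
        (stableConst γ * tailQuantile (scaledLaw F (ρ i)) (γ * lam i))) l Λ P Q := by
  intro n φ hφ
  have hφγ : ∀ k, MemLp (φ k) (ENNReal.ofReal γ) := fun k =>
    memLp_ofReal_of_memLp hγ.le hγ2.le (hφ k).1 (hφ k).2
  refine tendstoInDistribution_of_tendsto_integral_exp (fun i => ?_) ?_ fun t => ?_
  · refine aemeasurable_pi_lambda _ fun k => AEMeasurable.div_const ?_ _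
    exact ((hN i).aemeasurable_compensatedIntegral
      (integrable_grainValue hd hC hC1.le hF0 hmean (hρ0 i) _)).congr
      (centredGrainField_ae_eq (hN i) hd hC hC1.le hF0 hmean (hρ0 i) _).symm
  · exact aemeasurable_pi_lambda _ fun k => hΛ.aemeasurable _ (hφγ k)
  · obtain ⟨hm, hsum⟩ := hΛ.sum_ae_eq Finset.univ t hφγ
    have hlimit : ∫ ω, Complex.exp ((∑ k, t k * Λ (φ k) ω : ℝ) * Complex.I) ∂Q =
        Complex.exp (-((stableNorm γ (∑ k, t k • φ k) ^ γ : ℝ) : ℂ) * (1 - Complex.I *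
          ((stableSkewness γ (∑ k, t k • φ k) * Real.tan (Real.pi * γ / 2) : ℝ) : ℂ))) := by
      rw [← hΛ.charFun_eq _ hm]
      refine integral_congr_ae (hsum.mono fun ω hω => ?_)
      simp only [hω, mul_comm]
    rw [hlimit]
    refine Tendsto.congr (fun i => (integral_exp_sum_centredGrainField (hN i) hd hC hC1.le hF0
      hmean (hρ0 i) Finset.univ t (fun k => volume.withDensityᵥ (φ k)) _).symm) ?_
    refine (Complex.continuous_exp.tendsto _).comp ?_
    have hi : ∀ k, Integrable (φ k) := fun k => memLp_one_iff_integrable.1 (hφ k).1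
    have h1 : MemLp (∑ k, t k • φ k) 1 :=
      memLp_finsetSum' _ fun k _ => (hφ k).1.const_smul _
    have h2 : MemLp (∑ k, t k • φ k) 2 :=
      memLp_finsetSum' _ fun k _ => (hφ k).2.const_smul _
    rw [← withDensityᵥ_sum _ _ hi]
    -- A measurable version is needed for the Fubini arguments. Neither the signed measure nor the
    -- stable parameters notice the change.
    obtain ⟨ψ, hψm, hψ⟩ := h1.aestronglyMeasurable.aemeasurable
    rw [stableNorm_congr hψ, stableSkewness_congr hψ,
      WithDensityᵥEq.congr_ae hψ]
    have h1' := h1.ae_eq hψ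
    have h2' := h2.ae_eq hψ
    rw [← integral_rpow_smul_integral_compExp hγ hγ2 hψm h1' h2']
    refine tendsto_integral_smallGrain hd hC hCb hC1 hF hF0 hmean hγ hγ2 (stableConst_pos hγ hγ2)
      hlam0 hρ0 hlam hρ hlim hψm (memLp_one_iff_integrable.1 h1') ?_
    simp_rw [enorm_sq_eq_ofReal]
    exact (h2'.integrable_sq.lintegral_lt_top).ne

end StableLimit

end

/-! ### The three scaling regimes together -/

theorem theorem2 {d : ℕ} (hd : 0 < d)
    -- the grain shape
    (C : Set (EuclideanSpace ℝ (Fin d))) (hCm : MeasurableSet C) (hCb : Bornology.IsBounded C)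
    (hC : volume C = 1) (hCf : volume (frontier C) = 0)
    -- the law `F` of the normalised grain volume
    (F : Measure ℝ) [IsProbabilityMeasure F] (hFpos : F (Iic 0) = 0) (hFmean : ∫ v, v ∂F = 1)
    (γ : ℝ) (hγ1 : 1 < γ) (hγ2 : γ < 2) (hF : HasRegularlyVaryingTail F γ)
    (α : ℝ) (hα0 : 0 < α) (hα : α < 2 - γ)
    -- the scaling: mean grain densities tending to infinity, mean grain volumes tending to zero
    {ι : Type*} (l : Filter ι) [l.IsCountablyGenerated] (lam ρ : ι → ℝ)
    (hlam0 : ∀ i, 0 < lam i) (hρ0 : ∀ i, 0 < ρ i)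
    (hlam : Tendsto lam l atTop) (hρ : Tendsto ρ l (𝓝 0))
    -- the Poisson random measures that drive the grain fields
    {Ω : ι → Type*} [∀ i, MeasurableSpace (Ω i)] (P : (i : ι) → Measure (Ω i))
    [∀ i, IsProbabilityMeasure (P i)]
    (N : (i : ι) → Ω i → Measure (EuclideanSpace ℝ (Fin d) × ℝ))
    (hN : ∀ i, IsPoissonRandomMeasure (N i) (grainIntensity d F (lam i) (ρ i)) (P i)) :
    -- (i) large-grain scaling
    ((∃ (Ω' : Type) (_ : MeasurableSpace Ω') (Q : Measure Ω') (_ : IsProbabilityMeasure Q)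
        (W : SignedMeasure (EuclideanSpace ℝ (Fin d)) → Ω' → ℝ), IsLargeGrainLimit γ C W Q) ∧
      (Tendsto (fun i => lam i * tail (scaledLaw F (ρ i)) 1) l atTop →
        ∀ (Ω' : Type*) [MeasurableSpace Ω'] (Q : Measure Ω') [IsProbabilityMeasure Q]
          (W : SignedMeasure (EuclideanSpace ℝ (Fin d)) → Ω' → ℝ), IsLargeGrainLimit γ C W Q →
          TendstoFDD (rieszSpace d α)
            (fun i φ ω => centredGrainField C (N i) (P i) φ ω /
              (γ * lam i * tail (scaledLaw F (ρ i)) 1) ^ (1 / 2 : ℝ))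
            l W P Q)) ∧
    -- (ii) intermediate scaling
    (∀ (Ω' : Type*) [MeasurableSpace Ω'] (Q : Measure Ω') [IsProbabilityMeasure Q]
        (Nγ : Ω' → Measure (EuclideanSpace ℝ (Fin d) × ℝ)),
        IsPoissonRandomMeasure Nγ (stableIntensity d γ) Q →
        (∀ φ ∈ rieszSpace d (2 - γ), ∃ X : Ω' → ℝ,
          IsCentredPoissonIntegral Nγ (stableIntensity d γ) Q
            (fun p => φ (grain C p.1 p.2)) X) ∧
        (∀ σ₀ : ℝ, 0 < σ₀ →
          Tendsto (fun i => lam i * tail (scaledLaw F (ρ i)) 1) l (𝓝 σ₀) →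
          TendstoFDD (rieszSpace d α)
            (fun i φ ω => centredGrainField C (N i) (P i) φ ω)
            l (fun φ => intermediateField γ C Nγ Q
              (dilate ((γ * σ₀) ^ (1 / ((γ - 1) * d))) φ)) P Q)) ∧
    -- (iii) small-grain scaling
    (Tendsto (fun i => lam i * tail (scaledLaw F (ρ i)) 1) l (𝓝 0) →
      ∀ (Ω' : Type*) [MeasurableSpace Ω'] (Q : Measure Ω') [IsProbabilityMeasure Q]
        (Λ : (EuclideanSpace ℝ (Fin d) → ℝ) → Ω' → ℝ), IsStableRandomMeasure γ Λ Q →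
        TendstoFDD {φ : EuclideanSpace ℝ (Fin d) → ℝ | MemLp φ 1 volume ∧ MemLp φ 2 volume}
          (fun i φ ω => centredGrainField C (N i) (P i) (volume.withDensityᵥ φ) ω /
            (stableConst γ * tailQuantile (scaledLaw F (ρ i)) (γ * lam i)))
          l Λ P Q) := by
  refine ⟨⟨exists_isLargeGrainLimit hd hCm hCb hC.le hγ1, ?_⟩, ?_, ?_⟩
  · intro hlim Ω' _ Q _ W hW
    exact tendstoFDD_largeGrain hd hCm hCb hC.le hCf hF hFpos hFmean hγ1 hα hlam0 hρ0 hρ hN hlim hW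
  · intro Ω' _ Q _ Nγ hNγ
    exact ⟨fun φ hφ => exists_isCentredPoissonIntegral hd hCm hCb hC.le hγ1 hNγ hφ,
      fun σ₀ hσ₀ hlim => tendstoFDD_intermediate hd hCm hCb hC.le hCf hF hFpos hFmean hγ1 hα hlam0
        hρ0 hρ hN hσ₀ hlim hNγ⟩
  · intro hlim Ω' _ Q _ Λ hΛ
    exact tendstoFDD_smallGrain hd hCm hCb hC hF hFpos hFmean hγ1 hγ2 hlam0 hρ0 hlam hρ hN hlim hΛ
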